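/- Let $\xi$ be space-time white noise on $\mathbb{R}\times\mathbb{R}^2$ over a probability space $(\boldsymbol\Omega,\mathcal F,\mathbf P)$ with expectation $\mathbf E$. Let $\phi:\mathbb{R}\to[0,\infty)$ and $\psi:\mathbb{R}^2\to[0,\infty)$ be smooth, with $\phi$ supported in $[0,1]$ and $\psi$ symmetric ($\psi(-y)=\psi(y)$) and supported in $\{|y|\le 1/2\}$. Let $$V(t,x)=\int_{\mathbb{R}^{1+2}}\phi(t-s)\,\psi(x-y)\,d\xi(s,y)$$ (in a version with continuous sample paths), and let $R(s,y)=\mathbf E[V(s,y)V(0,0)]$ be its correlation function. Let $\hat\beta\in\mathbb{R}$ and $\epsilon\in(0,1)$, and let $u$ be, for almost every realization of the noise, the classical solution, with at most exponential growth in $x$ uniformly on bounded time intervals, of $$\partial_t u=\tfrac12\Delta u+\frac{\hat\beta}{\sqrt{\log\frac1\epsilon}}\,u\,V\quad\text{on }(0,\infty)\times\mathbb{R}^2,\qquad u(0,x)=1 .$$ For $t\ge 0$ let $W_t$ be the Wiener measure on $\Omega_t=\{B\in C([0,t];\mathbb{R}^2): B(0)=0\}$, and let $$\zeta_t^{(\epsilon)}=\log\int_{\Omega_t}\exp\Big(\frac{\hat\beta^2}{2\log\frac1\epsilon}\int_{[0,t]^2}R(s-r,B(s)-B(r))\,ds\,dr\Big)W_t(dB),$$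 $$\hat{\mathbb P}_t^{(\epsilon)}(dB)=\exp\Big(\frac{\hat\beta^2}{2\log\frac1\epsilon}\int_{[0,t]^2}R(s-r,B(s)-B(r))\,ds\,dr-\zeta_t^{(\epsilon)}\Big)W_t(dB).$$ Then $\hat{\mathbb P}_t^{(\epsilon)}$ is a probability measure and, for every $n\in\mathbb{N}$, $t\ge0$ and $x\in\mathbb{R}^2$, both expectations below are finite and $$e^{-n\zeta_t^{(\epsilon)}}\,\mathbf E[u(t,x)^n]=\hat{\mathbb E}_{B^1,\dots,B^n;t}\Big[\exp\Big(\frac{\hat\beta^2}{\log\frac1\epsilon}\sum_{1\le i<j\le n}\int_{[0,t]^2}R(s-r,B^i(s)-B^j(r))\,ds\,dr\Big)\Big],$$ where $\hat{\mathbb E}_{B^1,\dots,B^n;t}$ is the expectation over $n$ independent paths $B^1,\dots,B^n$ with law $\hat{\mathbb P}_t^{(\epsilon)}$. -/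

import Mathlib

open MeasureTheory ProbabilityTheory InnerProductSpace Set
open scoped ENNReal NNReal

noncomputable section

namespace MollifiedSHE

/-- The Euclidean plane. -/
abbrev Plane : Type := EuclideanSpace ℝ (Fin 2)

/-! ### The noise -/

/-- Space-time white noise on `ℝ × ℝ²`, as an isonormal Gaussian process over `L²(ℝ × ℝ²)`:
`ξ f` is the Wiener integral `∫ f dξ`, and `ξ` is a centred Gaussian family with
`E[ξ f * ξ g] = ⟨f, g⟩`. -/
structure IsWhiteNoise {Ω : Type*} [MeasurableSpace Ω] (P : Measure Ω)
    (ξ : Lp ℝ 2 (volume : Measure (ℝ × Plane)) → Ω → ℝ) : Prop where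
  gaussian : IsGaussianProcess ξ P
  mean_zero : ∀ f, ∫ ω, ξ f ω ∂P = 0
  covariance : ∀ f g, ∫ ω, ξ f ω * ξ g ω ∂P = inner ℝ f g

/-- The mollifiers: `φ` (in time) and `ψ` (in space) are nonnegative smooth functions,
`φ` vanishes off `[0, 1]`, `ψ` is symmetric and vanishes off the closed disc of radius `1/2`. -/
structure IsMollifierPair (φ : ℝ → ℝ) (ψ : Plane → ℝ) : Prop where
  smooth_time : ContDiff ℝ (⊤ : ℕ∞) φ
  nonneg_time : ∀ s, 0 ≤ φ s
  support_time : ∀ s, s ∉ Icc (0 : ℝ) 1 → φ s = 0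
  smooth_space : ContDiff ℝ (⊤ : ℕ∞) ψ
  nonneg_space : ∀ y, 0 ≤ ψ y
  symm_space : ∀ y, ψ (-y) = ψ y
  support_space : ∀ y, 1 / 2 < ‖y‖ → ψ y = 0

/-- The function `(s, y) ↦ φ (t - s) ψ (x - y)`. -/
def noiseKernel (φ : ℝ → ℝ) (ψ : Plane → ℝ) (t : ℝ) (x : Plane) (p : ℝ × Plane) : ℝ :=
  φ (t - p.1) * ψ (x - p.2)

theorem IsMollifierPair.memLp_noiseKernel {φ : ℝ → ℝ} {ψ : Plane → ℝ}
    (h : IsMollifierPair φ ψ) (t : ℝ) (x : Plane) :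
    MemLp (noiseKernel φ ψ t x) 2 (volume : Measure (ℝ × Plane)) := by
  have hφ := h.smooth_time.continuous
  have hψ := h.smooth_space.continuous
  have hc : Continuous (noiseKernel φ ψ t x) := by
    unfold noiseKernel
    fun_prop
  refine hc.memLp_of_hasCompactSupport ?_
  refine HasCompactSupport.intro
    ((isCompact_Icc (a := t - 1) (b := t)).prod (isCompact_closedBall x (1 / 2))) ?_
  rintro ⟨s, y⟩ hp
  unfold noiseKernel
  by_cases hs : t - s ∈ Icc (0 : ℝ) 1
  · have hy : y ∉ Metric.closedBall x (1 / 2) := fun hy =>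
      hp ⟨⟨by linarith [hs.2], by linarith [hs.1]⟩, hy⟩
    rw [Metric.mem_closedBall, dist_comm, dist_eq_norm, not_le] at hy
    simp [h.support_space _ hy]
  · simp [h.support_time _ hs]

/-- `V` is the mollified noise `V(t,x) = ∫ φ(t-s) ψ(x-y) dξ(s,y)`: a version of this family of
Wiener integrals with continuous sample paths. -/
structure IsMollifiedNoise {Ω : Type*} [MeasurableSpace Ω] (P : Measure Ω)
    (ξ : Lp ℝ 2 (volume : Measure (ℝ × Plane)) → Ω → ℝ) {φ : ℝ → ℝ} {ψ : Plane → ℝ}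
    (h : IsMollifierPair φ ψ) (V : ℝ → Plane → Ω → ℝ) : Prop where
  eq_integral : ∀ t x, V t x =ᵐ[P] ξ ((h.memLp_noiseKernel t x).toLp (noiseKernel φ ψ t x))
  continuous_paths : ∀ᵐ ω ∂P, Continuous fun p : ℝ × Plane => V p.1 p.2 ω

/-- The correlation function `R(s,y) = E[V(s,y) V(0,0)]`. -/
def correlation {Ω : Type*} [MeasurableSpace Ω] (P : Measure Ω) (V : ℝ → Plane → Ω → ℝ)
    (s : ℝ) (y : Plane) : ℝ :=
  ∫ ω, V s y ω * V 0 0 ω ∂P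

/-! ### The equation -/

/-- `u` is a classical solution on `[0, ∞) × ℝ²` of `∂ₜ u = ½ Δ u + b u v`, `u(0, ·) = 1`, with at
most exponential growth in `x`, uniformly on bounded time intervals. (Some growth restriction is
what singles out the solution of the Cauchy problem for a parabolic equation on the plane.) -/
structure IsSolution (b : ℝ) (v : ℝ → Plane → ℝ) (u : ℝ → Plane → ℝ) : Prop where
  initial : ∀ x, u 0 x = 1
  continuousOn : ContinuousOn (fun p : ℝ × Plane => u p.1 p.2) (Ici 0 ×ˢ univ)
  differentiable_time : ∀ t x, 0 < t → DifferentiableAt ℝ (fun s => u s x) t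
  contDiff_space : ∀ t, 0 < t → ContDiff ℝ 2 (u t)
  continuousOn_deriv_time :
    ContinuousOn (fun p : ℝ × Plane => deriv (fun s => u s p.2) p.1) (Ioi 0 ×ˢ univ)
  continuousOn_deriv_space :
    ContinuousOn (fun p : ℝ × Plane => fderiv ℝ (u p.1) p.2) (Ioi 0 ×ˢ univ)
  continuousOn_deriv_deriv_space :
    ContinuousOn (fun p : ℝ × Plane => fderiv ℝ (fderiv ℝ (u p.1)) p.2) (Ioi 0 ×ˢ univ)
  equation : ∀ t x, 0 < t →
    deriv (fun s => u s x) t = 1 / 2 * Laplacian.laplacian (u t) x + b * u t x * v t x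
  growth : ∀ T : ℝ, ∃ C a : ℝ, ∀ t ∈ Icc 0 T, ∀ x, |u t x| ≤ C * Real.exp (a * ‖x‖)

/-- The coupling constant `β̂ / √(log (1/ε))`. -/
def coupling (β ε : ℝ) : ℝ := β / √(Real.log (1 / ε))

/-! ### Wiener measure and its exponential tilting -/

/-- The space of continuous paths `[0, T] → ℝ²` started at `0`. -/
def PathSpace (T : ℝ) : Type :=
  {w : C(Icc (0 : ℝ) T, Plane) // ∀ s : Icc (0 : ℝ) T, (s : ℝ) = 0 → w s = 0}

/-- The topology of uniform convergence. -/
instance (T : ℝ) : TopologicalSpace (PathSpace T) :=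
  inferInstanceAs (TopologicalSpace {w : C(Icc (0 : ℝ) T, Plane) // ∀ s : Icc (0 : ℝ) T, (s : ℝ) = 0 → w s = 0})

instance (T : ℝ) : MeasurableSpace (PathSpace T) := borel _

instance (T : ℝ) : BorelSpace (PathSpace T) := ⟨rfl⟩

instance (T : ℝ) : CoeFun (PathSpace T) fun _ => Icc (0 : ℝ) T → Plane := ⟨fun w => w.1⟩

/-- `W` is the Wiener measure on `PathSpace T`: under `W` the coordinate process is the standard
two-dimensional Brownian motion on `[0, T]` started at `0`, i.e. the centred Gaussian process with
`E[wᵢ(s) wⱼ(r)] = δᵢⱼ min(s, r)`. Since the evaluations generate the Borel sets, this determines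
`W`. -/
structure IsWienerMeasure {T : ℝ} (W : Measure (PathSpace T)) : Prop where
  gaussian : IsGaussianProcess (fun (s : Icc (0 : ℝ) T) (w : PathSpace T) => w s) W
  mean_zero : ∀ s i, ∫ w : PathSpace T, w s i ∂W = 0
  covariance : ∀ (s r : Icc (0 : ℝ) T) (i j : Fin 2),
    ∫ w : PathSpace T, w s i * w r j ∂W = if i = j then min (s : ℝ) (r : ℝ) else 0

/-- `∫_{[0,T]²} R(s - r, w(s) - w'(r)) ds dr`. -/
def interaction (R : ℝ → Plane → ℝ) {T : ℝ} (w w' : PathSpace T) : ℝ :=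
  ∫ p : Icc (0 : ℝ) T × Icc (0 : ℝ) T, R ((p.1 : ℝ) - p.2) (w p.1 - w' p.2)
    ∂((volume.comap Subtype.val).prod (volume.comap Subtype.val))

/-- The normalization constant `ζ_T`. -/
def zeta (β ε : ℝ) (R : ℝ → Plane → ℝ) {T : ℝ} (W : Measure (PathSpace T)) : ℝ :=
  Real.log (∫ w, Real.exp (β ^ 2 / (2 * Real.log (1 / ε)) * interaction R w w) ∂W)

/-- The exponentially tilted measure `P̂_T`. -/
def tiltedMeasure (β ε : ℝ) (R : ℝ → Plane → ℝ) {T : ℝ} (W : Measure (PathSpace T)) :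
    Measure (PathSpace T) :=
  W.withDensity fun w => ENNReal.ofReal
    (Real.exp (β ^ 2 / (2 * Real.log (1 / ε)) * interaction R w w - zeta β ε R W))

end MollifiedSHE

end

noncomputable section

open Filter Topology

namespace MollifiedSHE

/-! ### The standard Gaussian measure on the plane -/

/-! To a path `w` attach the L² element A(w) = `pathKernel`, the integral over s in [0, t] of the
mollifier kernels at the points (t - s, x + w(s)). The noise collected along `w` is almost surely
the Wiener integral of A(w), and the interaction of two paths is ⟨A(w), A(w')⟩
(`IsMollifiedNoise.interaction_eq`). By Feynman-Kac, u(t, x) is the Wiener average of exp(b ∫ V(t -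
s, x + w(s)) ds) with b the coupling, so its n-th power is an average over n independent paths.
Fubini and the Gaussian Laplace transform turn the n-th moment into the average of exp(b² ‖∑ A(Bᵢ)‖²
/ 2) (`IsContinuousNoise.integrable_pow_and_integral_pow`). In the expanded square, the diagonal
terms are, up to the factor exp(nζ), the densities of the tilted laws, and the off-diagonal terms
are the interactions. Since ‖A(w)‖ is bounded uniformly in `w`, all expectations are finite.

Most of the work is Feynman-Kac for almost every noise (`IsContinuousNoise.feynmanKac_ae`), obtained
without stochastic calculus. Gaussian integration by parts and a spatial cutoff give Duhamel's
formula (`IsSolution.duhamel`). The Markov property allows Duhamel to be started from the position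
of the path at time r and tested against a functional of its past
(`IsWienerMeasure.integral_mul_solution`). With c the growth rate, Z the weight and g = b u v the
source along the path, the choice K = c_r Z_r gives E[c_r Z_r] = E[g_r Z_r] - E ∫_r^t c_r Z_r g_q
dq. Integrated over r, with ∫_0^q c_r Z_r dr = Z_q - 1, this becomes E[Z_t] - 1 = E ∫ g_q dq, which
is u(t, x) - 1 by Duhamel at r = 0 (`IsWienerMeasure.feynmanKac`).

A realization of the noise is unbounded in space, so these Fubini arguments need integrability that
no deterministic bound supplies. It holds for almost every realization because the corresponding
integrals have finite expectation: Gaussian exponential moments are bounded uniformly over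
space-time points and paths by stationarity. -/

/-- The standard Gaussian density on the plane. -/
def gaussDensity (z : Plane) : ℝ := (2 * Real.pi)⁻¹ * Real.exp (-‖z‖ ^ 2 / 2)

theorem gaussDensity_nonneg (z : Plane) : 0 ≤ gaussDensity z := by
  unfold gaussDensity; positivity

theorem continuous_gaussDensity : Continuous gaussDensity := by
  unfold gaussDensity; fun_prop

theorem contDiff_gaussDensity : ContDiff ℝ 1 gaussDensity := by
  unfold gaussDensity
  exact contDiff_const.mul (Real.contDiff_exp.comp ((contDiff_norm_sq ℝ).neg.div_const 2))

theorem fderiv_gaussDensity (z v : Plane) :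
    fderiv ℝ gaussDensity z v = -(inner ℝ v z * gaussDensity z) := by
  have h : HasFDerivAt gaussDensity _ z :=
    (((hasStrictFDerivAt_norm_sq z).hasFDerivAt.neg.mul_const (2⁻¹ : ℝ)).exp).const_mul
      (2 * Real.pi)⁻¹
  rw [h.fderiv]
  simp [gaussDensity, real_inner_comm v z, div_eq_mul_inv]
  ring

theorem integrable_gaussDensity : Integrable gaussDensity := by
  have h : Integrable fun z : Plane => Complex.exp (-(1 / 2 : ℂ) * ‖z‖ ^ 2 + 0 * inner ℝ (0 : Plane) z) :=
    GaussianFourier.integrable_cexp_neg_mul_sq_norm_add (by norm_num) 0 0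
  have h2 := h.norm.const_mul (2 * Real.pi)⁻¹
  refine h2.congr (Eventually.of_forall fun z => ?_)
  simp only [gaussDensity, Complex.norm_exp]
  congr 2
  simp only [zero_mul, add_zero]
  rw [← Complex.ofReal_pow, show (-(1 / 2 : ℂ)) = ((-(1 / 2) : ℝ) : ℂ) by push_cast; ring,
    ← Complex.ofReal_mul, Complex.ofReal_re]
  ring

/-- Both measures are finite and have characteristic function exp(-‖t‖² / 2), the second by the
Fourier integral of a Gaussian. -/
theorem stdGaussian_eq_withDensity :
    stdGaussian Plane = volume.withDensity fun z => ENNReal.ofReal (gaussDensity z) := by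
  have : IsFiniteMeasure (volume.withDensity fun z => ENNReal.ofReal (gaussDensity z)) :=
    isFiniteMeasure_withDensity_ofReal integrable_gaussDensity.hasFiniteIntegral
  refine Measure.ext_of_charFun ?_
  ext t
  rw [charFun_stdGaussian, charFun_apply,
    integral_withDensity_eq_integral_toReal_smul continuous_gaussDensity.measurable.ennreal_ofReal
      (Eventually.of_forall fun z => ENNReal.ofReal_lt_top)]
  have h := GaussianFourier.integral_cexp_neg_mul_sq_norm_add (V := Plane) (b := 1 / 2)
    (by norm_num) Complex.I t
  have e : ∀ z : Plane, (ENNReal.ofReal (gaussDensity z)).toReal • Complex.exp (inner ℝ z t * Complex.I)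
      = (2 * Real.pi : ℂ)⁻¹ * Complex.exp (-(1 / 2) * ‖z‖ ^ 2 + Complex.I * inner ℝ t z) := by
    intro z
    rw [ENNReal.toReal_ofReal (gaussDensity_nonneg z), gaussDensity, Complex.real_smul]
    push_cast
    rw [mul_assoc, ← Complex.exp_add, real_inner_comm]
    congr 2
    ring
  simp_rw [e]
  rw [integral_const_mul, h]
  simp only [finrank_euclideanSpace, Fintype.card_fin, Complex.I_sq]
  have : ((2 : ℕ) / 2 : ℂ) = 1 := by norm_num
  rw [this, Complex.cpow_one, ← mul_assoc]
  have hpi : (Real.pi : ℂ) ≠ 0 := by exact_mod_cast Real.pi_ne_zero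
  have : (2 * Real.pi : ℂ)⁻¹ * (Real.pi / (1 / 2)) = 1 := by field_simp
  rw [this, one_mul]
  congr 1
  ring

/-- Fernique's theorem supplies an integrable exp(C‖z‖²), which dominates after completing the
square. This is what makes the exponential growth allowed for solutions harmless. -/
theorem integrable_exp_norm_stdGaussian (a : ℝ) :
    Integrable (fun z : Plane => Real.exp (a * ‖z‖)) (stdGaussian Plane) := by
  obtain ⟨C, hC, h⟩ := IsGaussian.exists_integrable_exp_sq (stdGaussian Plane)
  refine (h.const_mul (Real.exp (a ^ 2 / (4 * C)))).mono' (by fun_prop)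
    (Eventually.of_forall fun z => ?_)
  rw [Real.norm_eq_abs, Real.abs_exp, ← Real.exp_add, Real.exp_le_exp]
  have : 0 ≤ C * (‖z‖ - a / (2 * C)) ^ 2 := by positivity
  have e : C * (‖z‖ - a / (2 * C)) ^ 2 = a ^ 2 / (4 * C) + C * ‖z‖ ^ 2 - a * ‖z‖ := by
    field_simp; ring
  linarith

theorem integral_stdGaussian (f : Plane → ℝ) :
    ∫ z, f z ∂stdGaussian Plane = ∫ z, gaussDensity z * f z := by
  rw [stdGaussian_eq_withDensity, integral_withDensity_eq_integral_toReal_smul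
    continuous_gaussDensity.measurable.ennreal_ofReal
    (Eventually.of_forall fun z => ENNReal.ofReal_lt_top)]
  simp [ENNReal.toReal_ofReal (gaussDensity_nonneg _)]

/-- Gaussian integration by parts. -/
theorem integral_fderiv_stdGaussian {g : Plane → ℝ} (hg : ContDiff ℝ 1 g)
    (hc : HasCompactSupport g) (v : Plane) :
    ∫ z, fderiv ℝ g z v ∂stdGaussian Plane = ∫ z, inner ℝ v z * g z ∂stdGaussian Plane := by
  have cg := hg.continuous
  have cg' : Continuous fun z => fderiv ℝ g z v := (hg.continuous_fderiv one_ne_zero).clm_apply continuous_const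
  have cd := continuous_gaussDensity
  have cd' : Continuous fun z => fderiv ℝ gaussDensity z v :=
    (contDiff_gaussDensity.continuous_fderiv one_ne_zero).clm_apply continuous_const
  have hc' : HasCompactSupport fun z => fderiv ℝ g z v := hc.fderiv_apply ℝ v
  rw [integral_stdGaussian, integral_stdGaussian,
    integral_mul_fderiv_eq_neg_fderiv_mul_of_integrable
      ((cd'.mul cg).integrable_of_hasCompactSupport hc.mul_left)
      ((cd.mul cg').integrable_of_hasCompactSupport hc'.mul_left)
      ((cd.mul cg).integrable_of_hasCompactSupport hc.mul_left)
      (fun z _ => (contDiff_gaussDensity.differentiable one_ne_zero) z)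
      (fun z _ => (hg.differentiable one_ne_zero) z), ← integral_neg]
  congr 1 with z
  rw [fderiv_gaussDensity]
  ring

/-- Gaussian integration by parts, for the law of `x + σ Z` with `Z` standard Gaussian. -/
theorem integral_fderiv_stdGaussian_affine {g : Plane → ℝ} (hg : ContDiff ℝ 1 g)
    (hc : HasCompactSupport g) (x v : Plane) {σ : ℝ} (hσ : σ ≠ 0) :
    σ * ∫ z, fderiv ℝ g (x + σ • z) v ∂stdGaussian Plane =
      ∫ z, inner ℝ v z * g (x + σ • z) ∂stdGaussian Plane := by
  have haff : ContDiff ℝ 1 fun z : Plane => x + σ • z := by fun_prop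
  have hcomp : HasCompactSupport fun z : Plane => g (x + σ • z) :=
    hc.comp_homeomorph ((Homeomorph.smulOfNeZero σ hσ).trans (Homeomorph.addLeft x))
  have h0 := integral_fderiv_stdGaussian (hg.comp haff) hcomp v
  simp only [Function.comp_apply] at h0
  rw [← h0, ← integral_const_mul]
  congr 1 with z
  have h1 : HasFDerivAt (fun z : Plane => x + σ • z) (σ • ContinuousLinearMap.id ℝ Plane) z :=
    ((hasFDerivAt_id z).const_smul σ).const_add x
  have h2 := ((hg.differentiable one_ne_zero) (x + σ • z)).hasFDerivAt.comp z h1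
  rw [show fderiv ℝ (g ∘ fun z : Plane => x + σ • z) z = _ from h2.fderiv]
  simp

/-- The coordinate vectors of the plane. -/
def unitVec (i : Fin 2) : Plane := EuclideanSpace.single i 1

theorem inner_unitVec (i : Fin 2) (z : Plane) : inner ℝ (unitVec i) z = z i := by
  simp [unitVec, EuclideanSpace.inner_single_left]

theorem sum_smul_unitVec (z : Plane) : ∑ i, z i • unitVec i = z := by
  ext j
  fin_cases j <;> simp [unitVec]

theorem laplacian_eq_sum (f : Plane → ℝ) (y : Plane) :
    Laplacian.laplacian f y = ∑ i, fderiv ℝ (fderiv ℝ f) y (unitVec i) (unitVec i) := by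
  rw [laplacian_eq_iteratedFDeriv_orthonormalBasis f (EuclideanSpace.basisFun (Fin 2) ℝ)]
  simp [iteratedFDeriv_two_apply, unitVec]

/-- The sum of the products of the partial derivatives of `f` and `g`. -/
def gradProd (f g : Plane → ℝ) (y : Plane) : ℝ :=
  ∑ i, fderiv ℝ f y (unitVec i) * fderiv ℝ g y (unitVec i)

theorem gradProd_comm (f g : Plane → ℝ) (y : Plane) : gradProd f g y = gradProd g f y := by
  simp [gradProd, mul_comm]

/-- The direction of differentiation is the Gaussian variable itself. Writing it in coordinates puts
a factor zᵢ in front of each partial derivative, and integration by parts trades that factor for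
another derivative. -/
theorem integral_mul_fderiv_stdGaussian {f g : Plane → ℝ} (hf : ContDiff ℝ 2 f)
    (hg : ContDiff ℝ 2 g) (hc : HasCompactSupport f ∨ HasCompactSupport g) (x : Plane) {σ : ℝ}
    (hσ : σ ≠ 0) :
    ∫ z, f (x + σ • z) * fderiv ℝ g (x + σ • z) z ∂stdGaussian Plane =
      σ * ∫ z, (gradProd f g (x + σ • z) + f (x + σ • z) * Laplacian.laplacian g (x + σ • z))
        ∂stdGaussian Plane := by
  have hg' : ContDiff ℝ 1 (fderiv ℝ g) := hg.fderiv_right (by norm_num)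
  have hf' : ContDiff ℝ 1 (fderiv ℝ f) := hf.fderiv_right (by norm_num)
  -- The components of the vector field f∇g, whose divergence is ∇f·∇g + f Δg.
  set F : Fin 2 → Plane → ℝ := fun i y => f y * fderiv ℝ g y (unitVec i) with hF
  have hFd : ∀ i, ContDiff ℝ 1 (F i) := fun i =>
    (hf.of_le (by norm_num)).mul (hg'.clm_apply contDiff_const)
  have hFc : ∀ i, HasCompactSupport (F i) := fun i => by
    rcases hc with hc | hc
    · exact hc.mul_right
    · exact (hc.fderiv_apply ℝ (unitVec i)).mul_left
  have key : ∀ i, ∀ y, fderiv ℝ (F i) y (unitVec i) =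
      fderiv ℝ f y (unitVec i) * fderiv ℝ g y (unitVec i) +
        f y * fderiv ℝ (fderiv ℝ g) y (unitVec i) (unitVec i) := by
    intro i y
    have h1 := (hf.differentiable (by norm_num) y).hasFDerivAt
    have h2 : HasFDerivAt (fun y => fderiv ℝ g y (unitVec i)) _ y :=
      (hg'.differentiable one_ne_zero y).hasFDerivAt.clm_apply (hasFDerivAt_const (unitVec i) y)
    rw [show fderiv ℝ (F i) y = _ from (h1.mul h2).fderiv]
    simp
    ring
  have haff : Continuous fun z : Plane => x + σ • z := by fun_prop
  have hcomp : ∀ h : Plane → ℝ, HasCompactSupport h →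
      HasCompactSupport fun z : Plane => h (x + σ • z) := fun _ hh =>
    hh.comp_homeomorph ((Homeomorph.smulOfNeZero σ hσ).trans (Homeomorph.addLeft x))
  have lhs : ∀ z, f (x + σ • z) * fderiv ℝ g (x + σ • z) z =
      ∑ i, inner ℝ (unitVec i) z * F i (x + σ • z) := by
    intro z
    conv_lhs => rw [← sum_smul_unitVec z]
    simp only [map_sum, map_smul, smul_eq_mul, Finset.mul_sum, hF, inner_unitVec]
    rw [sum_smul_unitVec]
    refine Finset.sum_congr rfl fun i _ => by ring
  have rhs : ∀ z, gradProd f g (x + σ • z) + f (x + σ • z) * Laplacian.laplacian g (x + σ • z) =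
      ∑ i, fderiv ℝ (F i) (x + σ • z) (unitVec i) := by
    intro z
    rw [laplacian_eq_sum, gradProd, Finset.mul_sum, ← Finset.sum_add_distrib]
    exact Finset.sum_congr rfl fun i _ => (key i _).symm
  simp_rw [lhs, rhs]
  clear_value F
  rw [integral_finsetSum, integral_finsetSum, Finset.mul_sum]
  · exact Finset.sum_congr rfl fun i _ =>
      (integral_fderiv_stdGaussian_affine (hFd i) (hFc i) x (unitVec i) hσ).symm
  · intro i _
    have c : Continuous fun y => fderiv ℝ (F i) y (unitVec i) :=
      ((hFd i).continuous_fderiv one_ne_zero).clm_apply continuous_const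
    have c1 : HasCompactSupport fun y => fderiv ℝ (F i) y (unitVec i) :=
      (hFc i).fderiv_apply ℝ (unitVec i)
    exact Continuous.integrable_of_hasCompactSupport (c.comp haff)
      (hcomp (fun y => fderiv ℝ (F i) y (unitVec i)) c1)
  · intro i _
    have c1 : Continuous fun z : Plane => (inner ℝ (unitVec i) z : ℝ) := by fun_prop
    have c2 : Continuous fun z : Plane => F i (x + σ • z) := (hFd i).continuous.comp haff
    have c3 : HasCompactSupport fun z : Plane => F i (x + σ • z) := hcomp (F i) (hFc i)
    exact (c1.mul c2).integrable_of_hasCompactSupport (HasCompactSupport.mul_left c3)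

/-! ### Cutoff functions -/

theorem continuous_laplacian {f : Plane → ℝ} (hf : ContDiff ℝ 2 f) :
    Continuous (Laplacian.laplacian f) := by
  have h1 : ContDiff ℝ 1 (fderiv ℝ f) := hf.fderiv_right (by norm_num)
  have h2 := h1.continuous_fderiv one_ne_zero
  have : Laplacian.laplacian f = fun y => ∑ i, fderiv ℝ (fderiv ℝ f) y (unitVec i) (unitVec i) :=
    funext (laplacian_eq_sum f)
  rw [this]
  exact continuous_finsetSum _ fun i _ =>
    (h2.clm_apply continuous_const).clm_apply continuous_const

theorem hasCompactSupport_laplacian {f : Plane → ℝ} (hf : HasCompactSupport f) :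
    HasCompactSupport (Laplacian.laplacian f) := by
  refine hf.of_isClosed_subset (isClosed_tsupport _) (closure_minimal ?_ (isClosed_tsupport f))
  intro y hy
  by_contra h
  refine hy ?_
  have h0 : f =ᶠ[𝓝 y] fun _ => 0 := notMem_tsupport_iff_eventuallyEq.mp h
  rw [(laplacian_congr_nhds h0).eq_of_nhds]
  simp

/-- A sequence of smooth compactly supported functions tending to `1`, with uniformly bounded
derivatives tending to `0`. -/
theorem exists_cutoff : ∃ (χ : ℕ → Plane → ℝ) (M : ℝ), (∀ k, ContDiff ℝ 2 (χ k)) ∧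
    (∀ k, HasCompactSupport (χ k)) ∧ (∀ k y, |χ k y| ≤ 1) ∧
    (∀ y, Tendsto (fun k => χ k y) atTop (𝓝 1)) ∧
    (∀ k y, ‖fderiv ℝ (χ k) y‖ ≤ M) ∧ (∀ y, Tendsto (fun k => fderiv ℝ (χ k) y) atTop (𝓝 0)) ∧
    (∀ k y, |Laplacian.laplacian (χ k) y| ≤ M) ∧
    (∀ y, Tendsto (fun k => Laplacian.laplacian (χ k) y) atTop (𝓝 0)) := by
  -- A fixed bump is dilated by k + 1: every derivative costs a factor 1/(k + 1), giving both the
  -- uniform bounds and the limits.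
  let g : ContDiffBump (0 : Plane) := ⟨1, 2, one_pos, one_lt_two⟩
  have hg : ContDiff ℝ 2 (g : Plane → ℝ) := g.contDiff
  have hgc : HasCompactSupport (g : Plane → ℝ) := g.hasCompactSupport
  obtain ⟨M₁, hM₁⟩ := (hgc.fderiv (𝕜 := ℝ)).exists_bound_of_continuous
    (hg.continuous_fderiv two_ne_zero)
  obtain ⟨M₂, hM₂⟩ := (hasCompactSupport_laplacian hgc).exists_bound_of_continuous
    (continuous_laplacian hg)
  let c : ℕ → ℝ := fun k => 1 / ((k : ℝ) + 1)
  have hc0 : ∀ k, 0 < c k := fun k => by positivity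
  have hc1 : ∀ k, c k ≤ 1 := fun k => by
    rw [div_le_one (by positivity)]; linarith [Nat.cast_nonneg (α := ℝ) k]
  have hct : Tendsto c atTop (𝓝 0) := tendsto_one_div_add_atTop_nhds_zero_nat
  have hd : ∀ k y, fderiv ℝ (fun y => g (c k • y)) y = c k • fderiv ℝ g (c k • y) := fun k y =>
    fderiv_comp_smul (c k)
  have hl : ∀ k y, Laplacian.laplacian (fun y => g (c k • y)) y =
      c k * (c k * Laplacian.laplacian (g : Plane → ℝ) (c k • y)) := by
    intro k y
    have e : fderiv ℝ (fun y => g (c k • y)) = fun y => c k • fderiv ℝ g (c k • y) := funext (hd k)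
    have h1 : Differentiable ℝ (fderiv ℝ g) :=
      (hg.fderiv_right (m := 1) (by norm_num)).differentiable one_ne_zero
    have h2 : DifferentiableAt ℝ (fun y => fderiv ℝ g (c k • y)) y :=
      (h1 _).comp y (differentiable_id.const_smul (c k) y)
    have e2 : fderiv ℝ (fun y => c k • fderiv ℝ g (c k • y)) y =
        c k • c k • fderiv ℝ (fderiv ℝ g) (c k • y) := by
      rw [← fderiv_comp_smul (f := fderiv ℝ g)]
      exact (h2.hasFDerivAt.const_smul (c k)).fderiv
    rw [laplacian_eq_sum, laplacian_eq_sum, e, e2]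
    simp
    ring
  have b1 : ∀ k y, ‖fderiv ℝ (fun y => g (c k • y)) y‖ ≤ c k * M₁ := fun k y => by
    rw [hd, norm_smul, Real.norm_of_nonneg (hc0 k).le]
    exact mul_le_mul_of_nonneg_left (hM₁ _) (hc0 k).le
  have hM₂0 : 0 ≤ M₂ := (norm_nonneg _).trans (hM₂ 0)
  have hM₁0 : 0 ≤ M₁ := (norm_nonneg _).trans (hM₁ 0)
  have b2 : ∀ k y, ‖Laplacian.laplacian (fun y => g (c k • y)) y‖ ≤ c k * M₂ := fun k y => by
    rw [hl, norm_mul, norm_mul, Real.norm_of_nonneg (hc0 k).le]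
    refine mul_le_mul_of_nonneg_left ?_ (hc0 k).le
    exact (mul_le_of_le_one_left (norm_nonneg _) (hc1 k)).trans (hM₂ _)
  have z1 : Tendsto (fun k => c k * M₁) atTop (𝓝 0) := by simpa using hct.mul_const M₁
  have z2 : Tendsto (fun k => c k * M₂) atTop (𝓝 0) := by simpa using hct.mul_const M₂
  refine ⟨fun k y => g (c k • y), max M₁ M₂, fun k => hg.comp (contDiff_id.const_smul (c k)),
    fun k => hgc.comp_homeomorph (Homeomorph.smulOfNeZero (c k) (hc0 k).ne'), fun k y => ?_,
    fun y => ?_, fun k y => ?_, fun y => squeeze_zero_norm (fun k => b1 k y) z1, fun k y => ?_,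
    fun y => squeeze_zero_norm (fun k => b2 k y) z2⟩
  · rw [abs_of_nonneg g.nonneg]; exact g.le_one
  · have h1 : Tendsto (fun k => g (c k • y)) atTop (𝓝 (g ((0 : ℝ) • y))) :=
      (g.continuous.tendsto _).comp (hct.smul_const y)
    simpa [g.one_of_mem_closedBall (by simp [g] : (0 : Plane) ∈ Metric.closedBall 0 g.rIn)] using h1
  · exact (b1 k y).trans ((mul_le_of_le_one_left hM₁0 (hc1 k)).trans (le_max_left _ _))
  · exact (b2 k y).trans ((mul_le_of_le_one_left hM₂0 (hc1 k)).trans (le_max_right _ _))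

theorem HasCompactSupport.comp_affine {E : Type*} [Zero E] {h : Plane → E}
    (hh : HasCompactSupport h) (x : Plane) {σ : ℝ} (hσ : σ ≠ 0) :
    HasCompactSupport fun z : Plane => h (x + σ • z) :=
  hh.comp_homeomorph ((Homeomorph.smulOfNeZero σ hσ).trans (Homeomorph.addLeft x))

theorem integrable_mul_fderiv_left {f g : Plane → ℝ} (hf : Continuous f) (hg : ContDiff ℝ 2 g)
    (hc : HasCompactSupport f ∨ HasCompactSupport g) (x : Plane) {σ : ℝ} (hσ : σ ≠ 0) :
    Integrable (fun z => f (x + σ • z) * fderiv ℝ g (x + σ • z) z) (stdGaussian Plane) := by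
  have haff : Continuous fun z : Plane => x + σ • z := by fun_prop
  have hg' := hg.continuous_fderiv two_ne_zero
  refine Continuous.integrable_of_hasCompactSupport
    ((hf.comp haff).mul ((hg'.comp haff).clm_apply continuous_id)) ?_
  rcases hc with hc | hc
  · exact (HasCompactSupport.comp_affine hc x hσ).mul_right
  · have h1 := HasCompactSupport.comp_affine (hc.fderiv (𝕜 := ℝ)) x hσ
    refine HasCompactSupport.mul_left (h1.mono fun z hz => ?_)
    rw [Function.mem_support] at hz ⊢
    intro h0
    exact hz (by rw [h0]; rfl)

theorem integrable_mul_comp_affine {f g : Plane → ℝ} (hf : Continuous f) (hg : Continuous g)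
    (hc : HasCompactSupport f ∨ HasCompactSupport g) (x : Plane) {σ : ℝ} (hσ : σ ≠ 0) :
    Integrable (fun z => f (x + σ • z) * g (x + σ • z)) (stdGaussian Plane) := by
  have haff : Continuous fun z : Plane => x + σ • z := by fun_prop
  refine Continuous.integrable_of_hasCompactSupport ((hf.comp haff).mul (hg.comp haff)) ?_
  rcases hc with hc | hc
  · exact (HasCompactSupport.comp_affine hc x hσ).mul_right
  · exact (HasCompactSupport.comp_affine hc x hσ).mul_left

theorem integrable_gradProd_add {f g : Plane → ℝ} (hf : ContDiff ℝ 2 f)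
    (hg : ContDiff ℝ 2 g) (hc : HasCompactSupport f ∨ HasCompactSupport g) (x : Plane) {σ : ℝ}
    (hσ : σ ≠ 0) :
    Integrable (fun z => gradProd f g (x + σ • z)) (stdGaussian Plane) := by
  refine integrable_finsetSum _ fun i _ => ?_
  refine integrable_mul_comp_affine
    ((hf.continuous_fderiv two_ne_zero).clm_apply (continuous_const (y := unitVec i)))
    ((hg.continuous_fderiv two_ne_zero).clm_apply (continuous_const (y := unitVec i))) ?_ x hσ
  exact hc.imp (fun h => h.fderiv_apply ℝ _) (fun h => h.fderiv_apply ℝ _)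

/-- Applying the preceding integration by parts with the two factors in either order and subtracting
eliminates ∇w·∇χ. The right side contains no first derivative of `w`, which matters because
solutions have a growth bound while their gradients have none. -/
theorem integral_fderiv_mul_stdGaussian {w χ : Plane → ℝ} (hw : ContDiff ℝ 2 w)
    (hχ : ContDiff ℝ 2 χ) (hc : HasCompactSupport χ) (x : Plane) {σ : ℝ} (hσ : σ ≠ 0) :
    ∫ z, (w (x + σ • z) * fderiv ℝ χ (x + σ • z) z + χ (x + σ • z) * fderiv ℝ w (x + σ • z) z)
      ∂stdGaussian Plane =
    ∫ z, (2 * (w (x + σ • z) * fderiv ℝ χ (x + σ • z) z) +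
      σ * (χ (x + σ • z) * Laplacian.laplacian w (x + σ • z) -
        w (x + σ • z) * Laplacian.laplacian χ (x + σ • z))) ∂stdGaussian Plane := by
  have A := integral_mul_fderiv_stdGaussian hχ hw (.inl hc) x hσ
  have B := integral_mul_fderiv_stdGaussian hw hχ (.inr hc) x hσ
  have i1 := integrable_mul_fderiv_left hw.continuous hχ (.inr hc) x hσ
  have i2 := integrable_mul_fderiv_left hχ.continuous hw (.inl hc) x hσ
  have i3 := integrable_mul_comp_affine hχ.continuous (continuous_laplacian hw) (.inl hc) x hσ
  have i4 := integrable_mul_comp_affine hw.continuous (continuous_laplacian hχ)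
    (.inr (hasCompactSupport_laplacian hc)) x hσ
  have i5 := integrable_gradProd_add hχ hw (.inl hc) x hσ
  have i6 := integrable_gradProd_add hw hχ (.inr hc) x hσ
  have i7 : Integrable (fun z => χ (x + σ • z) * Laplacian.laplacian w (x + σ • z) -
    w (x + σ • z) * Laplacian.laplacian χ (x + σ • z)) (stdGaussian Plane) := i3.sub i4
  rw [integral_add i1 i2, integral_add (i1.const_mul 2) (i7.const_mul σ),
    integral_const_mul, integral_const_mul, integral_sub i3 i4, A, B, integral_add i5 i3,
    integral_add i6 i4]
  simp_rw [gradProd_comm χ w]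
  ring

/-! ### Duhamel's formula -/

section Duhamel

variable {b : ℝ} {v u : ℝ → Plane → ℝ}

/-- The point `y + √(q - r) z`, reached from `y` at time `r` by a Brownian path with standardized
increment `z` at time `q`. -/
def diffuse (r : ℝ) (y : Plane) (q : ℝ) (z : Plane) : Plane := y + √(q - r) • z

@[fun_prop]
theorem continuous_diffuse (r : ℝ) (y : Plane) :
    Continuous fun p : ℝ × Plane => diffuse r y p.1 p.2 := by
  unfold diffuse; fun_prop

/-- Continuity of the partial derivatives upgrades separate to joint differentiability; the chain
rule along a point moving in both time and space needs the joint version. -/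
theorem IsSolution.hasFDerivAt (hu : IsSolution b v u) {s : ℝ} (hs : 0 < s) (y : Plane) :
    HasFDerivAt (fun p : ℝ × Plane => u p.1 p.2)
      ((ContinuousLinearMap.toSpanSingleton ℝ (deriv (fun s => u s y) s)).coprod
        (fderiv ℝ (u s) y)) (s, y) := by
  have hn : (Ioi (0 : ℝ) ×ˢ (univ : Set Plane)) ∈ 𝓝 (s, y) :=
    (isOpen_Ioi.prod isOpen_univ).mem_nhds ⟨hs, trivial⟩
  have key := hasStrictFDerivAt_uncurry_coprod (𝕜 := ℝ) (u := (s, y)) (f := u)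
    (f₁ := fun s y => ContinuousLinearMap.toSpanSingleton ℝ (deriv (fun s => u s y) s))
    (f₂ := fun s y => fderiv ℝ (u s) y)
    (by
      filter_upwards [hn] with p hp
      exact (hu.differentiable_time p.1 p.2 hp.1).hasDerivAt.hasFDerivAt)
    (by
      filter_upwards [hn] with p hp
      exact (((hu.contDiff_space p.1 hp.1).differentiable two_ne_zero) p.2).hasFDerivAt)
    (by
      have h1 : ContinuousAt (fun p : ℝ × Plane => deriv (fun s => u s p.2) p.1) (s, y) :=
        hu.continuousOn_deriv_time.continuousAt hn
      have h2 : Continuous fun a : ℝ => ContinuousLinearMap.toSpanSingleton ℝ a :=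
        (ContinuousLinearMap.toSpanSingletonCLE (𝕜 := ℝ) (E := ℝ)).continuous
      exact h2.continuousAt.comp h1)
    (hu.continuousOn_deriv_space.continuousAt hn)
  exact key.hasFDerivAt

theorem hasDerivAt_diffuse {r q : ℝ} (hq : r < q) (y z : Plane) :
    HasDerivAt (fun q => diffuse r y q z) ((1 / (2 * √(q - r))) • z) q := by
  have h1 : HasDerivAt (fun q => √(q - r)) (1 / (2 * √(q - r))) q := by
    simpa using ((hasDerivAt_id q).sub_const r).sqrt (sub_pos.2 hq).ne'
  exact (h1.smul_const z).const_add y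

/-- The time derivative of `χ u` along a diffusing point, backwards in the time of `u`. -/
def cutoffDeriv (χ : Plane → ℝ) (u : ℝ → Plane → ℝ) (t r : ℝ) (y : Plane) (q : ℝ) (z : Plane) : ℝ :=
  1 / (2 * √(q - r)) *
    (u (t - q) (diffuse r y q z) * fderiv ℝ χ (diffuse r y q z) z +
      χ (diffuse r y q z) * fderiv ℝ (u (t - q)) (diffuse r y q z) z) -
    χ (diffuse r y q z) * deriv (fun s => u s (diffuse r y q z)) (t - q)

theorem IsSolution.hasDerivAt_cutoff (hu : IsSolution b v u) {χ : Plane → ℝ}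
    (hχ : ContDiff ℝ 2 χ) {t r q : ℝ} (hr : r < q) (hq : q < t) (y z : Plane) :
    HasDerivAt (fun q => χ (diffuse r y q z) * u (t - q) (diffuse r y q z))
      (cutoffDeriv χ u t r y q z) q := by
  have h1 := hasDerivAt_diffuse hr y z
  have h2 : HasDerivAt (fun q => t - q) (-1) q := by simpa using (hasDerivAt_id q).const_sub t
  have h3 := (hu.hasFDerivAt (sub_pos.2 hq) (diffuse r y q z)).comp_hasDerivAt q (h2.prodMk h1)
  have h4 := ((hχ.differentiable two_ne_zero) (diffuse r y q z)).hasFDerivAt.comp_hasDerivAt q h1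
  refine (h4.mul h3).congr_deriv ?_
  simp [cutoffDeriv]
  ring

theorem IsSolution.continuousOn_cutoffDeriv (hu : IsSolution b v u) {χ : Plane → ℝ}
    (hχ : ContDiff ℝ 2 χ) (t r : ℝ) (y : Plane) :
    ContinuousOn (fun p : ℝ × Plane => cutoffDeriv χ u t r y p.1 p.2) (Ioo r t ×ˢ univ) := by
  have hm : ContinuousOn (fun p : ℝ × Plane => (t - p.1, diffuse r y p.1 p.2)) (Ioo r t ×ˢ univ) :=
    by fun_prop
  have hmt : MapsTo (fun p : ℝ × Plane => (t - p.1, diffuse r y p.1 p.2)) (Ioo r t ×ˢ univ)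
      (Ioi 0 ×ˢ univ) := fun p hp => ⟨sub_pos.2 hp.1.2, trivial⟩
  have c1 : ContinuousOn (fun p : ℝ × Plane => u (t - p.1) (diffuse r y p.1 p.2))
      (Ioo r t ×ˢ univ) :=
    hu.continuousOn.comp hm fun p hp => ⟨mem_Ici.2 (le_of_lt (mem_Ioi.1 (hmt hp).1)), trivial⟩
  have c2 : ContinuousOn (fun p : ℝ × Plane => deriv (fun s => u s (diffuse r y p.1 p.2)) (t - p.1))
      (Ioo r t ×ˢ univ) := hu.continuousOn_deriv_time.comp hm hmt
  have c3 : ContinuousOn (fun p : ℝ × Plane => fderiv ℝ (u (t - p.1)) (diffuse r y p.1 p.2))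
      (Ioo r t ×ˢ univ) := hu.continuousOn_deriv_space.comp hm hmt
  have c4 : Continuous fun p : ℝ × Plane => χ (diffuse r y p.1 p.2) :=
    hχ.continuous.comp (continuous_diffuse r y)
  have c5 : Continuous fun p : ℝ × Plane => fderiv ℝ χ (diffuse r y p.1 p.2) :=
    (hχ.continuous_fderiv two_ne_zero).comp (continuous_diffuse r y)
  have c6 : ContinuousOn (fun p : ℝ × Plane => 1 / (2 * √(p.1 - r))) (Ioo r t ×ˢ univ) := by
    refine ContinuousOn.div (by fun_prop) (by fun_prop) fun p hp => ?_
    have := Real.sqrt_pos.2 (sub_pos.2 hp.1.1)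
    positivity
  exact (c6.mul ((c1.mul (c5.clm_apply continuous_snd).continuousOn).add
    (c4.continuousOn.mul (c3.clm_apply continuous_snd.continuousOn)))).sub (c4.continuousOn.mul c2)

/-- The support of the cutoff and the times t - q form a compact set inside positive times, where
the derivatives of `u` are continuous. Keeping q away from r controls 1/√(q - r); the direction `z`
contributes the linear growth. -/
theorem IsSolution.exists_bound_cutoffDeriv (hu : IsSolution b v u) {χ : Plane → ℝ}
    (hχ : ContDiff ℝ 2 χ) (hc : HasCompactSupport χ) {t r q₀ q₁ : ℝ} (h₀ : r < q₀) (h₁ : q₁ < t)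
    (y : Plane) :
    ∃ C, ∀ q ∈ Icc q₀ q₁, ∀ z, |cutoffDeriv χ u t r y q z| ≤ C * (1 + ‖z‖) := by
  have hK : IsCompact (Icc (t - q₁) (t - q₀) ×ˢ tsupport χ) := isCompact_Icc.prod hc
  have hsub : Icc (t - q₁) (t - q₀) ×ˢ tsupport χ ⊆ Ioi 0 ×ˢ univ := fun p hp =>
    ⟨lt_of_lt_of_le (sub_pos.2 h₁) hp.1.1, trivial⟩
  obtain ⟨C₁, hC₁⟩ := hK.exists_bound_of_continuousOn
    (hu.continuousOn.mono (hsub.trans (prod_mono Ioi_subset_Ici_self subset_rfl)))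
  obtain ⟨C₂, hC₂⟩ := hK.exists_bound_of_continuousOn (hu.continuousOn_deriv_time.mono hsub)
  obtain ⟨C₃, hC₃⟩ := hK.exists_bound_of_continuousOn (hu.continuousOn_deriv_space.mono hsub)
  obtain ⟨M₀, hM₀⟩ := hc.exists_bound_of_continuous hχ.continuous
  obtain ⟨M₁, hM₁⟩ := (hc.fderiv (𝕜 := ℝ)).exists_bound_of_continuous
    (hχ.continuous_fderiv two_ne_zero)
  have hM₀' : 0 ≤ M₀ := (norm_nonneg _).trans (hM₀ 0)
  have hM₁' : 0 ≤ M₁ := (norm_nonneg _).trans (hM₁ 0)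
  set c := 1 / (2 * √(q₀ - r)) with hcdef
  have hc0 : 0 ≤ c := by positivity
  set D := c * (|C₁| * M₁ + M₀ * |C₃|) + M₀ * |C₂| with hD
  refine ⟨D, fun q hq z => ?_⟩
  have hD0 : 0 ≤ D := by positivity
  by_cases hz : diffuse r y q z ∈ tsupport χ
  · have hp : (t - q, diffuse r y q z) ∈ Icc (t - q₁) (t - q₀) ×ˢ tsupport χ :=
      ⟨⟨by linarith [hq.2], by linarith [hq.1]⟩, hz⟩
    have b1 := (hC₁ _ hp).trans (le_abs_self _)
    have b2 := (hC₂ _ hp).trans (le_abs_self _)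
    have b3 := (hC₃ _ hp).trans (le_abs_self _)
    have b4 := hM₀ (diffuse r y q z)
    have b5 := hM₁ (diffuse r y q z)
    have b6 : 1 / (2 * √(q - r)) ≤ c := by
      have := Real.sqrt_pos.2 (sub_pos.2 h₀)
      rw [hcdef]
      gcongr
      exact hq.1
    have e1 : |u (t - q) (diffuse r y q z) * fderiv ℝ χ (diffuse r y q z) z| ≤
        |C₁| * (M₁ * ‖z‖) := by
      rw [abs_mul]
      exact mul_le_mul b1 (((fderiv ℝ χ (diffuse r y q z)).le_opNorm z).trans
        (mul_le_mul_of_nonneg_right b5 (norm_nonneg z))) (abs_nonneg _)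
        (abs_nonneg _)
    have e2 : |χ (diffuse r y q z) * fderiv ℝ (u (t - q)) (diffuse r y q z) z| ≤
        M₀ * (|C₃| * ‖z‖) := by
      rw [abs_mul]
      exact mul_le_mul b4 (((fderiv ℝ (u (t - q)) (diffuse r y q z)).le_opNorm z).trans
        (mul_le_mul_of_nonneg_right b3 (norm_nonneg z))) (abs_nonneg _)
        hM₀'
    have e3 : |χ (diffuse r y q z) * deriv (fun s => u s (diffuse r y q z)) (t - q)| ≤
        M₀ * |C₂| := by
      rw [abs_mul]
      exact mul_le_mul b4 b2 (abs_nonneg _) hM₀'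
    unfold cutoffDeriv
    refine (abs_sub _ _).trans ((add_le_add ?_ e3).trans
      (?_ : c * (|C₁| * (M₁ * ‖z‖) + M₀ * (|C₃| * ‖z‖)) + M₀ * |C₂| ≤ _))
    · rw [abs_mul, abs_of_nonneg (by positivity : 0 ≤ 1 / (2 * √(q - r)))]
      exact mul_le_mul b6 ((abs_add_le _ _).trans (add_le_add e1 e2)) (abs_nonneg _) hc0
    · have hn := norm_nonneg z
      have p1 : 0 ≤ c * (|C₁| * M₁ + M₀ * |C₃|) := by positivity
      have p2 : 0 ≤ M₀ * |C₂| * ‖z‖ := by positivity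
      rw [hD]
      nlinarith
  · have z0 : χ (diffuse r y q z) = 0 := image_eq_zero_of_notMem_tsupport hz
    have z1 : fderiv ℝ χ (diffuse r y q z) = 0 :=
      image_eq_zero_of_notMem_tsupport fun h => hz (tsupport_fderiv_subset ℝ h)
    simp only [cutoffDeriv, z0, z1]
    simp
    positivity

theorem integrable_one_add_norm_stdGaussian :
    Integrable (fun z : Plane => 1 + ‖z‖) (stdGaussian Plane) :=
  (integrable_const 1).add IsGaussian.integrable_id.norm

/-- The fundamental theorem of calculus in q for each fixed `z`, followed by Fubini. -/
theorem IsSolution.integral_cutoff_sub (hu : IsSolution b v u) {χ : Plane → ℝ}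
    (hχ : ContDiff ℝ 2 χ) (hc : HasCompactSupport χ) {t r q₀ q₁ : ℝ} (h₀ : r < q₀) (h₁ : q₁ < t)
    (h : q₀ ≤ q₁) (y : Plane) :
    (∫ z, χ (diffuse r y q₁ z) * u (t - q₁) (diffuse r y q₁ z) ∂stdGaussian Plane) -
      ∫ z, χ (diffuse r y q₀ z) * u (t - q₀) (diffuse r y q₀ z) ∂stdGaussian Plane =
    ∫ q in Ioc q₀ q₁, ∫ z, cutoffDeriv χ u t r y q z ∂stdGaussian Plane := by
  have hsub : Icc q₀ q₁ ⊆ Ioo r t := Icc_subset_Ioo h₀ h₁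
  obtain ⟨C, hC⟩ := hu.exists_bound_cutoffDeriv hχ hc h₀ h₁ y
  have hcont := hu.continuousOn_cutoffDeriv hχ t r y
  have hint : Integrable (fun p : ℝ × Plane => cutoffDeriv χ u t r y p.1 p.2)
      ((volume.restrict (Ioc q₀ q₁)).prod (stdGaussian Plane)) := by
    have hdom : Integrable (fun p : ℝ × Plane => C * (1 + ‖p.2‖))
        ((volume.restrict (Ioc q₀ q₁)).prod (stdGaussian Plane)) :=
      (integrable_one_add_norm_stdGaussian.const_mul C).comp_snd _
    have hms : (volume.restrict (Ioc q₀ q₁)).prod (stdGaussian Plane) =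
        (volume.prod (stdGaussian Plane)).restrict (Ioc q₀ q₁ ×ˢ univ) := by
      rw [← Measure.prod_restrict, Measure.restrict_univ]
    refine hdom.mono' ?_ ?_
    · rw [hms]
      exact (hcont.mono (prod_mono (Ioc_subset_Icc_self.trans hsub) subset_rfl)).aestronglyMeasurable
        (measurableSet_Ioc.prod .univ)
    · rw [hms]
      filter_upwards [ae_restrict_mem (measurableSet_Ioc.prod .univ)] with p hp
      exact hC p.1 (Ioc_subset_Icc_self hp.1) p.2
  have ftc : ∀ z, χ (diffuse r y q₁ z) * u (t - q₁) (diffuse r y q₁ z) -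
      χ (diffuse r y q₀ z) * u (t - q₀) (diffuse r y q₀ z) =
      ∫ q in Ioc q₀ q₁, cutoffDeriv χ u t r y q z := by
    intro z
    rw [← intervalIntegral.integral_of_le h]
    refine (intervalIntegral.integral_eq_sub_of_hasDerivAt
      (f := fun q => χ (diffuse r y q z) * u (t - q) (diffuse r y q z)) (fun q hq => ?_) ?_).symm
    · rw [uIcc_of_le h] at hq
      exact hu.hasDerivAt_cutoff hχ (hsub hq).1 (hsub hq).2 y z
    · refine ContinuousOn.intervalIntegrable ?_
      rw [uIcc_of_le h]
      exact hcont.comp (f := fun q : ℝ => (q, z)) (by fun_prop) fun q hq => ⟨hsub hq, trivial⟩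
  have hi : ∀ q ∈ Icc q₀ q₁, Integrable
      (fun z => χ (diffuse r y q z) * u (t - q) (diffuse r y q z)) (stdGaussian Plane) := by
    intro q hq
    have hσ : √(q - r) ≠ 0 := (Real.sqrt_pos.2 (sub_pos.2 (hsub hq).1)).ne'
    exact integrable_mul_comp_affine hχ.continuous
      (hu.contDiff_space (t - q) (sub_pos.2 (hsub hq).2)).continuous (.inl hc) y hσ
  rw [← integral_sub (hi _ (right_mem_Icc.2 h)) (hi _ (left_mem_Icc.2 h))]
  simp_rw [ftc]
  rw [integral_integral_swap (μ := stdGaussian Plane) (ν := volume.restrict (Ioc q₀ q₁))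
    (f := fun z q => cutoffDeriv χ u t r y q z)]
  exact hint.swap

/-- The integrand in the cut-off Duhamel formula. -/
def cutoffSource (χ : Plane → ℝ) (b : ℝ) (v u : ℝ → Plane → ℝ) (t r : ℝ) (y : Plane) (q : ℝ)
    (z : Plane) : ℝ :=
  1 / √(q - r) * (u (t - q) (diffuse r y q z) * fderiv ℝ χ (diffuse r y q z) z) -
    1 / 2 * (u (t - q) (diffuse r y q z) * Laplacian.laplacian χ (diffuse r y q z)) -
    χ (diffuse r y q z) * (b * u (t - q) (diffuse r y q z) * v (t - q) (diffuse r y q z))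

/-- After integration by parts the term ½ χ Δu appears and cancels against the same term in χ ∂ₜu.
What remains is the source and terms carrying a derivative of the cutoff. -/
theorem IsSolution.integral_cutoffDeriv (hu : IsSolution b v u) {χ : Plane → ℝ}
    (hχ : ContDiff ℝ 2 χ) (hc : HasCompactSupport χ) {t r q : ℝ} (h₀ : r < q) (h₁ : q < t)
    (y : Plane) :
    ∫ z, cutoffDeriv χ u t r y q z ∂stdGaussian Plane =
      ∫ z, cutoffSource χ b v u t r y q z ∂stdGaussian Plane := by
  have hσ0 := Real.sqrt_pos.2 (sub_pos.2 h₀)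
  have hσ : √(q - r) ≠ 0 := hσ0.ne'
  have hs : 0 < t - q := sub_pos.2 h₁
  have hw := hu.contDiff_space (t - q) hs
  have hdt : Continuous fun y => deriv (fun s => u s y) (t - q) := by
    have := hu.continuousOn_deriv_time.comp_continuous (f := fun y : Plane => (t - q, y))
      (by fun_prop) (fun y => ⟨hs, trivial⟩)
    exact this
  have key := integral_fderiv_mul_stdGaussian hw hχ hc y hσ
  have i1 := integrable_mul_fderiv_left hw.continuous hχ (.inr hc) y hσ
  have i2 := integrable_mul_fderiv_left hχ.continuous hw (.inl hc) y hσ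
  have i3 := integrable_mul_comp_affine hχ.continuous (continuous_laplacian hw) (.inl hc) y hσ
  have i4 := integrable_mul_comp_affine hw.continuous (continuous_laplacian hχ)
    (.inr (hasCompactSupport_laplacian hc)) y hσ
  have i5 := integrable_mul_comp_affine hχ.continuous hdt (.inl hc) y hσ
  have i12 : Integrable (fun z => u (t - q) (y + √(q - r) • z) * fderiv ℝ χ (y + √(q - r) • z) z +
      χ (y + √(q - r) • z) * fderiv ℝ (u (t - q)) (y + √(q - r) • z) z) (stdGaussian Plane) :=
    i1.add i2
  have i6 : Integrable (fun z => 2 * (u (t - q) (y + √(q - r) • z) *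
      fderiv ℝ χ (y + √(q - r) • z) z) +
      √(q - r) * (χ (y + √(q - r) • z) * Laplacian.laplacian (u (t - q)) (y + √(q - r) • z) -
        u (t - q) (y + √(q - r) • z) * Laplacian.laplacian χ (y + √(q - r) • z)))
      (stdGaussian Plane) := (i1.const_mul 2).add ((i3.sub i4).const_mul _)
  calc ∫ z, cutoffDeriv χ u t r y q z ∂stdGaussian Plane
      = 1 / (2 * √(q - r)) * (∫ z, (u (t - q) (y + √(q - r) • z) * fderiv ℝ χ (y + √(q - r) • z) z +
          χ (y + √(q - r) • z) * fderiv ℝ (u (t - q)) (y + √(q - r) • z) z) ∂stdGaussian Plane) -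
        ∫ z, χ (y + √(q - r) • z) * deriv (fun s => u s (y + √(q - r) • z)) (t - q)
          ∂stdGaussian Plane := by
        rw [← integral_const_mul, ← integral_sub (i12.const_mul _) i5]
        rfl
    _ = ∫ z, cutoffSource χ b v u t r y q z ∂stdGaussian Plane := by
        rw [key, ← integral_const_mul, ← integral_sub (i6.const_mul _) i5]
        congr 1 with z
        rw [hu.equation (t - q) _ hs]
        unfold cutoffSource diffuse
        field_simp
        ring

end Duhamel

/-! ### Removal of the cutoff -/

section Duhamel

variable {b : ℝ} {v u : ℝ → Plane → ℝ}

/-- The source term `b u v` of Duhamel's formula, at time `t - q` and at a diffusing point. -/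
def source (b : ℝ) (v u : ℝ → Plane → ℝ) (t r : ℝ) (y : Plane) (q : ℝ) (z : Plane) : ℝ :=
  b * u (t - q) (diffuse r y q z) * v (t - q) (diffuse r y q z)

theorem norm_diffuse_le {r q t : ℝ} (hq : q ≤ t) (y z : Plane) :
    ‖diffuse r y q z‖ ≤ ‖y‖ + √(t - r) * ‖z‖ := by
  unfold diffuse
  refine (norm_add_le _ _).trans ?_
  rw [norm_smul, Real.norm_of_nonneg (Real.sqrt_nonneg _)]
  have : √(q - r) ≤ √(t - r) := Real.sqrt_le_sqrt (by linarith)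
  gcongr

theorem IsSolution.exists_bound_diffuse (hu : IsSolution b v u) (t r : ℝ) (y : Plane) :
    ∃ C a, 0 ≤ C ∧ ∀ q ∈ Icc r t, ∀ z,
      |u (t - q) (diffuse r y q z)| ≤ C * Real.exp (a * ‖z‖) := by
  obtain ⟨C, a, h⟩ := hu.growth (t - r)
  refine ⟨|C| * Real.exp (|a| * ‖y‖), |a| * √(t - r), by positivity, fun q hq z => ?_⟩
  refine (h (t - q) ⟨by linarith [hq.2], by linarith [hq.1]⟩ _).trans ?_
  rw [mul_assoc, ← Real.exp_add]
  refine mul_le_mul (le_abs_self C) (Real.exp_le_exp.2 ?_) (Real.exp_pos _).le (abs_nonneg _)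
  calc a * ‖diffuse r y q z‖ ≤ |a| * (‖y‖ + √(t - r) * ‖z‖) :=
        mul_le_mul (le_abs_self a) (norm_diffuse_le hq.2 y z) (norm_nonneg _) (abs_nonneg _)
    _ = _ := by ring

theorem IsSolution.continuousOn_diffuse (hu : IsSolution b v u) (t r : ℝ) (y : Plane) :
    ContinuousOn (fun p : ℝ × Plane => u (t - p.1) (diffuse r y p.1 p.2)) (Iic t ×ˢ univ) :=
  hu.continuousOn.comp (f := fun p : ℝ × Plane => (t - p.1, diffuse r y p.1 p.2))
    (by fun_prop) fun _ hp => ⟨mem_Ici.2 (sub_nonneg.2 hp.1), trivial⟩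

theorem IsSolution.continuous_diffuse_right (hu : IsSolution b v u) {t q : ℝ} (hq : q ≤ t) (r : ℝ)
    (y : Plane) : Continuous fun z => u (t - q) (diffuse r y q z) :=
  (hu.continuousOn_diffuse t r y).comp_continuous (f := fun z => (q, z)) (by fun_prop)
    fun _ => ⟨hq, trivial⟩

theorem IsSolution.continuousOn_integral_diffuse (hu : IsSolution b v u) (t r : ℝ) (y : Plane) :
    ContinuousOn (fun q => ∫ z, u (t - q) (diffuse r y q z) ∂stdGaussian Plane) (Icc r t) := by
  obtain ⟨C, a, -, hC⟩ := hu.exists_bound_diffuse t r y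
  refine continuousOn_of_dominated (bound := fun z => C * Real.exp (a * ‖z‖))
    (fun q hq => (hu.continuous_diffuse_right hq.2 r y).aestronglyMeasurable)
    (fun q hq => Eventually.of_forall fun z => hC q hq z)
    ((integrable_exp_norm_stdGaussian a).const_mul C) (Eventually.of_forall fun z => ?_)
  exact (hu.continuousOn_diffuse t r y).comp (f := fun q => (q, z)) (by fun_prop)
    fun q hq => ⟨hq.2, trivial⟩

theorem norm_le_exp (z : Plane) : ‖z‖ ≤ Real.exp ‖z‖ := by
  linarith [Real.add_one_le_exp ‖z‖]

/-- Dominated convergence as the cutoffs tend to 1. Nothing bounds the growth of `v`, so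
integrability of the source is a hypothesis. -/
theorem IsSolution.integral_diffuse_sub (hu : IsSolution b v u) {t r q₀ q₁ : ℝ} (h₀ : r < q₀)
    (h₁ : q₁ < t) (h : q₀ ≤ q₁) (y : Plane)
    (hint : Integrable (fun p : ℝ × Plane => source b v u t r y p.1 p.2)
      ((volume.restrict (Ioc r t)).prod (stdGaussian Plane))) :
    (∫ z, u (t - q₁) (diffuse r y q₁ z) ∂stdGaussian Plane) -
      ∫ z, u (t - q₀) (diffuse r y q₀ z) ∂stdGaussian Plane =
    - ∫ q in Ioc q₀ q₁, ∫ z, source b v u t r y q z ∂stdGaussian Plane := by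
  obtain ⟨χ, M, χd, χc, χb, χt, χ1b, χ1t, χ2b, χ2t⟩ := exists_cutoff
  obtain ⟨C, a, hC0, hC⟩ := hu.exists_bound_diffuse t r y
  have hM : 0 ≤ M := (abs_nonneg _).trans (χ2b 0 0)
  have hsub : Icc q₀ q₁ ⊆ Icc r t := Icc_subset_Icc h₀.le h₁.le
  have hsubo : Icc q₀ q₁ ⊆ Ioo r t := Icc_subset_Ioo h₀ h₁
  set μ := (volume.restrict (Ioc q₀ q₁)).prod (stdGaussian Plane) with hμ
  have hms : μ = (volume.prod (stdGaussian Plane)).restrict (Ioc q₀ q₁ ×ˢ univ) := by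
    rw [← Measure.prod_restrict, Measure.restrict_univ]
  have hint' : Integrable (fun p : ℝ × Plane => source b v u t r y p.1 p.2) μ :=
    hint.mono_measure (Measure.prod_mono (Measure.restrict_mono
      (Ioc_subset_Ioc h₀.le h₁.le) le_rfl) le_rfl)
  have endpt : ∀ q ∈ Icc q₀ q₁, Tendsto
      (fun k => ∫ z, χ k (diffuse r y q z) * u (t - q) (diffuse r y q z) ∂stdGaussian Plane) atTop
      (𝓝 (∫ z, u (t - q) (diffuse r y q z) ∂stdGaussian Plane)) := by
    intro q hq
    have hd : Continuous fun z => diffuse r y q z := by unfold diffuse; fun_prop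
    refine tendsto_integral_of_dominated_convergence (fun z => C * Real.exp (a * ‖z‖))
      (fun k => (((χd k).continuous.comp hd).mul
        (hu.continuous_diffuse_right (hsub hq).2 r y)).aestronglyMeasurable)
      ((integrable_exp_norm_stdGaussian a).const_mul C) (fun k => Eventually.of_forall fun z => ?_)
      (Eventually.of_forall fun z => ?_)
    · rw [norm_mul]
      exact (mul_le_of_le_one_left (norm_nonneg _) (χb k _)).trans (hC q (hsub hq) z)
    · simpa using (χt (diffuse r y q z)).mul_const (u (t - q) (diffuse r y q z))
  set c := 1 / √(q₀ - r) with hc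
  have hc0 : 0 ≤ c := by positivity
  have hmeas : ∀ k, AEStronglyMeasurable
      (fun p : ℝ × Plane => cutoffSource (χ k) b v u t r y p.1 p.2) μ := by
    intro k
    have c1 : ContinuousOn (fun p : ℝ × Plane => u (t - p.1) (diffuse r y p.1 p.2))
        (Ioc q₀ q₁ ×ˢ univ) :=
      (hu.continuousOn_diffuse t r y).mono (prod_mono (fun q hq => hq.2.trans h₁.le) subset_rfl)
    have c2 : Continuous fun p : ℝ × Plane => fderiv ℝ (χ k) (diffuse r y p.1 p.2) p.2 :=
      (((χd k).continuous_fderiv two_ne_zero).comp (continuous_diffuse r y)).clm_apply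
        continuous_snd
    have c3 : Continuous fun p : ℝ × Plane => Laplacian.laplacian (χ k) (diffuse r y p.1 p.2) :=
      (continuous_laplacian (χd k)).comp (continuous_diffuse r y)
    have c4 : Continuous fun p : ℝ × Plane => χ k (diffuse r y p.1 p.2) :=
      (χd k).continuous.comp (continuous_diffuse r y)
    have c5 : ContinuousOn (fun p : ℝ × Plane => 1 / √(p.1 - r)) (Ioc q₀ q₁ ×ˢ univ) := by
      refine ContinuousOn.div (by fun_prop) (by fun_prop) fun p hp => ?_
      exact (Real.sqrt_pos.2 (sub_pos.2 (h₀.trans hp.1.1))).ne'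
    have c6 : ContinuousOn (fun p : ℝ × Plane =>
        1 / √(p.1 - r) * (u (t - p.1) (diffuse r y p.1 p.2) *
          fderiv ℝ (χ k) (diffuse r y p.1 p.2) p.2) -
        1 / 2 * (u (t - p.1) (diffuse r y p.1 p.2) *
          Laplacian.laplacian (χ k) (diffuse r y p.1 p.2))) (Ioc q₀ q₁ ×ˢ univ) :=
      (c5.mul (c1.mul c2.continuousOn)).sub (continuousOn_const.mul (c1.mul c3.continuousOn))
    have m1 := c6.aestronglyMeasurable (μ := volume.prod (stdGaussian Plane))
      (measurableSet_Ioc.prod .univ)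
    rw [← hms] at m1
    exact m1.sub (c4.aestronglyMeasurable.mul hint'.aestronglyMeasurable)
  -- The two terms with derivatives of the cutoff are dominated through the growth of `u`, the extra
  -- 1 in the exponent absorbing the factor ‖z‖; the source dominates its own cut-off version.
  set bound : ℝ × Plane → ℝ := fun p => (c * C * M + 1 / 2 * (C * M)) *
    Real.exp ((a + 1) * ‖p.2‖) + ‖source b v u t r y p.1 p.2‖ with hbound
  have hbi : Integrable bound μ :=
    (((integrable_exp_norm_stdGaussian (a + 1)).const_mul _).comp_snd _).add hint'.norm
  have hle : ∀ k, ∀ᵐ p ∂μ, ‖cutoffSource (χ k) b v u t r y p.1 p.2‖ ≤ bound p := by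
    intro k
    rw [hms]
    filter_upwards [ae_restrict_mem (measurableSet_Ioc.prod .univ)] with p hp
    obtain ⟨q, z⟩ := p
    have hq : q ∈ Icc q₀ q₁ := Ioc_subset_Icc_self hp.1
    have b1 := hC q (hsub hq) z
    have b2 : 1 / √(q - r) ≤ c := by
      have := Real.sqrt_pos.2 (sub_pos.2 h₀)
      rw [hc]
      gcongr
      exact hq.1
    have b3 : |fderiv ℝ (χ k) (diffuse r y q z) z| ≤ M * Real.exp ‖z‖ :=
      ((fderiv ℝ (χ k) (diffuse r y q z)).le_opNorm z).trans
        (mul_le_mul (χ1b k _) (norm_le_exp z) (norm_nonneg _) hM)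
    have b4 := χ2b k (diffuse r y q z)
    have e : Real.exp ((a + 1) * ‖z‖) = Real.exp (a * ‖z‖) * Real.exp ‖z‖ := by
      rw [← Real.exp_add]; ring_nf
    have e1 : |1 / √(q - r) * (u (t - q) (diffuse r y q z) *
        fderiv ℝ (χ k) (diffuse r y q z) z)| ≤ c * C * M * Real.exp ((a + 1) * ‖z‖) := by
      rw [abs_mul, abs_mul, abs_of_nonneg (by positivity : 0 ≤ 1 / √(q - r)), e]
      calc _ ≤ c * ((C * Real.exp (a * ‖z‖)) * (M * Real.exp ‖z‖)) := by gcongr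
        _ = _ := by ring
    have e2 : |1 / 2 * (u (t - q) (diffuse r y q z) *
        Laplacian.laplacian (χ k) (diffuse r y q z))| ≤
          1 / 2 * (C * M) * Real.exp ((a + 1) * ‖z‖) := by
      rw [abs_mul, abs_mul, abs_of_nonneg (by norm_num : (0 : ℝ) ≤ 1 / 2), e]
      have : 1 ≤ Real.exp ‖z‖ := Real.one_le_exp (norm_nonneg _)
      calc _ ≤ 1 / 2 * ((C * Real.exp (a * ‖z‖)) * M) := by gcongr
        _ = 1 / 2 * (C * M) * (Real.exp (a * ‖z‖) * 1) := by ring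
        _ ≤ _ := by gcongr
    have e3 : |χ k (diffuse r y q z) * source b v u t r y q z| ≤ ‖source b v u t r y q z‖ := by
      rw [abs_mul]
      exact mul_le_of_le_one_left (abs_nonneg _) (χb k _)
    have := (abs_sub (1 / √(q - r) * (u (t - q) (diffuse r y q z) *
        fderiv ℝ (χ k) (diffuse r y q z) z) - 1 / 2 * (u (t - q) (diffuse r y q z) *
        Laplacian.laplacian (χ k) (diffuse r y q z)))
        (χ k (diffuse r y q z) * source b v u t r y q z)).trans
        (add_le_add ((abs_sub _ _).trans (add_le_add e1 e2)) e3)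
    simp only [hbound]
    rw [add_mul]
    exact this
  have hlim : ∀ᵐ p ∂μ, Tendsto (fun k => cutoffSource (χ k) b v u t r y p.1 p.2) atTop
      (𝓝 (-source b v u t r y p.1 p.2)) := by
    refine Eventually.of_forall fun p => ?_
    have t1 : Tendsto (fun k => fderiv ℝ (χ k) (diffuse r y p.1 p.2) p.2) atTop (𝓝 0) := by
      have h1 := ((ContinuousLinearMap.apply ℝ ℝ p.2).continuous.tendsto 0).comp
        (χ1t (diffuse r y p.1 p.2))
      rw [map_zero] at h1
      exact h1
    have h2 := (((t1.const_mul (u (t - p.1) (diffuse r y p.1 p.2))).const_mul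
      (1 / √(p.1 - r))).sub (((χ2t (diffuse r y p.1 p.2)).const_mul
        (u (t - p.1) (diffuse r y p.1 p.2))).const_mul (1 / 2))).sub
        ((χt (diffuse r y p.1 p.2)).mul_const (source b v u t r y p.1 p.2))
    simp only [mul_zero, sub_zero, one_mul, zero_sub] at h2
    exact h2
  have hmain := tendsto_integral_of_dominated_convergence bound hmeas hbi hle hlim
  have hleft := (endpt q₁ (right_mem_Icc.2 h)).sub (endpt q₀ (left_mem_Icc.2 h))
  have heq : ∀ k, (∫ z, χ k (diffuse r y q₁ z) * u (t - q₁) (diffuse r y q₁ z) ∂stdGaussian Plane) -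
      ∫ z, χ k (diffuse r y q₀ z) * u (t - q₀) (diffuse r y q₀ z) ∂stdGaussian Plane =
      ∫ p, cutoffSource (χ k) b v u t r y p.1 p.2 ∂μ := by
    intro k
    rw [hu.integral_cutoff_sub (χd k) (χc k) h₀ h₁ h y,
      integral_prod _ (hbi.mono' (hmeas k) (hle k))]
    refine setIntegral_congr_fun measurableSet_Ioc fun q hq => ?_
    have hq' := hsubo (Ioc_subset_Icc_self hq)
    exact hu.integral_cutoffDeriv (χd k) (χc k) hq'.1 hq'.2 y
  simp_rw [heq] at hleft
  rw [tendsto_nhds_unique hleft hmain, integral_neg, integral_prod _ hint']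

/-- Duhamel's formula. -/
theorem IsSolution.duhamel (hu : IsSolution b v u) {t r : ℝ} (hrt : r ≤ t) (y : Plane)
    (hint : Integrable (fun p : ℝ × Plane => source b v u t r y p.1 p.2)
      ((volume.restrict (Ioc r t)).prod (stdGaussian Plane))) :
    u (t - r) y = 1 + ∫ q in Ioc r t, ∫ z, source b v u t r y q z ∂stdGaussian Plane := by
  rcases hrt.eq_or_lt with rfl | hrt
  · simp [hu.initial]
  set h : ℝ → ℝ := fun q => ∫ z, source b v u t r y q z ∂stdGaussian Plane with hh
  set J : ℝ → ℝ := fun q => ∫ z, u (t - q) (diffuse r y q z) ∂stdGaussian Plane with hJ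
  have hi : IntegrableOn h (Ioc r t) := hint.integral_prod_left
  -- This function is constant on the open interval by the preceding lemma, and continuity carries
  -- the constant to the endpoints, where J is u(t - r, y) at q = r and 1 at q = t.
  have hG : ContinuousOn (fun q => J q + ∫ s in Ioc r q, h s) (Icc r t) :=
    (hu.continuousOn_integral_diffuse t r y).add
      (intervalIntegral.continuousOn_primitive ((integrableOn_Icc_iff_integrableOn_Ioc).2 hi))
  set m := (r + t) / 2 with hm
  have hmm : m ∈ Ioo r t := ⟨by linarith, by linarith⟩
  have aux : ∀ q₀ q₁, r < q₀ → q₀ ≤ q₁ → q₁ < t →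
      J q₁ + (∫ s in Ioc r q₁, h s) = J q₀ + ∫ s in Ioc r q₀, h s := by
    intro q₀ q₁ h₀ h₀₁ h₁
    have e1 := hu.integral_diffuse_sub h₀ h₁ h₀₁ y hint
    have e2 : ∫ s in Ioc r q₁, h s = (∫ s in Ioc r q₀, h s) + ∫ s in Ioc q₀ q₁, h s := by
      rw [← setIntegral_union (Ioc_disjoint_Ioc_of_le le_rfl) measurableSet_Ioc
        (hi.mono_set (Ioc_subset_Ioc_right (h₀₁.trans h₁.le)))
        (hi.mono_set (Ioc_subset_Ioc h₀.le h₁.le)), Ioc_union_Ioc_eq_Ioc h₀.le h₀₁]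
    simp only [hJ]
    rw [e2]
    linarith
  have hconst : EqOn (fun q => J q + ∫ s in Ioc r q, h s)
      (fun _ => J m + ∫ s in Ioc r m, h s) (Ioo r t) := by
    intro q hq
    rcases le_total q m with hqm | hqm
    · exact (aux q m hq.1 hqm hmm.2).symm
    · exact aux m q hmm.1 hqm hq.2
  have hfull := hconst.of_subset_closure hG continuousOn_const Ioo_subset_Icc_self
    (by rw [closure_Ioo hrt.ne])
  have h1 := (hfull (left_mem_Icc.2 hrt.le)).trans (hfull (right_mem_Icc.2 hrt.le)).symm
  simpa [hJ, diffuse, hu.initial] using h1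

end Duhamel

/-! ### Brownian paths -/

instance (T : ℝ) : SecondCountableTopology (PathSpace T) :=
  inferInstanceAs (SecondCountableTopology
    {w : C(Icc (0 : ℝ) T, Plane) // ∀ s : Icc (0 : ℝ) T, (s : ℝ) = 0 → w s = 0})

section Wiener

variable {t : ℝ}

/-- The value of a path at a real time, the path being extended by constants. -/
def path (ht : 0 ≤ t) (w : PathSpace t) (s : ℝ) : Plane := w (projIcc 0 t ht s)

variable (ht : 0 ≤ t)

theorem continuous_pathSpace_eval :
    Continuous fun p : PathSpace t × Icc (0 : ℝ) t => p.1 p.2 := by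
  have h : Continuous fun p : PathSpace t × Icc (0 : ℝ) t => (p.1.1, p.2) :=
    (continuous_subtype_val.comp continuous_fst).prodMk continuous_snd
  exact ContinuousEval.continuous_eval.comp h

theorem continuous_path : Continuous fun p : PathSpace t × ℝ => path ht p.1 p.2 :=
  continuous_pathSpace_eval.comp
    (continuous_fst.prodMk ((continuous_projIcc (h := ht)).comp continuous_snd))

@[fun_prop]
theorem Continuous.path {X : Type*} [TopologicalSpace X] {f : X → PathSpace t} {g : X → ℝ}
    (hf : Continuous f) (hg : Continuous g) : Continuous fun x => path ht (f x) (g x) :=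
  (continuous_path ht).comp (hf.prodMk hg)

theorem path_zero (w : PathSpace t) : path ht w 0 = 0 :=
  w.2 _ (by simp [projIcc_left])

theorem path_coe (w : PathSpace t) (s : Icc (0 : ℝ) t) : path ht w s = w s := by
  simp [path]

variable {W : Measure (PathSpace t)}

theorem IsWienerMeasure.isGaussianProcess_path (hW : IsWienerMeasure W) :
    IsGaussianProcess (fun s w => path ht w s) W :=
  hW.gaussian.comp_right (projIcc 0 t ht)

theorem measurable_path (s : ℝ) : Measurable fun w : PathSpace t => path ht w s :=
  (Continuous.path ht continuous_id continuous_const).measurable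

theorem IsWienerMeasure.memLp_inner (hW : IsWienerMeasure W) (s : ℝ) (x : Plane) :
    MemLp (fun w => (inner ℝ x (path ht w s) : ℝ)) 2 W :=
  (((hW.isGaussianProcess_path ht).hasGaussianLaw_eval s).map_fun (innerSL ℝ x)).memLp_two

theorem IsWienerMeasure.integral_inner (hW : IsWienerMeasure W) (s : ℝ) (x : Plane) :
    ∫ w, (inner ℝ x (path ht w s) : ℝ) ∂W = 0 := by
  have hi : ∀ i : Fin 2, Integrable (fun w => path ht w s i) W := fun i => by
    have := hW.isGaussianProcess_path ht |>.isProbabilityMeasure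
    simpa [inner_unitVec] using (hW.memLp_inner ht s (unitVec i)).integrable one_le_two
  simp only [PiLp.inner_apply, RCLike.inner_apply, conj_trivial]
  rw [integral_finsetSum _ fun i _ => (hi i).mul_const _]
  refine Finset.sum_eq_zero fun i _ => ?_
  rw [integral_mul_const]
  have := hW.mean_zero (projIcc 0 t ht s) i
  simp only [path, this, zero_mul]

theorem IsWienerMeasure.integral_inner_mul_inner (hW : IsWienerMeasure W) {s r : ℝ} (hs : s ∈ Icc 0 t) (hr : r ∈ Icc 0 t)
    (x y : Plane) :
    ∫ w, (inner ℝ x (path ht w s) : ℝ) * inner ℝ y (path ht w r) ∂W =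
      inner ℝ x y * min s r := by
  have hi : ∀ i j : Fin 2, Integrable (fun w => path ht w s i * path ht w r j) W := fun i j => by
    have h := (hW.memLp_inner ht s (unitVec i)).integrable_mul (hW.memLp_inner ht r (unitVec j))
    simp only [inner_unitVec] at h
    exact h
  have hc : ∀ i j : Fin 2, ∫ w, path ht w s i * path ht w r j ∂W =
      if i = j then min s r else 0 := fun i j => by
    simpa [path, projIcc_of_mem ht hs, projIcc_of_mem ht hr] using hW.covariance ⟨s, hs⟩ ⟨r, hr⟩ i j
  have e : ∀ w, (inner ℝ x (path ht w s) : ℝ) * inner ℝ y (path ht w r) =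
      ∑ i, ∑ j, x i * y j * (path ht w s i * path ht w r j) := fun w => by
    simp [PiLp.inner_apply, Fin.sum_univ_two]
    ring
  simp_rw [e]
  rw [integral_finsetSum _ fun i _ => integrable_finsetSum _ fun j _ => (hi i j).const_mul _]
  simp_rw [fun i => integral_finsetSum Finset.univ fun j _ => (hi i j).const_mul (x i * y j),
    integral_const_mul, hc]
  simp [PiLp.inner_apply, Fin.sum_univ_two]
  ring

/-- A Gaussian law is determined by the mean and variance of its projections; the variance along `x`
is (q - 2r + r)‖x‖². -/
theorem IsWienerMeasure.map_increment (hW : IsWienerMeasure W) {r q : ℝ} (hr : 0 ≤ r) (hrq : r ≤ q) (hq : q ≤ t) :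
    W.map (fun w => path ht w q - path ht w r) =
      (stdGaussian Plane).map fun z => √(q - r) • z := by
  have hGP := hW.isGaussianProcess_path ht
  have := hGP.isProbabilityMeasure
  have hG : HasGaussianLaw (fun w => path ht w q - path ht w r) W := hGP.hasGaussianLaw_fun_sub
  have hmr : r ∈ Icc 0 t := ⟨hr, hrq.trans hq⟩
  have hmq : q ∈ Icc 0 t := ⟨hr.trans hrq, hq⟩
  have : IsFiniteMeasure (W.map fun w => path ht w q - path ht w r) :=
    Measure.isFiniteMeasure_map _ _
  refine Measure.ext_of_charFun ?_
  ext x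
  have hL : HasGaussianLaw (fun w => (inner ℝ x (path ht w q - path ht w r) : ℝ)) W :=
    hG.map_fun (innerSL ℝ x)
  have hmean : ∫ w, (inner ℝ x (path ht w q - path ht w r) : ℝ) ∂W = 0 := by
    simp_rw [inner_sub_right]
    rw [integral_sub ((hW.memLp_inner ht q x).integrable one_le_two)
      ((hW.memLp_inner ht r x).integrable one_le_two), hW.integral_inner, hW.integral_inner,
      sub_zero]
  have hvar : Var[fun w => (inner ℝ x (path ht w q - path ht w r) : ℝ); W] =
      (q - r) * ‖x‖ ^ 2 := by
    rw [variance_of_integral_eq_zero hL.aemeasurable hmean]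
    have i : ∀ s s', Integrable (fun w => (inner ℝ x (path ht w s) : ℝ) * inner ℝ x (path ht w s'))
      W := fun s s' => (hW.memLp_inner ht s x).integrable_mul (hW.memLp_inner ht s' x)
    have e : ∀ w, (inner ℝ x (path ht w q - path ht w r) : ℝ) ^ 2 =
        (inner ℝ x (path ht w q) : ℝ) * inner ℝ x (path ht w q) -
        2 * ((inner ℝ x (path ht w q) : ℝ) * inner ℝ x (path ht w r)) +
        (inner ℝ x (path ht w r) : ℝ) * inner ℝ x (path ht w r) := fun w => by
      rw [inner_sub_right]; ring
    simp_rw [e]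
    have i' : Integrable (fun w => (inner ℝ x (path ht w q) : ℝ) * inner ℝ x (path ht w q) -
        2 * ((inner ℝ x (path ht w q) : ℝ) * inner ℝ x (path ht w r))) W :=
      (i q q).sub ((i q r).const_mul 2)
    rw [integral_add i' (i r r),
      integral_sub (i q q) ((i q r).const_mul 2), integral_const_mul,
      hW.integral_inner_mul_inner ht hmq hmq, hW.integral_inner_mul_inner ht hmq hmr,
      hW.integral_inner_mul_inner ht hmr hmr, min_eq_right hrq, min_self, min_self,
      real_inner_self_eq_norm_sq]
    ring
  have hsq := Real.sq_sqrt (sub_nonneg.2 hrq)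
  rw [hG.charFun_map_eq, hmean, hvar, charFun_map_smul, charFun_stdGaussian, norm_smul,
    Real.norm_of_nonneg (Real.sqrt_nonneg _)]
  congr 1
  have : (√(q - r) : ℂ) ^ 2 = q - r := by exact_mod_cast hsq
  push_cast
  rw [mul_pow, this]
  ring

/-! ### Independence of increments and the Markov property -/

/-- The information in a path up to time `r`. -/
abbrev pathHistory (ht : 0 ≤ t) (r : ℝ) : MeasurableSpace (PathSpace t) :=
  MeasurableSpace.comap (fun w (s : Icc (0 : ℝ) r) => path ht w s) inferInstance

theorem pathHistory_le (r : ℝ) :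
    pathHistory ht r ≤ (inferInstance : MeasurableSpace (PathSpace t)) :=
  (measurable_pi_lambda _ fun s : Icc (0 : ℝ) r => measurable_path ht s).comap_le

/-- The past and the increment are jointly Gaussian, so vanishing covariances suffice: min(s, q) -
min(s, r) = 0 for s ≤ r. -/
theorem IsWienerMeasure.indep_increment (hW : IsWienerMeasure W) {r q : ℝ} (hr : 0 ≤ r) (hrq : r ≤ q) (hq : q ≤ t) :
    IndepFun (fun w (s : Icc (0 : ℝ) r) => path ht w s)
      (fun w => path ht w q - path ht w r) W := by
  have hGP := hW.isGaussianProcess_path ht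
  have := hGP.isProbabilityMeasure
  have hmr : r ∈ Icc 0 t := ⟨hr, hrq.trans hq⟩
  have hmq : q ∈ Icc 0 t := ⟨hr.trans hrq, hq⟩
  set X : Icc (0 : ℝ) r → PathSpace t → Plane := fun s w => path ht w s with hX
  set Y : Unit → PathSpace t → Plane := fun _ w => path ht w q - path ht w r with hY
  have hXY : IsGaussianProcess (Sum.elim X Y) W := by
    refine hGP.of_isGaussianProcess ?_
    rintro (s | _)
    · exact ⟨{(s : ℝ)}, ContinuousLinearMap.proj ⟨(s : ℝ), by simp⟩, fun w => rfl⟩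
    · exact ⟨{q, r}, ContinuousLinearMap.proj ⟨q, by simp⟩ - ContinuousLinearMap.proj ⟨r, by simp⟩,
        fun w => rfl⟩
  have hind : IndepFun (fun w s => X s w) (fun w s => Y s w) W := by
    refine hXY.indepFun_of_covariance_inner (fun s => (measurable_path ht _).aemeasurable)
      (fun _ => ((measurable_path ht _).sub (measurable_path ht _)).aemeasurable) fun s _ x y => ?_
    have hms : (s : ℝ) ∈ Icc 0 t := ⟨s.2.1, s.2.2.trans (hrq.trans hq)⟩
    have m1 := hW.memLp_inner ht s x
    have m2 : MemLp (fun w => (inner ℝ y (path ht w q - path ht w r) : ℝ)) 2 W := by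
      simp_rw [inner_sub_right]
      exact (hW.memLp_inner ht q y).sub (hW.memLp_inner ht r y)
    rw [covariance_eq_sub m1 m2]
    have e : ((fun w => (inner ℝ x (X s w) : ℝ)) * fun w => (inner ℝ y (Y () w) : ℝ)) = fun w =>
        (inner ℝ x (path ht w s) : ℝ) * inner ℝ y (path ht w q) -
          (inner ℝ x (path ht w s) : ℝ) * inner ℝ y (path ht w r) := by
      ext w
      simp only [hX, hY, Pi.mul_apply, inner_sub_right]
      ring
    have i : ∀ s', Integrable (fun w => (inner ℝ x (path ht w s) : ℝ) * inner ℝ y (path ht w s'))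
      W := fun s' => m1.integrable_mul (hW.memLp_inner ht s' y)
    rw [show (fun w => (inner ℝ y (path ht w q - path ht w r) : ℝ)) =
      fun w => (inner ℝ y (Y () w) : ℝ) from rfl, e, integral_sub (i q) (i r),
      hW.integral_inner_mul_inner ht hms hmq, hW.integral_inner_mul_inner ht hms hmr,
      min_eq_left s.2.2, min_eq_left (s.2.2.trans hrq), hW.integral_inner]
    simp
  exact hind.comp (φ := id) (ψ := fun f => f ()) measurable_id
    (measurable_pi_apply (X := fun _ : Unit => Plane) ())

theorem measurable_history_path {r s : ℝ} (hs : s ∈ Icc 0 r) :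
    Measurable[pathHistory ht r] fun w => path ht w s := by
  have h1 : Measurable[pathHistory ht r] fun w (s : Icc (0 : ℝ) r) => path ht w s :=
    comap_measurable _
  exact (measurable_pi_apply (⟨s, hs⟩ : Icc (0 : ℝ) r)).comp h1

/-- The Markov property at a fixed time: the increment is independent of the past, hence of the pair
formed by `K` and the position at time r, and can be replaced by an independent Gaussian. -/
theorem IsWienerMeasure.map_history_path (hW : IsWienerMeasure W) {r q : ℝ} (hr : 0 ≤ r) (hrq : r ≤ q) (hq : q ≤ t)
    {K : PathSpace t → ℝ} (hK : Measurable[pathHistory ht r] K) :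
    W.map (fun w => (K w, path ht w q)) =
      (W.prod (stdGaussian Plane)).map
        fun p => (K p.1, diffuse r (path ht p.1 r) q p.2) := by
  have := (hW.isGaussianProcess_path ht).isProbabilityMeasure
  have hle := pathHistory_le ht r
  have hK' : Measurable K := hK.mono hle le_rfl
  have hBr := measurable_history_path ht (r := r) (right_mem_Icc.2 hr)
  have hX : Measurable[pathHistory ht r] fun w => (K w, path ht w r) :=
    Measurable.prodMk hK hBr
  have hX' : Measurable fun w => (K w, path ht w r) := hX.mono hle le_rfl
  have hI : IndepFun (fun w => (K w, path ht w r)) (fun w => path ht w q - path ht w r) W := by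
    have h := hW.indep_increment ht hr hrq hq
    rw [IndepFun_iff_Indep] at h ⊢
    exact indep_of_indep_of_le_left h hX.comap_le
  have hinc : Measurable fun w => path ht w q - path ht w r :=
    (measurable_path ht q).sub (measurable_path ht r)
  have hmap := (indepFun_iff_map_prod_eq_prod_map_map hX'.aemeasurable hinc.aemeasurable).1 hI
  have hsm : Measurable fun z : Plane => √(q - r) • z := by fun_prop
  rw [hW.map_increment ht hr hrq hq, Measure.map_prod_map _ _ hX' hsm] at hmap
  have hadd : Measurable fun p : (ℝ × Plane) × Plane => (p.1.1, p.1.2 + p.2) := by fun_prop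
  have h2 := congrArg (Measure.map fun p : (ℝ × Plane) × Plane => (p.1.1, p.1.2 + p.2)) hmap
  rw [Measure.map_map hadd (hX'.prodMk hinc), Measure.map_map hadd (hX'.prodMap hsm)] at h2
  have e : (fun w => (K w, path ht w q)) =
      (fun p : (ℝ × Plane) × Plane => (p.1.1, p.1.2 + p.2)) ∘
        fun w => ((K w, path ht w r), path ht w q - path ht w r) := by
    ext1 w
    simp
  rw [e, h2]
  rfl

/-- The Markov property, integrated over a time interval. -/
theorem IsWienerMeasure.map_history_path_prod (hW : IsWienerMeasure W) {r : ℝ} (hr : 0 ≤ r)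
    {K : PathSpace t → ℝ} (hK : Measurable[pathHistory ht r] K) :
    (W.prod (volume.restrict (Ioc r t))).map (fun p => (K p.1, p.2, path ht p.1 p.2)) =
      (W.prod ((volume.restrict (Ioc r t)).prod (stdGaussian Plane))).map
        fun p => (K p.1, p.2.1, diffuse r (path ht p.1 r) p.2.1 p.2.2) := by
  have := (hW.isGaussianProcess_path ht).isProbabilityMeasure
  have hK' : Measurable K := hK.mono (pathHistory_le ht r) le_rfl
  have hc : Continuous fun p : PathSpace t × ℝ × Plane =>
      diffuse r (path ht p.1 r) p.2.1 p.2.2 := by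
    unfold diffuse; fun_prop
  have m1 : Measurable fun p : PathSpace t × ℝ => (K p.1, p.2, path ht p.1 p.2) :=
    (hK'.comp measurable_fst).prodMk (measurable_snd.prodMk (continuous_path ht).measurable)
  have m2 : Measurable fun p : PathSpace t × ℝ × Plane =>
      (K p.1, p.2.1, diffuse r (path ht p.1 r) p.2.1 p.2.2) :=
    (hK'.comp measurable_fst).prodMk ((measurable_fst.comp measurable_snd).prodMk hc.measurable)
  refine Measure.ext_of_lintegral _ fun f hf => ?_
  rw [lintegral_map hf m1, lintegral_map hf m2,
    lintegral_prod_symm' (fun p : PathSpace t × ℝ => f (K p.1, p.2, path ht p.1 p.2)) (hf.comp m1),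
    lintegral_prod (fun p : PathSpace t × ℝ × Plane =>
      f (K p.1, p.2.1, diffuse r (path ht p.1 r) p.2.1 p.2.2)) (hf.comp m2).aemeasurable]
  have e : ∀ w, ∫⁻ y, f (K w, y.1, diffuse r (path ht w r) y.1 y.2)
      ∂(volume.restrict (Ioc r t)).prod (stdGaussian Plane) =
      ∫⁻ q in Ioc r t, ∫⁻ z, f (K w, q, diffuse r (path ht w r) q z) ∂stdGaussian Plane := by
    intro w
    exact lintegral_prod _ ((hf.comp m2).comp measurable_prodMk_left).aemeasurable
  simp only [e]
  have m6 : Measurable fun p : (PathSpace t × ℝ) × Plane =>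
      f (K p.1.1, p.1.2, diffuse r (path ht p.1.1 r) p.1.2 p.2) :=
    (hf.comp m2).comp ((measurable_fst.comp measurable_fst).prodMk
      ((measurable_snd.comp measurable_fst).prodMk measurable_snd))
  rw [lintegral_lintegral_swap (μ := W) (ν := volume.restrict (Ioc r t))
    (f := fun w q => ∫⁻ z, f (K w, q, diffuse r (path ht w r) q z) ∂stdGaussian Plane)
    (Measurable.lintegral_prod_right' (ν := stdGaussian Plane) m6).aemeasurable]
  refine setLIntegral_congr_fun (s := Ioc r t) measurableSet_Ioc fun q hq => ?_
  have m3 : Measurable fun w => (K w, path ht w q) := hK'.prodMk (measurable_path ht q)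
  have m4 : Measurable fun p : PathSpace t × Plane => (K p.1, diffuse r (path ht p.1 r) q p.2) :=
    (hK'.comp measurable_fst).prodMk (hc.measurable.comp
      (measurable_fst.prodMk (measurable_const.prodMk measurable_snd)))
  have m5 : Measurable fun p : ℝ × Plane => f (p.1, q, p.2) := by fun_prop
  have h := congrArg (fun μ => ∫⁻ p, f (p.1, q, p.2) ∂μ)
    (hW.map_history_path ht hr hq.1.le hq.2 hK)
  simp only at h
  rw [lintegral_map m5 m3, lintegral_map m5 m4,
    lintegral_prod (fun p : PathSpace t × Plane => f (K p.1, q, diffuse r (path ht p.1 r) q p.2))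
      (m5.comp m4).aemeasurable] at h
  exact h

end Wiener

/-! ### The Feynman-Kac formula -/

theorem measurable_intervalIntegral_of_continuous {X : Type*} [MeasurableSpace X] {f : X → ℝ → ℝ}
    (hm : ∀ s, Measurable fun x => f x s) (hc : ∀ x, Continuous (f x)) (a c : ℝ) :
    Measurable fun x => ∫ s in a..c, f x s := by
  have h : Measurable (Function.uncurry f) := by
    have := measurable_uncurry_of_continuous_of_measurable (u := fun s x => f x s) hc hm
    exact this.comp measurable_swap
  have h2 := h.stronglyMeasurable
  simp only [intervalIntegral]
  exact (h2.integral_prod_right (ν := volume.restrict (Ioc a c))).measurable.sub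
    (h2.integral_prod_right (ν := volume.restrict (Ioc c a))).measurable

section FeynmanKac

variable {t : ℝ} (ht : 0 ≤ t) (x : Plane) (b : ℝ) (v u : ℝ → Plane → ℝ)

/-- The rate `b v(t - s, x + w(s))` of exponential growth along a path. -/
def growthRate (w : PathSpace t) (s : ℝ) : ℝ := b * v (t - s) (x + path ht w s)

/-- The Feynman-Kac weight. -/
def weight (w : PathSpace t) (r : ℝ) : ℝ := Real.exp (∫ s in (0 : ℝ)..r, growthRate ht x b v w s)

/-- The source term `b u v` at time `t - q` and position `x + y`; `u` is extended to negative times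
by its initial value. -/
def shiftedSource (t : ℝ) (x : Plane) (b : ℝ) (v u : ℝ → Plane → ℝ) (q : ℝ) (y : Plane) : ℝ :=
  b * u (max (t - q) 0) (x + y) * v (t - q) (x + y)

variable {b v u}

theorem continuous_growthRate (hv : Continuous fun p : ℝ × Plane => v p.1 p.2) :
    Continuous fun p : PathSpace t × ℝ => growthRate ht x b v p.1 p.2 := by
  have h : Continuous fun p : PathSpace t × ℝ => (t - p.2, x + path ht p.1 p.2) := by fun_prop
  exact continuous_const.mul (hv.comp h)

theorem continuous_weight (hv : Continuous fun p : ℝ × Plane => v p.1 p.2) :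
    Continuous fun p : PathSpace t × ℝ => weight ht x b v p.1 p.2 := by
  refine Real.continuous_exp.comp ?_
  have h1 : Continuous fun q : (PathSpace t × ℝ) × ℝ => growthRate ht x b v q.1.1 q.2 :=
    (continuous_growthRate ht x hv).comp (f := fun q : (PathSpace t × ℝ) × ℝ => (q.1.1, q.2))
      (by fun_prop)
  exact intervalIntegral.continuous_parametric_intervalIntegral_of_continuous
    (μ := volume)
    (f := fun (p : PathSpace t × ℝ) s => growthRate ht x b v p.1 s) h1 continuous_snd

theorem IsSolution.continuous_shiftedSource (hu : IsSolution b v u)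
    (hv : Continuous fun p : ℝ × Plane => v p.1 p.2) (t : ℝ) (x : Plane) :
    Continuous fun p : ℝ × Plane => shiftedSource t x b v u p.1 p.2 := by
  have h1 : Continuous fun p : ℝ × Plane => u (max (t - p.1) 0) (x + p.2) :=
    hu.continuousOn.comp_continuous (f := fun p : ℝ × Plane => (max (t - p.1) 0, x + p.2))
      (by fun_prop) fun p => ⟨mem_Ici.2 (le_max_right _ _), trivial⟩
  have h2 : Continuous fun p : ℝ × Plane => v (t - p.1) (x + p.2) :=
    hv.comp (f := fun p : ℝ × Plane => (t - p.1, x + p.2)) (by fun_prop)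
  exact (continuous_const.mul h1).mul h2

theorem source_eq_shiftedSource {r q : ℝ} (hq : q ≤ t) (y z : Plane) :
    source b v u t r (x + y) q z = shiftedSource t x b v u q (diffuse r y q z) := by
  simp [source, shiftedSource, diffuse, add_assoc, max_eq_left (sub_nonneg.2 hq)]

/-- The growth rate is rounded up to a natural number because it depends on the realization of the
noise: almost sure statements can then be made for all rates at once. -/
theorem IsSolution.exists_bound_shiftedSource (hu : IsSolution b v u) (t : ℝ) (x : Plane) :
    ∃ (C : ℝ) (a : ℕ), 0 ≤ C ∧ ∀ q ∈ Icc 0 t, ∀ y,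
      |shiftedSource t x b v u q y| ≤ C * (|v (t - q) (x + y)| * Real.exp (a * ‖x + y‖)) := by
  obtain ⟨C, a, h⟩ := hu.growth t
  obtain ⟨n, hn⟩ := exists_nat_ge a
  refine ⟨|b| * |C|, n, by positivity, fun q hq y => ?_⟩
  have h1 : |u (t - q) (x + y)| ≤ |C| * Real.exp (n * ‖x + y‖) :=
    (h (t - q) ⟨by linarith [hq.2], by linarith [hq.1]⟩ (x + y)).trans
      (mul_le_mul (le_abs_self C) (Real.exp_le_exp.2
        (mul_le_mul_of_nonneg_right hn (norm_nonneg _))) (Real.exp_pos _).le (abs_nonneg _))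
  rw [shiftedSource, max_eq_left (sub_nonneg.2 hq.2), abs_mul, abs_mul]
  calc _ ≤ |b| * (|C| * Real.exp (n * ‖x + y‖)) * |v (t - q) (x + y)| := by gcongr
    _ = _ := by ring

theorem hasDerivAt_weight (hv : Continuous fun p : ℝ × Plane => v p.1 p.2) (w : PathSpace t)
    (r : ℝ) : HasDerivAt (weight ht x b v w) (growthRate ht x b v w r * weight ht x b v w r) r := by
  have hc : Continuous (growthRate ht x b v w) :=
    (continuous_growthRate ht x hv).comp (f := fun s : ℝ => (w, s)) (by fun_prop)
  have h := (intervalIntegral.integral_hasDerivAt_right (hc.intervalIntegrable 0 r)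
    (hc.stronglyMeasurableAtFilter _ _) hc.continuousAt).exp
  exact h.congr_deriv (mul_comm _ _)

theorem integral_growthRate_mul_weight (hv : Continuous fun p : ℝ × Plane => v p.1 p.2)
    (w : PathSpace t) {q : ℝ} (hq : 0 ≤ q) :
    ∫ r in Ioc 0 q, growthRate ht x b v w r * weight ht x b v w r = weight ht x b v w q - 1 := by
  have hc : Continuous fun r => growthRate ht x b v w r * weight ht x b v w r :=
    ((continuous_growthRate ht x hv).mul (continuous_weight ht x hv)).comp
      (f := fun s : ℝ => (w, s)) (by fun_prop)
  rw [← intervalIntegral.integral_of_le hq, intervalIntegral.integral_eq_sub_of_hasDerivAt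
    (fun r _ => hasDerivAt_weight ht x hv w r) (hc.intervalIntegrable 0 q)]
  simp [weight]

theorem measurable_history_growthRate (hv : Continuous fun p : ℝ × Plane => v p.1 p.2) {r s : ℝ}
    (hs : s ∈ Icc 0 r) : Measurable[pathHistory ht r] fun w => growthRate ht x b v w s := by
  have h : Continuous fun y : Plane => b * v (t - s) (x + y) :=
    continuous_const.mul (hv.comp (f := fun y : Plane => (t - s, x + y)) (by fun_prop))
  exact h.measurable.comp (measurable_history_path ht hs)

theorem measurable_history_weight (hv : Continuous fun p : ℝ × Plane => v p.1 p.2) {r : ℝ}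
    (hr : 0 ≤ r) : Measurable[pathHistory ht r] fun w => weight ht x b v w r := by
  -- Clamping s to [0, r] does not change the integral, and makes the integrand measurable with
  -- respect to the history at every real s.
  have e : (fun w => weight ht x b v w r) = fun w =>
      Real.exp (∫ s in (0 : ℝ)..r, growthRate ht x b v w (projIcc 0 r hr s)) := by
    ext w
    unfold weight
    congr 1
    refine intervalIntegral.integral_congr fun s hs => ?_
    rw [uIcc_of_le hr] at hs
    simp [projIcc_of_mem hr hs]
  rw [e]
  refine Real.measurable_exp.comp ?_
  refine @measurable_intervalIntegral_of_continuous _ (pathHistory ht r)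
    (fun w s => growthRate ht x b v w (projIcc 0 r hr s)) (fun s => ?_) (fun w => ?_) 0 r
  · exact measurable_history_growthRate ht x hv (projIcc 0 r hr s).2
  · exact (continuous_growthRate ht x hv).comp
      (f := fun s : ℝ => (w, (projIcc 0 r hr s : ℝ))) (by fun_prop)

variable {W : Measure (PathSpace t)}

/-- Duhamel's formula started from a Brownian path at time `r`, tested against a functional of the
path up to time `r`. -/
theorem IsWienerMeasure.integral_mul_solution (hW : IsWienerMeasure W) (hu : IsSolution b v u)
    (hv : Continuous fun p : ℝ × Plane => v p.1 p.2) {r : ℝ} (hr : r ∈ Icc 0 t)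
    {K : PathSpace t → ℝ} (hK : Measurable[pathHistory ht r] K) (hKi : Integrable K W)
    (hs : Integrable (fun p : PathSpace t × ℝ => shiftedSource t x b v u p.2 (path ht p.1 p.2))
      (W.prod (volume.restrict (Ioc r t))))
    (hKs : Integrable
      (fun p : PathSpace t × ℝ => K p.1 * shiftedSource t x b v u p.2 (path ht p.1 p.2))
      (W.prod (volume.restrict (Ioc r t)))) :
    ∫ w, K w ∂W = (∫ w, K w * u (t - r) (x + path ht w r) ∂W) -
      ∫ p : PathSpace t × ℝ, K p.1 * shiftedSource t x b v u p.2 (path ht p.1 p.2)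
        ∂W.prod (volume.restrict (Ioc r t)) := by
  have := (hW.isGaussianProcess_path ht).isProbabilityMeasure
  have hK' : Measurable K := hK.mono (pathHistory_le ht r) le_rfl
  have hg := (hu.continuous_shiftedSource hv t x).measurable
  have hc : Continuous fun p : PathSpace t × ℝ × Plane =>
      diffuse r (path ht p.1 r) p.2.1 p.2.2 := by
    unfold diffuse; fun_prop
  have m1 : Measurable fun p : PathSpace t × ℝ => (K p.1, p.2, path ht p.1 p.2) :=
    (hK'.comp measurable_fst).prodMk (measurable_snd.prodMk (continuous_path ht).measurable)
  have m2 : Measurable fun p : PathSpace t × ℝ × Plane =>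
      (K p.1, p.2.1, diffuse r (path ht p.1 r) p.2.1 p.2.2) :=
    (hK'.comp measurable_fst).prodMk ((measurable_fst.comp measurable_snd).prodMk hc.measurable)
  have hmap := hW.map_history_path_prod ht hr.1 hK
  have f1 : Measurable fun p : ℝ × ℝ × Plane => shiftedSource t x b v u p.2.1 p.2.2 :=
    hg.comp measurable_snd
  have f2 : Measurable fun p : ℝ × ℝ × Plane => p.1 * shiftedSource t x b v u p.2.1 p.2.2 :=
    measurable_fst.mul f1
  have hs' : Integrable (fun p : PathSpace t × ℝ × Plane =>
      shiftedSource t x b v u p.2.1 (diffuse r (path ht p.1 r) p.2.1 p.2.2))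
      (W.prod ((volume.restrict (Ioc r t)).prod (stdGaussian Plane))) := by
    have h := (integrable_map_measure f1.aestronglyMeasurable m1.aemeasurable).2 hs
    rw [hmap] at h
    exact (integrable_map_measure f1.aestronglyMeasurable m2.aemeasurable).1 h
  have hKs' : Integrable (fun p : PathSpace t × ℝ × Plane =>
      K p.1 * shiftedSource t x b v u p.2.1 (diffuse r (path ht p.1 r) p.2.1 p.2.2))
      (W.prod ((volume.restrict (Ioc r t)).prod (stdGaussian Plane))) := by
    have h := (integrable_map_measure f2.aestronglyMeasurable m1.aemeasurable).2 hKs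
    rw [hmap] at h
    exact (integrable_map_measure f2.aestronglyMeasurable m2.aemeasurable).1 h
  have heq : ∫ p : PathSpace t × ℝ, K p.1 * shiftedSource t x b v u p.2 (path ht p.1 p.2)
      ∂W.prod (volume.restrict (Ioc r t)) =
      ∫ w, K w * ∫ p : ℝ × Plane, shiftedSource t x b v u p.1 (diffuse r (path ht w r) p.1 p.2)
        ∂(volume.restrict (Ioc r t)).prod (stdGaussian Plane) ∂W := by
    have h1 := integral_map m1.aemeasurable (f := fun p : ℝ × ℝ × Plane =>
      p.1 * shiftedSource t x b v u p.2.1 p.2.2)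
      (μ := W.prod (volume.restrict (Ioc r t))) f2.aestronglyMeasurable
    rw [hmap, integral_map m2.aemeasurable f2.aestronglyMeasurable, integral_prod _ hKs'] at h1
    rw [← h1]
    simp_rw [integral_const_mul]
  -- Duhamel is available only for almost every path, since integrability of the source is known on
  -- the product space and passes to almost every section.
  have hD : ∀ᵐ w ∂W, ∫ p : ℝ × Plane,
      shiftedSource t x b v u p.1 (diffuse r (path ht w r) p.1 p.2)
        ∂(volume.restrict (Ioc r t)).prod (stdGaussian Plane) =
      u (t - r) (x + path ht w r) - 1 := by
    filter_upwards [hs'.prod_right_ae] with w hw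
    have hw' : Integrable (fun p : ℝ × Plane => source b v u t r (x + path ht w r) p.1 p.2)
        ((volume.restrict (Ioc r t)).prod (stdGaussian Plane)) := by
      refine hw.congr ?_
      have hms : (volume.restrict (Ioc r t)).prod (stdGaussian Plane) =
          (volume.prod (stdGaussian Plane)).restrict (Ioc r t ×ˢ univ) := by
        rw [← Measure.prod_restrict, Measure.restrict_univ]
      rw [hms]
      filter_upwards [ae_restrict_mem (measurableSet_Ioc.prod .univ)] with p hp
      exact (source_eq_shiftedSource x hp.1.2 _ _).symm
    rw [hu.duhamel hr.2 _ hw', integral_prod _ hw, add_sub_cancel_left]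
    refine setIntegral_congr_fun measurableSet_Ioc fun q hq => ?_
    simp_rw [source_eq_shiftedSource x hq.2]
  -- This function is a partial integral of an integrable function, so no growth bound has to be
  -- combined with `K`.
  have hKint : Integrable (fun w => K w * (u (t - r) (x + path ht w r) - 1)) W := by
    refine hKs'.integral_prod_left.congr ?_
    filter_upwards [hD] with w hw
    simp only [integral_const_mul, hw]
  have heq2 : ∫ p : PathSpace t × ℝ, K p.1 * shiftedSource t x b v u p.2 (path ht p.1 p.2)
      ∂W.prod (volume.restrict (Ioc r t)) =
      ∫ w, K w * (u (t - r) (x + path ht w r) - 1) ∂W := by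
    rw [heq]
    refine integral_congr_ae ?_
    filter_upwards [hD] with w hw
    rw [hw]
  have hsum : ∫ w, K w * u (t - r) (x + path ht w r) ∂W =
      ∫ w, (K w * (u (t - r) (x + path ht w r) - 1) + K w) ∂W := by
    congr 1 with w
    ring
  rw [heq2, hsum, integral_add hKint hKi]
  ring

/-- Deterministic form, for one continuous potential. The two integrability hypotheses replace a
growth condition on `v`: the first concerns a pair of times on one path, the second a single time,
and together they justify every use of Fubini. -/
theorem IsWienerMeasure.feynmanKac (hW : IsWienerMeasure W) (hu : IsSolution b v u)
    (hv : Continuous fun p : ℝ × Plane => v p.1 p.2)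
    (h₁ : ∀ a : ℕ, Integrable (fun p : ℝ × PathSpace t × ℝ =>
      |v (t - p.1) (x + path ht p.2.1 p.1)| * weight ht x b v p.2.1 p.1 *
        (|v (t - p.2.2) (x + path ht p.2.1 p.2.2)| *
          Real.exp (a * ‖x + path ht p.2.1 p.2.2‖)))
      ((volume.restrict (Ioc 0 t)).prod (W.prod (volume.restrict (Ioc 0 t)))))
    (h₂ : ∀ a : ℕ, Integrable (fun p : PathSpace t × ℝ =>
      |v (t - p.2) (x + path ht p.1 p.2)| * Real.exp (a * ‖x + path ht p.1 p.2‖) *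
        (1 + weight ht x b v p.1 p.2))
      (W.prod (volume.restrict (Ioc 0 t)))) :
    u t x = ∫ w, weight ht x b v w t ∂W := by
  have := (hW.isGaussianProcess_path ht).isProbabilityMeasure
  set ν := volume.restrict (Ioc (0 : ℝ) t) with hν
  obtain ⟨C, a, hC0, hC⟩ := hu.exists_bound_shiftedSource t x
  set g : PathSpace t × ℝ → ℝ := fun p => shiftedSource t x b v u p.2 (path ht p.1 p.2) with hg
  set Z : PathSpace t × ℝ → ℝ := fun p => weight ht x b v p.1 p.2 with hZ
  set c : PathSpace t × ℝ → ℝ := fun p => growthRate ht x b v p.1 p.2 with hc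
  have gc : Continuous g := (hu.continuous_shiftedSource hv t x).comp
    (f := fun p : PathSpace t × ℝ => (p.2, path ht p.1 p.2)) (by fun_prop)
  have Zc : Continuous Z := continuous_weight ht x hv
  have cc : Continuous c := continuous_growthRate ht x hv
  have Z0 : ∀ p, 0 ≤ Z p := fun p => (Real.exp_pos _).le
  have hmem : ∀ᵐ p ∂W.prod ν, p.2 ∈ Ioc 0 t := by
    have hms : W.prod ν = (W.prod volume).restrict (univ ×ˢ Ioc 0 t) := by
      rw [← Measure.prod_restrict, Measure.restrict_univ]
    rw [hms]
    filter_upwards [ae_restrict_mem (MeasurableSet.univ.prod measurableSet_Ioc)] with p hp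
    exact hp.2
  have hmem2 : ∀ᵐ p ∂ν.prod (W.prod ν), p.2.2 ∈ Ioc 0 t :=
    Measure.quasiMeasurePreserving_snd.ae hmem
  have gi : Integrable g (W.prod ν) := by
    refine ((h₂ a).const_mul C).mono' gc.aestronglyMeasurable ?_
    filter_upwards [hmem] with p hp
    refine (hC p.2 (Ioc_subset_Icc_self hp) _).trans (mul_le_mul_of_nonneg_left ?_ hC0)
    exact le_mul_of_one_le_right (by positivity) (by linarith [Z0 p])
  have gZi : Integrable (fun p => g p * Z p) (W.prod ν) := by
    refine ((h₂ a).const_mul C).mono' (gc.mul Zc).aestronglyMeasurable ?_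
    filter_upwards [hmem] with p hp
    rw [norm_mul, Real.norm_of_nonneg (Z0 p)]
    refine (mul_le_mul_of_nonneg_right (hC p.2 (Ioc_subset_Icc_self hp) _) (Z0 p)).trans ?_
    rw [mul_assoc]
    refine mul_le_mul_of_nonneg_left (mul_le_mul_of_nonneg_left ?_ (by positivity)) hC0
    exact (le_add_iff_nonneg_left _).2 zero_le_one
  have cZi : Integrable (fun p => c p * Z p) (W.prod ν) := by
    refine ((h₂ 0).const_mul |b|).mono' (cc.mul Zc).aestronglyMeasurable
      (Eventually.of_forall fun p => ?_)
    rw [norm_mul, Real.norm_of_nonneg (Z0 p)]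
    simp only [hc, growthRate, Real.norm_eq_abs, abs_mul, Nat.cast_zero, zero_mul, Real.exp_zero,
      mul_one]
    rw [mul_assoc]
    refine mul_le_mul_of_nonneg_left (mul_le_mul_of_nonneg_left ?_ (by positivity)) (abs_nonneg _)
    exact (le_add_iff_nonneg_left _).2 zero_le_one
  have cZgi : Integrable (fun p : ℝ × PathSpace t × ℝ => c (p.2.1, p.1) * Z (p.2.1, p.1) * g p.2)
      (ν.prod (W.prod ν)) := by
    have hcont : Continuous fun p : ℝ × PathSpace t × ℝ =>
        c (p.2.1, p.1) * Z (p.2.1, p.1) * g p.2 := by fun_prop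
    refine ((h₁ a).const_mul (|b| * C)).mono' hcont.aestronglyMeasurable ?_
    filter_upwards [hmem2] with p hp
    have e1 := hC p.2.2 (Ioc_subset_Icc_self hp) (path ht p.2.1 p.2.2)
    rw [norm_mul, norm_mul, Real.norm_of_nonneg (Z0 _)]
    simp only [hc, growthRate, Real.norm_eq_abs, abs_mul]
    calc _ ≤ |b| * |v (t - p.1) (x + path ht p.2.1 p.1)| * Z (p.2.1, p.1) *
          (C * (|v (t - p.2.2) (x + path ht p.2.1 p.2.2)| *
            Real.exp (a * ‖x + path ht p.2.1 p.2.2‖))) :=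
          mul_le_mul_of_nonneg_left e1 (mul_nonneg (by positivity) (Z0 _))
      _ = _ := by simp only [hZ]; ring
  -- The double time integral over r < q, written with an indicator so that the order of integration
  -- can be exchanged on the full product.
  set Φ : ℝ × PathSpace t × ℝ → ℝ := {p | p.1 < p.2.2}.indicator
    fun p => c (p.2.1, p.1) * Z (p.2.1, p.1) * g p.2 with hΦ
  have hΦset : MeasurableSet {p : ℝ × PathSpace t × ℝ | p.1 < p.2.2} :=
    measurableSet_lt measurable_fst measurable_snd.snd
  have Φi : Integrable Φ (ν.prod (W.prod ν)) := cZgi.indicator hΦset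
  have base : 1 = u t x - ∫ p, g p ∂W.prod ν := by
    have h := hW.integral_mul_solution ht x hu hv (r := 0) (K := fun _ => 1) ⟨le_rfl, ht⟩
      measurable_const (integrable_const 1) gi (by simpa using gi)
    simpa [path_zero] using h
  -- Duhamel at time r tested against K = c Z; the product of c with u(t - r, x + w(r)) is the
  -- source g.
  have step : ∀ᵐ r ∂ν, ∫ w, c (w, r) * Z (w, r) ∂W =
      (∫ w, g (w, r) * Z (w, r) ∂W) - ∫ p, Φ (r, p) ∂W.prod ν := by
    have hr_mem : ∀ᵐ r ∂ν, r ∈ Ioc 0 t := ae_restrict_mem measurableSet_Ioc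
    filter_upwards [hr_mem, cZgi.prod_right_ae, cZi.swap.prod_right_ae] with r hr s1 s2
    have hms : ∀ s : Set ℝ, W.prod (volume.restrict s) = (W.prod volume).restrict (univ ×ˢ s) := by
      intro s
      rw [← Measure.prod_restrict, Measure.restrict_univ]
    have hle : W.prod (volume.restrict (Ioc r t)) ≤ W.prod ν :=
      Measure.prod_mono le_rfl (Measure.restrict_mono (Ioc_subset_Ioc_left hr.1.le) le_rfl)
    have hΦr : ∫ p, Φ (r, p) ∂W.prod ν =
        ∫ p : PathSpace t × ℝ, c (p.1, r) * Z (p.1, r) * g p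
          ∂W.prod (volume.restrict (Ioc r t)) := by
      have e1 : W.prod (volume.restrict (Ioc r t)) =
          (W.prod ν).restrict {p | r < p.2} := by
        rw [hms, hν, hms, Measure.restrict_restrict (measurableSet_lt measurable_const
          measurable_snd)]
        congr 1
        ext p
        simp only [mem_prod, mem_univ, true_and, mem_Ioc, mem_inter_iff, mem_ofPred_eq]
        constructor
        · exact fun h => ⟨h.1, hr.1.trans h.1, h.2⟩
        · exact fun h => ⟨h.1, h.2.2⟩
      rw [e1, ← integral_indicator (measurableSet_lt measurable_const measurable_snd)]
      rfl
    have h := hW.integral_mul_solution ht x hu hv (Ioc_subset_Icc_self hr)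
      (K := fun w => c (w, r) * Z (w, r))
      ((measurable_history_growthRate ht x hv (right_mem_Icc.2 hr.1.le)).mul
        (measurable_history_weight ht x hv hr.1.le)) s2 (gi.mono_measure hle)
      (s1.mono_measure hle)
    rw [h, hΦr]
    congr 2 with w
    simp only [hc, hZ, hg, growthRate, shiftedSource, max_eq_left (sub_nonneg.2 hr.2)]
    ring
  -- With r integrated first, c Z is the derivative of Z and Z starts from 1.
  have hΦsum : ∫ p, Φ p ∂ν.prod (W.prod ν) = ∫ p, g p * (Z p - 1) ∂W.prod ν := by
    rw [integral_prod_symm _ Φi]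
    refine integral_congr_ae ?_
    filter_upwards [hmem] with p hp
    have e : (fun r => Φ (r, p)) = (Iio p.2).indicator
        fun r => c (p.1, r) * Z (p.1, r) * g p := by
      ext r
      simp [hΦ, indicator]
    rw [e, integral_indicator measurableSet_Iio, hν, Measure.restrict_restrict measurableSet_Iio,
      integral_mul_const]
    have e2 : ∫ r in Iio p.2 ∩ Ioc 0 t, c (p.1, r) * Z (p.1, r) =
        ∫ r in Ioc 0 p.2, c (p.1, r) * Z (p.1, r) := by
      rw [integral_Ioc_eq_integral_Ioo]
      congr 2
      ext r
      simp only [mem_inter_iff, mem_Iio, mem_Ioc, mem_Ioo]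
      constructor
      · exact fun h => ⟨h.2.1, h.1⟩
      · exact fun h => ⟨h.2, h.1, (h.2.le.trans hp.2)⟩
    rw [e2]
    have := integral_growthRate_mul_weight ht x (b := b) hv p.1 hp.1.le
    simp only [hc, hZ]
    rw [this]
    ring
  have hZt : ∀ w, weight ht x b v w t = 1 + ∫ r, c (w, r) * Z (w, r) ∂ν := by
    intro w
    have := integral_growthRate_mul_weight ht x (b := b) hv w ht
    simp only [hc, hZ, hν]
    rw [this]
    ring
  have gZs : Integrable (fun r => ∫ w, g (w, r) * Z (w, r) ∂W) ν := gZi.swap.integral_prod_left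
  simp_rw [hZt]
  rw [integral_add (integrable_const 1) cZi.integral_prod_left,
    integral_integral_swap (f := fun w r => c (w, r) * Z (w, r)) cZi, integral_congr_ae step,
    integral_sub gZs Φi.integral_prod_left, ← integral_prod _ Φi, hΦsum,
    ← integral_integral_swap (f := fun w r => g (w, r) * Z (w, r)) gZi, ← integral_prod _ gZi,
    ← integral_sub' gZi]
  -- The weight drops out, leaving the integral of the source that occurs in `base`.
  · have e : ((fun p => g p * Z p) - fun p => g p * (Z p - 1)) = g := by
      ext p
      simp only [Pi.sub_apply]
      ring
    rw [e]
    simp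
    linarith
  · have := gZi.sub gi
    refine this.congr (Eventually.of_forall fun p => ?_)
    simp only [Pi.sub_apply]
    ring

end FeynmanKac

/-! ### Gaussian computations for the noise -/

theorem sq_integral_le {S : Type*} [MeasurableSpace S] {ν : Measure S} [IsFiniteMeasure ν]
    {f : S → ℝ} (hf : MemLp f 2 ν) : (∫ s, f s ∂ν) ^ 2 ≤ ν.real univ * ∫ s, f s ^ 2 ∂ν := by
  set m := ν.real univ with hm
  set I := ∫ s, f s ∂ν with hI
  have i1 := hf.integrable one_le_two
  have i2 := hf.integrable_sq
  -- The integrand is (m f - I)², and its integral is m (m ∫ f² - I²); dividing by m leaves the case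
  -- of zero mass to be treated apart.
  have h : 0 ≤ ∫ s, (m ^ 2 * f s ^ 2 - 2 * m * I * f s + I ^ 2) ∂ν :=
    integral_nonneg fun s => by
      have := sq_nonneg (m * f s - I)
      simp only [Pi.zero_apply]
      linarith
  have i3 : Integrable (fun s => m ^ 2 * f s ^ 2 - 2 * m * I * f s) ν :=
    (i2.const_mul _).sub (i1.const_mul _)
  rw [integral_add i3 (integrable_const _), integral_sub (i2.const_mul _) (i1.const_mul _),
    integral_const_mul, integral_const_mul, integral_const, smul_eq_mul, ← hm, ← hI] at h
  rcases (measureReal_nonneg (μ := ν) (s := univ)).eq_or_lt with h0 | h0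
  · have hν : ν = 0 := by
      rw [← Measure.measure_univ_eq_zero]
      exact (measureReal_eq_zero_iff).1 h0.symm
    simp [hI, hν]
  · rw [← hm] at h0
    have : 0 ≤ m * (m * ∫ s, f s ^ 2 ∂ν - I ^ 2) := by linarith
    have := nonneg_of_mul_nonneg_right this h0
    linarith

/-- A nonnegative function on a product is integrable if its partial integrals are bounded. -/
theorem integrable_prod_of_integral_le {X S : Type*} [MeasurableSpace X] [MeasurableSpace S]
    {P : Measure X} [SFinite P] {ν : Measure S} [IsFiniteMeasure ν] {f : X × S → ℝ}
    (hf : AEStronglyMeasurable f (P.prod ν)) (h0 : ∀ p, 0 ≤ f p) {C : ℝ}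
    (hi : ∀ᵐ s ∂ν, Integrable (fun x => f (x, s)) P)
    (hC : ∀ᵐ s ∂ν, ∫ x, f (x, s) ∂P ≤ C) : Integrable f (P.prod ν) := by
  refine (integrable_prod_iff' hf).2 ⟨hi, ?_⟩
  have hm : AEStronglyMeasurable (fun s => ∫ x, ‖f (x, s)‖ ∂P) ν :=
    hf.prod_swap.norm.integral_prod_right'
  refine (integrable_const C).mono' hm ?_
  filter_upwards [hC] with s hs
  rw [Real.norm_of_nonneg (integral_nonneg fun _ => norm_nonneg _)]
  simpa only [Real.norm_of_nonneg (h0 _)] using hs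

section Noise

variable {Ω : Type*} [MeasurableSpace Ω] {P : Measure Ω}
  {ξ : Lp ℝ 2 (volume : Measure (ℝ × Plane)) → Ω → ℝ}

theorem IsWhiteNoise.memLp (hξ : IsWhiteNoise P ξ) (f : Lp ℝ 2 (volume : Measure (ℝ × Plane))) :
    MemLp (ξ f) 2 P := (hξ.gaussian.hasGaussianLaw_eval f).memLp_two

theorem IsWhiteNoise.map_eq (hξ : IsWhiteNoise P ξ)
    (f : Lp ℝ 2 (volume : Measure (ℝ × Plane))) :
    P.map (ξ f) = gaussianReal 0 (‖f‖ ^ 2).toNNReal := by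
  rw [(hξ.gaussian.hasGaussianLaw_eval f).map_eq_gaussianReal, hξ.mean_zero,
    variance_of_integral_eq_zero (hξ.memLp f).aemeasurable (hξ.mean_zero f)]
  have := hξ.covariance f f
  rw [real_inner_self_eq_norm_sq] at this
  simp_rw [pow_two (ξ f _), this]

theorem IsWhiteNoise.integral_exp (hξ : IsWhiteNoise P ξ)
    (f : Lp ℝ 2 (volume : Measure (ℝ × Plane))) (θ : ℝ) :
    ∫ ω, Real.exp (θ * ξ f ω) ∂P = Real.exp (θ ^ 2 * ‖f‖ ^ 2 / 2) := by
  have h := mgf_gaussianReal (hξ.map_eq f) θ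
  rw [mgf] at h
  rw [h, Real.coe_toNNReal _ (sq_nonneg _)]
  congr 1
  ring

theorem IsWhiteNoise.integrable_exp (hξ : IsWhiteNoise P ξ)
    (f : Lp ℝ 2 (volume : Measure (ℝ × Plane))) (θ : ℝ) :
    Integrable (fun ω => Real.exp (θ * ξ f ω)) P := by
  have h : Integrable (fun x : ℝ => Real.exp (θ * x)) (P.map (ξ f)) := by
    rw [hξ.map_eq f]
    exact integrable_exp_mul_gaussianReal θ
  exact (integrable_map_measure (by fun_prop) (hξ.memLp f).aemeasurable).1 h

/-! ### Mollifier kernels in L² and the correlation function -/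

variable {φ : ℝ → ℝ} {ψ : Plane → ℝ} (h : IsMollifierPair φ ψ)

/-- The noise kernel as an element of `L²`. -/
def kernelLp (p : ℝ × Plane) : Lp ℝ 2 (volume : Measure (ℝ × Plane)) :=
  (h.memLp_noiseKernel p.1 p.2).toLp (noiseKernel φ ψ p.1 p.2)

instance : (volume : Measure (ℝ × Plane)).IsAddHaarMeasure :=
  inferInstanceAs ((volume : Measure ℝ).prod (volume : Measure Plane)).IsAddHaarMeasure

instance : VAddInvariantMeasure (ℝ × Plane) (ℝ × Plane) volume := inferInstance

-- The kernels are the translates of a single L² function, and translation acts continuously on L².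
set_option synthInstance.maxSize 400 in
theorem continuous_kernelLp : Continuous (kernelLp h) := by
  have : Fact ((2 : ℝ≥0∞) ≠ ∞) := ⟨ENNReal.ofNat_ne_top⟩
  have e : kernelLp h = fun p : ℝ × Plane =>
      (DomAddAct.mk (-p) : (ℝ × Plane)ᵈᵃᵃ) +ᵥ kernelLp h 0 := by
    ext1 p
    rw [kernelLp, kernelLp, DomAddAct.mk_vadd_toLp]
    congr 1
    ext q
    simp only [noiseKernel, vadd_eq_add, Prod.fst_add, Prod.snd_add, Prod.fst_neg, Prod.snd_neg,
      Prod.fst_zero, Prod.snd_zero]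
    congr 2
    · ring
    · abel
  rw [e]
  have h1 : Continuous fun p : ℝ × Plane => (DomAddAct.mk (-p) : (ℝ × Plane)ᵈᵃᵃ) :=
    DomAddAct.continuous_mk.comp continuous_neg
  exact h1.vadd continuous_const

theorem inner_kernelLp (p q : ℝ × Plane) :
    inner ℝ (kernelLp h p) (kernelLp h q) =
      ∫ r, noiseKernel φ ψ p.1 p.2 r * noiseKernel φ ψ q.1 q.2 r := by
  rw [L2.inner_def]
  refine integral_congr_ae ?_
  filter_upwards [(h.memLp_noiseKernel p.1 p.2).coeFn_toLp,
    (h.memLp_noiseKernel q.1 q.2).coeFn_toLp] with r h1 h2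
  simp only [kernelLp, h1, h2, RCLike.inner_apply, conj_trivial]
  ring

/-- Translation in time and reflection in space preserve Lebesgue measure. Symmetry of `ψ` absorbs
the reflection, which is what produces opposite signs for the time and space differences. -/
theorem inner_kernelLp_reflect (p q : ℝ × Plane) :
    inner ℝ (kernelLp h (q.1 - p.1, p.2 - q.2)) (kernelLp h 0) =
      inner ℝ (kernelLp h p) (kernelLp h q) := by
  rw [inner_kernelLp, inner_kernelLp]
  have hmp : MeasurePreserving (fun r : ℝ × Plane => (r.1 - p.1, p.2 - r.2))
      (volume : Measure (ℝ × Plane)) volume :=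
    (measurePreserving_sub_right volume p.1).prod (Measure.measurePreserving_sub_left volume p.2)
  have hc : Continuous fun r : ℝ × Plane => noiseKernel φ ψ (q.1 - p.1) (p.2 - q.2) r *
      noiseKernel φ ψ (0 : ℝ × Plane).1 (0 : ℝ × Plane).2 r := by
    have h1 := h.smooth_time.continuous
    have h2 := h.smooth_space.continuous
    unfold noiseKernel
    fun_prop
  have key := integral_map hmp.measurable.aemeasurable (μ := volume)
    (hc.aestronglyMeasurable (μ := Measure.map _ _))
  rw [hmp.map_eq] at key
  simp only at key ⊢
  rw [key]
  congr 1 with r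
  simp only [noiseKernel, Prod.fst_zero, Prod.snd_zero]
  rw [show q.1 - p.1 - (r.1 - p.1) = q.1 - r.1 by ring, show 0 - (r.1 - p.1) = p.1 - r.1 by ring,
    show p.2 - q.2 - (p.2 - r.2) = -(q.2 - r.2) by abel,
    show 0 - (p.2 - r.2) = -(p.2 - r.2) by abel, h.symm_space, h.symm_space]
  ring

theorem norm_kernelLp (p : ℝ × Plane) : ‖kernelLp h p‖ = ‖kernelLp h 0‖ := by
  have h1 := inner_kernelLp_reflect h p p
  rw [sub_self, sub_self, real_inner_self_eq_norm_sq,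
    show ((0 : ℝ), (0 : Plane)) = 0 from rfl, real_inner_self_eq_norm_sq] at h1
  exact (sq_eq_sq₀ (norm_nonneg _) (norm_nonneg _)).1 h1.symm

variable {h}

theorem IsMollifiedNoise.correlation_eq (hξ : IsWhiteNoise P ξ) {V : ℝ → Plane → Ω → ℝ}
    (hV : IsMollifiedNoise P ξ h V) (s : ℝ) (y : Plane) :
    correlation P V s y = inner ℝ (kernelLp h (s, y)) (kernelLp h 0) := by
  rw [← hξ.covariance, correlation]
  refine integral_congr_ae ?_
  filter_upwards [hV.eq_integral s y, hV.eq_integral 0 0] with ω h1 h2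
  rw [h1, h2]
  rfl

theorem IsMollifiedNoise.correlation_sub (hξ : IsWhiteNoise P ξ) {V : ℝ → Plane → Ω → ℝ}
    (hV : IsMollifiedNoise P ξ h V) (p q : ℝ × Plane) :
    correlation P V (q.1 - p.1) (p.2 - q.2) = inner ℝ (kernelLp h p) (kernelLp h q) := by
  rw [hV.correlation_eq hξ, inner_kernelLp_reflect]

/-! ### A regular version of the noise -/

/-- A jointly measurable version of the mollified noise all of whose paths are continuous. -/
structure IsContinuousNoise (P : Measure Ω)
    (ξ : Lp ℝ 2 (volume : Measure (ℝ × Plane)) → Ω → ℝ) {φ : ℝ → ℝ} {ψ : Plane → ℝ}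
    (h : IsMollifierPair φ ψ) (X : ℝ × Plane → Ω → ℝ) : Prop where
  eq_integral : ∀ p, X p =ᵐ[P] ξ (kernelLp h p)
  continuous : ∀ ω, Continuous fun p => X p ω
  measurable : Measurable (Function.uncurry X)

theorem IsMollifiedNoise.exists_isContinuousNoise (hξ : IsWhiteNoise P ξ)
    {V : ℝ → Plane → Ω → ℝ} (hV : IsMollifiedNoise P ξ h V) :
    ∃ X, IsContinuousNoise P ξ h X ∧ ∀ᵐ ω ∂P, ∀ t x, V t x ω = X (t, x) ω := by
  have hm : ∀ p : ℝ × Plane, AEMeasurable (V p.1 p.2) P := fun p =>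
    (hξ.memLp _).aemeasurable.congr (hV.eq_integral p.1 p.2).symm
  set d := TopologicalSpace.denseSeq (ℝ × Plane) with hd
  have hgood : ∀ᵐ ω ∂P, (Continuous fun p : ℝ × Plane => V p.1 p.2 ω) ∧
      ∀ n, V (d n).1 (d n).2 ω = (hm (d n)).mk _ ω := by
    filter_upwards [hV.continuous_paths, ae_all_iff.2 fun n => (hm (d n)).ae_eq_mk] with ω h1 h2
    exact ⟨h1, h2⟩
  -- On this measurable set of full measure, paths are continuous and agree at a dense sequence with
  -- measurable functions. Setting the noise to zero elsewhere makes it measurable at the dense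
  -- points, then everywhere by limits.
  obtain ⟨G, hG, hGm, hGs⟩ := hgood.exists_measurable_mem
  have hVX : ∀ᵐ ω ∂P, ∀ t x, V t x ω = G.indicator (V t x) ω := by
    filter_upwards [hG] with ω hω t x
    rw [indicator_of_mem hω]
  set X : ℝ × Plane → Ω → ℝ := fun p => G.indicator (V p.1 p.2) with hX
  have hcont : ∀ ω, Continuous fun p => X p ω := by
    intro ω
    by_cases hω : ω ∈ G
    · simp only [hX, indicator_of_mem hω]
      exact (hGs ω hω).1
    · simp only [hX, indicator_of_notMem hω]
      exact continuous_const
  have hmd : ∀ n, Measurable (X (d n)) := by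
    intro n
    have e : X (d n) = G.indicator ((hm (d n)).mk _) := by
      ext ω
      by_cases hω : ω ∈ G
      · simp only [hX, indicator_of_mem hω]
        exact (hGs ω hω).2 n
      · simp only [hX, indicator_of_notMem hω]
    rw [e]
    exact (hm (d n)).measurable_mk.indicator hGm
  have hmeas : ∀ p, Measurable (X p) := by
    intro p
    obtain ⟨y, hy, hlim⟩ := mem_closure_iff_seq_limit.1
      (TopologicalSpace.denseRange_denseSeq (ℝ × Plane) p)
    refine measurable_of_tendsto_metrizable (f := fun k => X (y k)) (fun k => ?_) ?_
    · obtain ⟨n, hn⟩ := hy k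
      rw [← hn]
      exact hmd n
    · exact tendsto_pi_nhds.2 fun ω => ((hcont ω).tendsto p).comp hlim
  refine ⟨X, ⟨fun p => ?_, hcont, measurable_uncurry_of_continuous_of_measurable hcont hmeas⟩, hVX⟩
  filter_upwards [hVX, hV.eq_integral p.1 p.2] with ω h1 h2
  exact (h1 p.1 p.2).symm.trans h2

/-! ### Averages of the noise as Wiener integrals -/

section Functional

variable {X : ℝ × Plane → Ω → ℝ}

theorem IsContinuousNoise.memLp (hX : IsContinuousNoise P ξ h X) (hξ : IsWhiteNoise P ξ)
    (p : ℝ × Plane) : MemLp (X p) 2 P := (memLp_congr_ae (hX.eq_integral p)).2 (hξ.memLp _)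

theorem IsContinuousNoise.integral_mul (hX : IsContinuousNoise P ξ h X) (hξ : IsWhiteNoise P ξ)
    (p : ℝ × Plane) (f : Lp ℝ 2 (volume : Measure (ℝ × Plane))) :
    ∫ ω, X p ω * ξ f ω ∂P = inner ℝ (kernelLp h p) f := by
  rw [← hξ.covariance]
  refine integral_congr_ae ?_
  filter_upwards [hX.eq_integral p] with ω h1
  rw [h1]

theorem IsContinuousNoise.integral_mul_self (hX : IsContinuousNoise P ξ h X)
    (hξ : IsWhiteNoise P ξ) (p q : ℝ × Plane) :
    ∫ ω, X p ω * X q ω ∂P = inner ℝ (kernelLp h p) (kernelLp h q) := by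
  rw [← hX.integral_mul hξ]
  refine integral_congr_ae ?_
  filter_upwards [hX.eq_integral q] with ω h1
  rw [h1]

theorem IsContinuousNoise.aestronglyMeasurable_comp {S : Type*} [MeasurableSpace S] (ν : Measure S)
    {c : S → ℝ × Plane} (hX : IsContinuousNoise P ξ h X) (hc : Measurable c) :
    AEStronglyMeasurable (fun p : Ω × S => X (c p.2) p.1) (P.prod ν) := by
  have : Measurable fun p : Ω × S => (c p.2, p.1) := (hc.comp measurable_snd).prodMk measurable_fst
  exact (hX.measurable.comp this).aestronglyMeasurable

variable {S : Type*} [MeasurableSpace S] (ν : Measure S) [IsFiniteMeasure ν]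
  {c : S → ℝ × Plane}

theorem IsContinuousNoise.integrable_sq (hX : IsContinuousNoise P ξ h X) (hξ : IsWhiteNoise P ξ)
    (hc : Measurable c) :
    Integrable (fun p : Ω × S => X (c p.2) p.1 ^ 2) (P.prod ν) := by
  have := hξ.gaussian.isProbabilityMeasure
  refine integrable_prod_of_integral_le (C := ‖kernelLp h 0‖ ^ 2)
    ((hX.aestronglyMeasurable_comp ν hc).pow 2) (fun p => sq_nonneg _)
    (Eventually.of_forall fun s => (hX.memLp hξ (c s)).integrable_sq)
    (Eventually.of_forall fun s => ?_)
  simp_rw [pow_two (X _ _)]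
  rw [hX.integral_mul_self hξ, real_inner_self_eq_norm_sq, norm_kernelLp]

theorem IsContinuousNoise.memLp_integral (hX : IsContinuousNoise P ξ h X) (hξ : IsWhiteNoise P ξ)
    (hc : Measurable c) : MemLp (fun ω => ∫ s, X (c s) ω ∂ν) 2 P := by
  have := hξ.gaussian.isProbabilityMeasure
  have hm := hX.aestronglyMeasurable_comp (P := P) ν hc
  have hmY : AEStronglyMeasurable (fun ω => ∫ s, X (c s) ω ∂ν) P := hm.integral_prod_right'
  rw [memLp_two_iff_integrable_sq hmY]
  have hi := hX.integrable_sq ν hξ hc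
  refine (hi.integral_prod_left.const_mul (ν.real univ)).mono' (hmY.pow 2) ?_
  filter_upwards [hi.prod_right_ae] with ω hω
  rw [Real.norm_of_nonneg (sq_nonneg _)]
  refine sq_integral_le ((memLp_two_iff_integrable_sq ?_).2 hω)
  exact (hX.measurable.comp (hc.prodMk measurable_const)).aestronglyMeasurable

theorem IsContinuousNoise.integral_integral_mul (hX : IsContinuousNoise P ξ h X)
    (hξ : IsWhiteNoise P ξ) (hc : Measurable c) {Q : Ω → ℝ} (hQ : MemLp Q 2 P) :
    ∫ ω, (∫ s, X (c s) ω ∂ν) * Q ω ∂P = ∫ s, ∫ ω, X (c s) ω * Q ω ∂P ∂ν := by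
  have := hξ.gaussian.isProbabilityMeasure
  have hi := hX.integrable_sq ν hξ hc
  have hi2 : Integrable (fun p : Ω × S => X (c p.2) p.1 * Q p.1) (P.prod ν) := by
    have hQi : Integrable (fun p : Ω × S => Q p.1 ^ 2) (P.prod ν) := hQ.integrable_sq.comp_fst ν
    have hQm : AEStronglyMeasurable (fun p : Ω × S => Q p.1) (P.prod ν) :=
      hQ.aestronglyMeasurable.comp_fst
    refine (hi.add hQi).mono' ((hX.aestronglyMeasurable_comp ν hc).mul hQm)
      (Eventually.of_forall fun p => ?_)
    simp only [Pi.add_apply, norm_mul, Real.norm_eq_abs]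
    rw [← sq_abs (X _ _), ← sq_abs (Q _)]
    nlinarith [sq_nonneg (|X (c p.2) p.1| - |Q p.1|), sq_nonneg (|X (c p.2) p.1|), sq_nonneg |Q p.1|]
  rw [← integral_integral_swap (f := fun ω s => X (c s) ω * Q ω) hi2]
  simp_rw [integral_mul_const]

variable (h c) in
/-- The `L²` function whose Wiener integral is `∫ X (c s) ν(ds)`. -/
def averagedKernel : Lp ℝ 2 (volume : Measure (ℝ × Plane)) := ∫ s, kernelLp h (c s) ∂ν

theorem integrable_kernelLp (hc : Measurable c) : Integrable (fun s => kernelLp h (c s)) ν :=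
  (integrable_const ‖kernelLp h 0‖).mono'
    ((continuous_kernelLp h).comp_aestronglyMeasurable hc.aestronglyMeasurable)
    (Eventually.of_forall fun s => (norm_kernelLp h (c s)).le)

theorem inner_averagedKernel (hc : Measurable c) (f : Lp ℝ 2 (volume : Measure (ℝ × Plane))) :
    ∫ s, inner ℝ (kernelLp h (c s)) f ∂ν = inner ℝ (averagedKernel h ν c) f := by
  have := integral_inner (𝕜 := ℝ) (integrable_kernelLp (h := h) ν hc) f
  rw [real_inner_comm, averagedKernel, ← this]
  simp_rw [real_inner_comm f]

theorem norm_averagedKernel_le : ‖averagedKernel h ν c‖ ≤ ‖kernelLp h 0‖ * ν.real univ :=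
  norm_integral_le_of_norm_le_const (Eventually.of_forall fun s => (norm_kernelLp h (c s)).le)

/-- Linearity of `ξ` is not assumed but follows from its covariance. The average Y and ξ(F) have the
same covariance with every X(c s), so Y - ξ(F) is orthogonal to Y; it is also orthogonal to ξ(F),
hence to itself. -/
theorem IsContinuousNoise.integral_ae_eq (hX : IsContinuousNoise P ξ h X) (hξ : IsWhiteNoise P ξ)
    (hc : Measurable c) :
    (fun ω => ∫ s, X (c s) ω ∂ν) =ᵐ[P] ξ (averagedKernel h ν c) := by
  set F := averagedKernel h ν c with hF
  set Y : Ω → ℝ := fun ω => ∫ s, X (c s) ω ∂ν with hY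
  have mY : MemLp Y 2 P := hX.memLp_integral ν hξ hc
  have mF := hξ.memLp F
  have mD : MemLp (Y - ξ F) 2 P := mY.sub mF
  have mul : ∀ {f g : Ω → ℝ}, MemLp f 2 P → MemLp g 2 P → Integrable (fun ω => f ω * g ω) P :=
    fun hf hg => hf.integrable_mul hg
  have eXF : ∀ s, ∫ ω, X (c s) ω * ξ F ω ∂P = inner ℝ (kernelLp h (c s)) F := fun s =>
    hX.integral_mul hξ _ _
  have eXY : ∀ s, ∫ ω, X (c s) ω * Y ω ∂P = inner ℝ (kernelLp h (c s)) F := fun s => by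
    simp_rw [mul_comm (X (c s) _)]
    rw [hX.integral_integral_mul ν hξ hc (hX.memLp hξ (c s))]
    simp_rw [hX.integral_mul_self hξ]
    rw [inner_averagedKernel ν hc, real_inner_comm]
  have eYD : ∫ ω, Y ω * (Y - ξ F) ω ∂P = 0 := by
    rw [hX.integral_integral_mul ν hξ hc mD]
    have : ∀ s, ∫ ω, X (c s) ω * (Y - ξ F) ω ∂P = 0 := fun s => by
      simp only [Pi.sub_apply, mul_sub]
      rw [integral_sub (mul (hX.memLp hξ (c s)) mY)
        (mul (hX.memLp hξ (c s)) mF), eXF, eXY, sub_self]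
    simp only [this, integral_zero]
  have eFD : ∫ ω, ξ F ω * (Y - ξ F) ω ∂P = 0 := by
    simp only [Pi.sub_apply, mul_sub]
    rw [integral_sub (mul mF mY) (mul mF mF), hξ.covariance]
    simp_rw [mul_comm (ξ F _)]
    rw [hX.integral_integral_mul ν hξ hc mF]
    simp_rw [eXF]
    rw [inner_averagedKernel ν hc, sub_self]
  have e0 : ∫ ω, (Y - ξ F) ω ^ 2 ∂P = 0 := by
    have : ∀ ω, (Y - ξ F) ω ^ 2 = Y ω * (Y - ξ F) ω - ξ F ω * (Y - ξ F) ω := fun ω => by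
      simp only [Pi.sub_apply]; ring
    simp_rw [this]
    rw [integral_sub (mul mY mD) (mul mF mD), eYD, eFD, sub_zero]
  have h0 := (integral_eq_zero_iff_of_nonneg (fun ω => sq_nonneg _) mD.integrable_sq).1 e0
  filter_upwards [h0] with ω hω
  have : (Y - ξ F) ω = 0 := by simpa using hω
  simpa [sub_eq_zero] using this

theorem IsContinuousNoise.integrable_exp_integral (hX : IsContinuousNoise P ξ h X)
    (hξ : IsWhiteNoise P ξ) (hc : Measurable c) (θ : ℝ) :
    Integrable (fun ω => Real.exp (θ * ∫ s, X (c s) ω ∂ν)) P := by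
  refine (hξ.integrable_exp (averagedKernel h ν c) θ).congr ?_
  filter_upwards [hX.integral_ae_eq ν hξ hc] with ω hω
  rw [hω]

theorem IsContinuousNoise.integral_exp_integral (hX : IsContinuousNoise P ξ h X)
    (hξ : IsWhiteNoise P ξ) (hc : Measurable c) (θ : ℝ) :
    ∫ ω, Real.exp (θ * ∫ s, X (c s) ω ∂ν) ∂P =
      Real.exp (θ ^ 2 * ‖averagedKernel h ν c‖ ^ 2 / 2) := by
  rw [← hξ.integral_exp]
  refine integral_congr_ae ?_
  filter_upwards [hX.integral_ae_eq ν hξ hc] with ω hω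
  rw [hω]

/-- All kernels have the same norm, so the bound depends on the curve `c` in no way; this uniformity
over paths drives the integrability arguments. -/
theorem IsContinuousNoise.integral_exp_integral_le (hX : IsContinuousNoise P ξ h X)
    (hξ : IsWhiteNoise P ξ) (hc : Measurable c) (θ : ℝ) {m : ℝ} (hm : ν.real univ ≤ m) :
    ∫ ω, Real.exp (θ * ∫ s, X (c s) ω ∂ν) ∂P ≤
      Real.exp (θ ^ 2 * (‖kernelLp h 0‖ * m) ^ 2 / 2) := by
  rw [hX.integral_exp_integral ν hξ hc]
  have := (norm_averagedKernel_le (h := h) (c := c) ν).trans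
    (mul_le_mul_of_nonneg_left hm (norm_nonneg _))
  gcongr

end Functional

end Noise

/-! ### The Feynman-Kac formula for almost every realization of the noise -/

instance (T : ℝ) : TopologicalSpace.MetrizableSpace (PathSpace T) :=
  inferInstanceAs (TopologicalSpace.MetrizableSpace
    {w : C(Icc (0 : ℝ) T, Plane) // ∀ s : Icc (0 : ℝ) T, (s : ℝ) = 0 → w s = 0})

theorem mul_mul_mul_le_sum_pow {a b c d : ℝ} :
    a * b * (c * d) ≤ a ^ 4 + b ^ 4 + (c ^ 4 + d ^ 4) := by
  nlinarith [sq_nonneg (a * b - c * d), sq_nonneg (a ^ 2 - b ^ 2), sq_nonneg (c ^ 2 - d ^ 2),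
    sq_nonneg (a ^ 2), sq_nonneg (b ^ 2), sq_nonneg (c ^ 2), sq_nonneg (d ^ 2)]

theorem pow_four_le_exp (y : ℝ) : y ^ 4 ≤ Real.exp (4 * y) + Real.exp (-4 * y) := by
  have h : |y| ≤ Real.exp |y| := (lt_add_one _).le.trans (Real.add_one_le_exp _)
  have h2 : y ^ 4 ≤ Real.exp (4 * |y|) := by
    rw [← Even.pow_abs (by decide), show 4 * |y| = (4 : ℕ) * |y| by norm_num, Real.exp_nat_mul]
    gcongr
  refine h2.trans ?_
  rcases abs_choice y with h | h <;> rw [h]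
  · linarith [Real.exp_pos (-4 * y)]
  · rw [mul_neg, ← neg_mul]
    linarith [Real.exp_pos (4 * y)]

theorem weight_nonneg {t : ℝ} (ht : 0 ≤ t) (x : Plane) (b : ℝ) (v : ℝ → Plane → ℝ)
    (w : PathSpace t) (r : ℝ) : 0 ≤ weight ht x b v w r := (Real.exp_pos _).le

theorem weight_eq {t : ℝ} (ht : 0 ≤ t) (x : Plane) (b : ℝ) (v : ℝ → Plane → ℝ)
    (w : PathSpace t) {r : ℝ} (hr : 0 ≤ r) :
    weight ht x b v w r = Real.exp (b * ∫ s in Ioc 0 r, v (t - s) (x + path ht w s)) := by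
  simp only [weight, growthRate]
  rw [intervalIntegral.integral_const_mul, intervalIntegral.integral_of_le hr]

theorem measurable_noise_point {t : ℝ} (ht : 0 ≤ t) (x : Plane) (w : PathSpace t) :
    Measurable fun s => (t - s, x + path ht w s) := by
  have : Continuous fun s => (t - s, x + path ht w s) := by fun_prop
  exact this.measurable

section Noise

variable {Ω : Type*} [MeasurableSpace Ω] {P : Measure Ω}
  {ξ : Lp ℝ 2 (volume : Measure (ℝ × Plane)) → Ω → ℝ}
  {φ : ℝ → ℝ} {ψ : Plane → ℝ} {h : IsMollifierPair φ ψ} {X : ℝ × Plane → Ω → ℝ}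

theorem IsContinuousNoise.integrable_exp (hX : IsContinuousNoise P ξ h X)
    (hξ : IsWhiteNoise P ξ) (p : ℝ × Plane) (θ : ℝ) :
    Integrable (fun ω => Real.exp (θ * X p ω)) P := by
  refine (hξ.integrable_exp (kernelLp h p) θ).congr ?_
  filter_upwards [hX.eq_integral p] with ω hω
  rw [hω]

theorem IsContinuousNoise.integral_exp (hX : IsContinuousNoise P ξ h X)
    (hξ : IsWhiteNoise P ξ) (p : ℝ × Plane) (θ : ℝ) :
    ∫ ω, Real.exp (θ * X p ω) ∂P = Real.exp (θ ^ 2 * ‖kernelLp h 0‖ ^ 2 / 2) := by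
  rw [← norm_kernelLp h p, ← hξ.integral_exp]
  refine integral_congr_ae ?_
  filter_upwards [hX.eq_integral p] with ω hω
  rw [hω]

theorem IsContinuousNoise.integrable_pow_four (hX : IsContinuousNoise P ξ h X)
    (hξ : IsWhiteNoise P ξ) {S : Type*} [MeasurableSpace S] (ν : Measure S) [IsFiniteMeasure ν]
    {c : S → ℝ × Plane} (hc : Measurable c) :
    Integrable (fun p : Ω × S => X (c p.2) p.1 ^ 4) (P.prod ν) := by
  have := hξ.gaussian.isProbabilityMeasure
  have hm := hX.aestronglyMeasurable_comp (P := P) ν hc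
  have key : ∀ θ : ℝ, Integrable (fun p : Ω × S => Real.exp (θ * X (c p.2) p.1)) (P.prod ν) :=
    fun θ => integrable_prod_of_integral_le
      (Real.continuous_exp.comp_aestronglyMeasurable (hm.const_mul θ)) (fun _ => (Real.exp_pos _).le)
      (Eventually.of_forall fun s => hX.integrable_exp hξ (c s) θ)
      (Eventually.of_forall fun s => (hX.integral_exp hξ (c s) θ).le)
  refine ((key 4).add (key (-4))).mono' (hm.pow 4) (Eventually.of_forall fun p => ?_)
  rw [Real.norm_of_nonneg (by positivity)]
  exact pow_four_le_exp _

variable {t : ℝ} (ht : 0 ≤ t) (x : Plane) (b : ℝ)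

theorem IsContinuousNoise.continuous_section (hX : IsContinuousNoise P ξ h X) (ω : Ω) :
    Continuous fun p : ℝ × Plane => (fun s y => X (s, y) ω) p.1 p.2 := hX.continuous ω

theorem IsContinuousNoise.measurable_weight (hX : IsContinuousNoise P ξ h X) :
    Measurable fun p : (PathSpace t × ℝ) × Ω =>
      weight ht x b (fun s y => X (s, y) p.2) p.1.1 p.1.2 := by
  refine measurable_uncurry_of_continuous_of_measurable
    (u := fun (q : PathSpace t × ℝ) ω => weight ht x b (fun s y => X (s, y) ω) q.1 q.2)
    (fun ω => continuous_weight ht x (hX.continuous_section ω)) fun q => ?_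
  have hm : Measurable fun p : Ω × ℝ => b * X (t - p.2, x + path ht q.1 p.2) p.1 :=
    (hX.measurable.comp (((measurable_noise_point ht x q.1).comp measurable_snd).prodMk
      measurable_fst)).const_mul b
  simp only [weight, growthRate, intervalIntegral]
  exact ((hm.stronglyMeasurable.integral_prod_right').measurable.sub
    (hm.stronglyMeasurable.integral_prod_right').measurable).exp

/-- A power of the weight is again the exponential of a noise average, with b replaced by kb, and
its expectation is bounded uniformly in the path and the time. -/
theorem IsContinuousNoise.integrable_weight_pow (hX : IsContinuousNoise P ξ h X)
    (hξ : IsWhiteNoise P ξ) {S : Type*} [MeasurableSpace S] (ν : Measure S) [IsFiniteMeasure ν]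
    {w : S → PathSpace t} {r : S → ℝ} (hw : Measurable w) (hr : Measurable r)
    (hrt : ∀ᵐ s ∂ν, r s ∈ Icc 0 t) (k : ℕ) :
    Integrable (fun p : Ω × S => weight ht x b (fun s y => X (s, y) p.1) (w p.2) (r p.2) ^ k)
      (P.prod ν) := by
  have := hξ.gaussian.isProbabilityMeasure
  have hm : Measurable fun p : Ω × S =>
      weight ht x b (fun s y => X (s, y) p.1) (w p.2) (r p.2) :=
    (hX.measurable_weight ht x b).comp
      (((hw.prodMk hr).comp measurable_snd).prodMk measurable_fst)
  have e : ∀ s, r s ∈ Icc 0 t → ∀ ω,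
      weight ht x b (fun s y => X (s, y) ω) (w s) (r s) ^ k =
        Real.exp (k * b * ∫ q in Ioc 0 (r s), X (t - q, x + path ht (w s) q) ω) := by
    intro s hs ω
    rw [weight_eq ht x b _ _ hs.1, ← Real.exp_nat_mul, mul_assoc]
  refine integrable_prod_of_integral_le
    (C := Real.exp ((k * b) ^ 2 * (‖kernelLp h 0‖ * t) ^ 2 / 2))
    (hm.pow_const k).aestronglyMeasurable (fun p => pow_nonneg (Real.exp_pos _).le k) ?_ ?_
  · filter_upwards [hrt] with s hs
    simp only [e s hs]
    exact hX.integrable_exp_integral _ hξ (measurable_noise_point ht x (w s)) _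
  · filter_upwards [hrt] with s hs
    simp only [e s hs]
    refine hX.integral_exp_integral_le _ hξ (measurable_noise_point ht x (w s)) _ ?_
    simpa [measureReal_def, ENNReal.toReal_ofReal hs.1] using hs.2

variable {W : Measure (PathSpace t)}

theorem IsWienerMeasure.integrable_exp_norm (hW : IsWienerMeasure W) (k : ℕ) :
    Integrable (fun p : PathSpace t × ℝ => Real.exp (k * ‖x + path ht p.1 p.2‖))
      (W.prod (volume.restrict (Ioc 0 t))) := by
  have := (hW.isGaussianProcess_path ht).isProbabilityMeasure
  have hc : Continuous fun p : PathSpace t × ℝ => Real.exp (k * ‖x + path ht p.1 p.2‖) := by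
    fun_prop
  have hi := (integrable_exp_norm_stdGaussian (k * √t)).const_mul (Real.exp (k * ‖x‖))
  have hbound : ∀ s ∈ Ioc 0 t, ∀ z : Plane, Real.exp (k * ‖x + √(s - 0) • z‖) ≤
      Real.exp (k * ‖x‖) * Real.exp (k * √t * ‖z‖) := by
    intro s hs z
    rw [← Real.exp_add, Real.exp_le_exp, sub_zero]
    have h1 : ‖x + √s • z‖ ≤ ‖x‖ + √t * ‖z‖ := by
      refine (norm_add_le _ _).trans (add_le_add le_rfl ?_)
      rw [norm_smul, Real.norm_of_nonneg (Real.sqrt_nonneg _)]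
      exact mul_le_mul_of_nonneg_right (Real.sqrt_le_sqrt hs.2) (norm_nonneg _)
    have := mul_le_mul_of_nonneg_left h1 (Nat.cast_nonneg (α := ℝ) k)
    linarith
  have hi2 : ∀ s ∈ Ioc 0 t, Integrable (fun z : Plane => Real.exp (k * ‖x + √(s - 0) • z‖))
      (stdGaussian Plane) := fun s hs =>
    hi.mono' (by fun_prop) (Eventually.of_forall fun z => by
      rw [Real.norm_of_nonneg (Real.exp_pos _).le]
      exact hbound s hs z)
  have hmap : ∀ s ∈ Ioc 0 t, W.map (fun w => path ht w s) =
      (stdGaussian Plane).map fun z => √(s - 0) • z := fun s hs => by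
    rw [← hW.map_increment ht le_rfl hs.1.le hs.2]
    simp only [path_zero, sub_zero]
  have hg : Continuous fun y : Plane => Real.exp (k * ‖x + y‖) := by fun_prop
  have hsm : ∀ s : ℝ, Measurable fun z : Plane => √(s - 0) • z := fun s => by fun_prop
  refine integrable_prod_of_integral_le hc.aestronglyMeasurable (fun _ => (Real.exp_pos _).le)
    (C := ∫ z : Plane, Real.exp (k * ‖x‖) * Real.exp (k * √t * ‖z‖) ∂(stdGaussian Plane)) ?_ ?_
  · filter_upwards [ae_restrict_mem measurableSet_Ioc] with s hs
    refine (integrable_map_measure (g := fun y : Plane => Real.exp (k * ‖x + y‖))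
      hg.aestronglyMeasurable (measurable_path ht s).aemeasurable).1 ?_
    rw [hmap s hs]
    exact (integrable_map_measure hg.aestronglyMeasurable (hsm s).aemeasurable).2 (hi2 s hs)
  · filter_upwards [ae_restrict_mem measurableSet_Ioc] with s hs
    have := integral_map (φ := fun w => path ht w s) (μ := W) (measurable_path ht s).aemeasurable
      (f := fun y : Plane => Real.exp (k * ‖x + y‖)) hg.aestronglyMeasurable
    rw [← this, hmap s hs, integral_map (hsm s).aemeasurable hg.aestronglyMeasurable]
    exact integral_mono (hi2 s hs) hi fun z => hbound s hs z

variable {b}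

/-- The hypotheses of the deterministic formula are proved jointly in the noise and the path, then
restricted to almost every noise. Countably many exponents `a` leave a single null set. -/
theorem IsContinuousNoise.feynmanKac_ae (hX : IsContinuousNoise P ξ h X)
    (hξ : IsWhiteNoise P ξ) (hW : IsWienerMeasure W) {u : ℝ → Plane → Ω → ℝ}
    (hu : ∀ᵐ ω ∂P, IsSolution b (fun s y => X (s, y) ω) (fun s y => u s y ω)) :
    ∀ᵐ ω ∂P, u t x ω = ∫ w, weight ht x b (fun s y => X (s, y) ω) w t ∂W := by
  have := hξ.gaussian.isProbabilityMeasure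
  have := (hW.isGaussianProcess_path ht).isProbabilityMeasure
  set I : Measure ℝ := volume.restrict (Ioc 0 t) with hI
  have hIm : ∀ᵐ s ∂I, s ∈ Icc 0 t := by
    filter_upwards [ae_restrict_mem measurableSet_Ioc] with s hs using Ioc_subset_Icc_self hs
  have cpt : Continuous fun q : PathSpace t × ℝ => (t - q.2, x + path ht q.1 q.2) := by fun_prop
  have hXm : ∀ {S : Type} [MeasurableSpace S] {q : S → PathSpace t × ℝ}, Measurable q →
      Measurable fun p : Ω × S => |X (t - (q p.2).2, x + path ht (q p.2).1 (q p.2).2) p.1| :=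
    fun hq => measurable_norm.comp (hX.measurable.comp
      (((cpt.measurable.comp hq).comp measurable_snd).prodMk measurable_fst))
  have hGm : ∀ {S : Type} [MeasurableSpace S] {q : S → PathSpace t × ℝ}, Measurable q →
      Measurable fun p : Ω × S => weight ht x b (fun s y => X (s, y) p.1) (q p.2).1 (q p.2).2 :=
    fun hq => (hX.measurable_weight ht x b).comp ((hq.comp measurable_snd).prodMk measurable_fst)
  have hEm : ∀ {S : Type} [MeasurableSpace S] {q : S → PathSpace t × ℝ} (a : ℕ), Measurable q →
      Measurable fun p : Ω × S => Real.exp (a * ‖x + path ht (q p.2).1 (q p.2).2‖) := by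
    intro S _ q a hq
    have : Continuous fun q : PathSpace t × ℝ => Real.exp (a * ‖x + path ht q.1 q.2‖) := by
      fun_prop
    exact (this.measurable.comp hq).comp measurable_snd
  have hE4 : ∀ a : ℕ, Integrable (fun p : PathSpace t × ℝ =>
      Real.exp (a * ‖x + path ht p.1 p.2‖) ^ 4) (W.prod I) := fun a => by
    simp_rw [← Real.exp_nat_mul]
    have := hW.integrable_exp_norm ht x (4 * a)
    push_cast at this ⊢
    simpa only [mul_assoc] using this
  have h₁ : ∀ a : ℕ, Integrable (fun p : Ω × ℝ × PathSpace t × ℝ =>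
      |X (t - p.2.1, x + path ht p.2.2.1 p.2.1) p.1| *
        weight ht x b (fun s y => X (s, y) p.1) p.2.2.1 p.2.1 *
        (|X (t - p.2.2.2, x + path ht p.2.2.1 p.2.2.2) p.1| *
          Real.exp (a * ‖x + path ht p.2.2.1 p.2.2.2‖))) (P.prod (I.prod (W.prod I))) := by
    intro a
    have q1 : Measurable fun p : ℝ × PathSpace t × ℝ => (p.2.1, p.1) := by fun_prop
    have q2 : Measurable fun p : ℝ × PathSpace t × ℝ => (p.2.1, p.2.2) := by fun_prop
    have i1 := hX.integrable_pow_four hξ (I.prod (W.prod I)) (cpt.measurable.comp q1)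
    have i2 := hX.integrable_weight_pow ht x b hξ (I.prod (W.prod I)) (w := fun p => p.2.1)
      (r := fun p => p.1) (by fun_prop) (by fun_prop)
      (Measure.quasiMeasurePreserving_fst.ae hIm) 4
    have i3 := hX.integrable_pow_four hξ (I.prod (W.prod I)) (cpt.measurable.comp q2)
    have i4 := ((hE4 a).comp_snd I).comp_snd P
    -- The four factors are dependent, so their product is dominated by the sum of their fourth
    -- powers, each integrable by itself.
    refine ((i1.add i2).add (i3.add i4)).mono' ?_ (Eventually.of_forall fun p => ?_)
    · exact (((hXm q1).mul (hGm q1)).mul ((hXm q2).mul (hEm a q2))).aestronglyMeasurable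
    · have := weight_nonneg ht x b (fun s y => X (s, y) p.1) p.2.2.1 p.2.1
      rw [Real.norm_of_nonneg (by positivity)]
      refine mul_mul_mul_le_sum_pow.trans_eq ?_
      simp only [Even.pow_abs (show Even 4 by decide)]
      rfl
  have h₂ : ∀ a : ℕ, Integrable (fun p : Ω × PathSpace t × ℝ =>
      |X (t - p.2.2, x + path ht p.2.1 p.2.2) p.1| * Real.exp (a * ‖x + path ht p.2.1 p.2.2‖) *
        (1 + weight ht x b (fun s y => X (s, y) p.1) p.2.1 p.2.2)) (P.prod (W.prod I)) := by
    intro a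
    have i1 := hX.integrable_pow_four hξ (W.prod I) cpt.measurable
    have i2 := hX.integrable_weight_pow ht x b hξ (W.prod I) (w := fun p => p.1)
      (r := fun p => p.2) (by fun_prop) (by fun_prop)
      (Measure.quasiMeasurePreserving_snd.ae hIm) 4
    have i3 := (hE4 a).comp_snd P
    have hq : Measurable fun p : PathSpace t × ℝ => p := measurable_id
    have hm1 := (hXm hq).mul (hEm a hq)
    -- The sum 1 + Z is split, and factors 1 pad each product to the four required by the
    -- inequality.
    have j1 : Integrable (fun p : Ω × PathSpace t × ℝ =>
        |X (t - p.2.2, x + path ht p.2.1 p.2.2) p.1| *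
          Real.exp (a * ‖x + path ht p.2.1 p.2.2‖) * (1 * 1)) (P.prod (W.prod I)) := by
      refine ((i1.add i3).add ((integrable_const (1 : ℝ)).add (integrable_const (1 : ℝ)))).mono'
        (hm1.mul_const _).aestronglyMeasurable (Eventually.of_forall fun p => ?_)
      rw [Real.norm_of_nonneg (by positivity)]
      refine mul_mul_mul_le_sum_pow.trans_eq ?_
      simp only [Even.pow_abs (show Even 4 by decide), one_pow]
      rfl
    have j2 : Integrable (fun p : Ω × PathSpace t × ℝ =>
        |X (t - p.2.2, x + path ht p.2.1 p.2.2) p.1| *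
          Real.exp (a * ‖x + path ht p.2.1 p.2.2‖) *
          (weight ht x b (fun s y => X (s, y) p.1) p.2.1 p.2.2 * 1)) (P.prod (W.prod I)) := by
      refine ((i1.add i3).add (i2.add (integrable_const (1 : ℝ)))).mono'
        (hm1.mul ((hGm hq).mul_const _)).aestronglyMeasurable (Eventually.of_forall fun p => ?_)
      have := weight_nonneg ht x b (fun s y => X (s, y) p.1) p.2.1 p.2.2
      rw [Real.norm_of_nonneg (by positivity)]
      refine mul_mul_mul_le_sum_pow.trans_eq ?_
      simp only [Even.pow_abs (show Even 4 by decide), one_pow]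
      rfl
    refine (j1.add j2).congr (Eventually.of_forall fun p => ?_)
    simp only [Pi.add_apply]
    ring
  filter_upwards [hu, ae_all_iff.2 fun a => (h₁ a).prod_right_ae,
    ae_all_iff.2 fun a => (h₂ a).prod_right_ae] with ω hω h1 h2
  exact hW.feynmanKac ht x hω (hX.continuous_section ω) h1 h2

end Noise

/-! ### Moments -/

/-- Checked on boxes, where the integral of a product of functions of separate coordinates
factorizes. -/
theorem pi_withDensity_ofReal {ι E : Type*} [Fintype ι] [MeasurableSpace E] (μ : Measure E)
    [SigmaFinite μ] {f : E → ℝ} (h0 : ∀ x, 0 ≤ f x) (hi : Integrable f μ) :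
    (Measure.pi fun _ : ι => μ.withDensity fun x => ENNReal.ofReal (f x)) =
      (Measure.pi fun _ : ι => μ).withDensity fun x => ENNReal.ofReal (∏ i, f (x i)) := by
  have := isFiniteMeasure_withDensity_ofReal hi.2
  refine Measure.pi_eq fun s hs => ?_
  rw [withDensity_apply _ (MeasurableSet.univ_pi hs), Measure.restrict_pi_pi,
    ← ofReal_integral_eq_lintegral_ofReal
      (Integrable.fintype_prod (f := fun _ : ι => f) fun i => hi.restrict)
      (Eventually.of_forall fun x => Finset.prod_nonneg fun i _ => h0 _),
    integral_fintype_prod_eq_prod (f := fun _ : ι => f),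
    ENNReal.ofReal_prod_of_nonneg fun i _ => integral_nonneg h0]
  refine Finset.prod_congr rfl fun i _ => ?_
  rw [withDensity_apply _ (hs i), ofReal_integral_eq_lintegral_ofReal hi.restrict
    (Eventually.of_forall h0)]

theorem norm_sum_sq_eq {E : Type*} [NormedAddCommGroup E] [InnerProductSpace ℝ E] {n : ℕ}
    (v : Fin n → E) :
    ‖∑ i, v i‖ ^ 2 = ∑ i, inner ℝ (v i) (v i) + 2 * ∑ i, ∑ j ∈ Finset.Ioi i, inner ℝ (v i) (v j) := by
  rw [← real_inner_self_eq_norm_sq, sum_inner]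
  simp_rw [inner_sum]
  have h : ∀ i, ∑ j, inner ℝ (v i) (v j) = inner ℝ (v i) (v i) +
      (∑ j ∈ Finset.Ioi i, inner ℝ (v i) (v j) + ∑ j ∈ Finset.Iio i, inner ℝ (v i) (v j)) := by
    intro i
    rw [← Finset.sum_union, ← Finset.add_sum_erase _ _ (Finset.mem_univ i)]
    · congr 2
      ext j
      simp [lt_or_lt_iff_ne, ne_comm]
    · rw [Finset.disjoint_left]
      intro j h1 h2
      exact lt_asymm (Finset.mem_Ioi.1 h1) (Finset.mem_Iio.1 h2)
  have h2 : ∑ i, ∑ j ∈ Finset.Iio i, inner ℝ (v i) (v j) =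
      ∑ i, ∑ j ∈ Finset.Ioi i, inner ℝ (v i) (v j) := by
    rw [Finset.sum_comm' (t' := Finset.univ) (s' := fun j => Finset.Ioi j) (by simp)]
    simp_rw [real_inner_comm]
  simp_rw [h, Finset.sum_add_distrib]
  rw [h2]
  ring

/-! ### The L² element of a path and the Gaussian moments -/

section PathKernel

variable {φ : ℝ → ℝ} {ψ : Plane → ℝ} (h : IsMollifierPair φ ψ) {t : ℝ} (x : Plane)

/-- Lebesgue measure on `[0, t]`. -/
def timeMeasure (t : ℝ) : Measure (Icc (0 : ℝ) t) := volume.comap Subtype.val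

theorem timeMeasure_univ : timeMeasure t univ = ENNReal.ofReal t := by
  rw [timeMeasure, (MeasurableEmbedding.subtype_coe measurableSet_Icc).comap_apply, image_univ,
    Subtype.range_coe, Real.volume_Icc, sub_zero]

instance : IsFiniteMeasure (timeMeasure t) := ⟨by simp [timeMeasure_univ]⟩

theorem continuous_spaceTime : Continuous fun p : PathSpace t × Icc (0 : ℝ) t =>
    (t - (p.2 : ℝ), x + p.1 p.2) := by
  have := continuous_pathSpace_eval (t := t)
  fun_prop

theorem measurable_spaceTime (w : PathSpace t) :
    Measurable fun s : Icc (0 : ℝ) t => (t - (s : ℝ), x + w s) :=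
  ((continuous_spaceTime x).comp (Continuous.prodMk_right w)).measurable

/-- The `L²` function whose Wiener integral is the noise collected along a path. -/
def pathKernel (w : PathSpace t) : Lp ℝ 2 (volume : Measure (ℝ × Plane)) :=
  averagedKernel h (timeMeasure t) fun s => (t - (s : ℝ), x + w s)

theorem continuous_pathKernel : Continuous (pathKernel h x : PathSpace t → _) := by
  unfold pathKernel averagedKernel
  refine continuous_of_dominated (bound := fun _ => ‖kernelLp h 0‖) (fun w => ?_)
    (fun w => Eventually.of_forall fun s => (norm_kernelLp h _).le) (integrable_const _)
    (Eventually.of_forall fun s => ?_)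
  · exact (integrable_kernelLp _ (measurable_spaceTime x w)).aestronglyMeasurable
  · exact (continuous_kernelLp h).comp
      ((continuous_spaceTime x).comp (Continuous.prodMk_left s))

theorem norm_pathKernel_le (w : PathSpace t) :
    ‖pathKernel h x w‖ ≤ ‖kernelLp h 0‖ * (timeMeasure t).real univ :=
  norm_averagedKernel_le _

theorem inner_pathKernel (w w' : PathSpace t) :
    inner ℝ (pathKernel h x w) (pathKernel h x w') =
      ∫ p : Icc (0 : ℝ) t × Icc (0 : ℝ) t, inner ℝ (kernelLp h (t - (p.1 : ℝ), x + w p.1))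
        (kernelLp h (t - (p.2 : ℝ), x + w' p.2)) ∂((timeMeasure t).prod (timeMeasure t)) := by
  rw [integral_prod, pathKernel, ← inner_averagedKernel _ (measurable_spaceTime x w)]
  · congr 1 with s
    rw [real_inner_comm, pathKernel, ← inner_averagedKernel _ (measurable_spaceTime x w')]
    simp_rw [real_inner_comm (kernelLp h (t - (s : ℝ), x + w s))]
  · have hc : Continuous fun p : Icc (0 : ℝ) t × Icc (0 : ℝ) t =>
        inner ℝ (kernelLp h (t - (p.1 : ℝ), x + w p.1))
          (kernelLp h (t - (p.2 : ℝ), x + w' p.2)) := by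
      have h1 : ∀ w : PathSpace t, Continuous fun s : Icc (0 : ℝ) t =>
          kernelLp h (t - (s : ℝ), x + w s) := fun w =>
        (continuous_kernelLp h).comp ((continuous_spaceTime x).comp (Continuous.prodMk_right w))
      exact ((h1 w).comp continuous_fst).inner ((h1 w').comp continuous_snd)
    refine (integrable_const (‖kernelLp h 0‖ * ‖kernelLp h 0‖)).mono' hc.aestronglyMeasurable
      (Eventually.of_forall fun p => ?_)
    refine (norm_inner_le_norm _ _).trans_eq ?_
    rw [norm_kernelLp h (_, x + w p.1), norm_kernelLp h (_, x + w' p.2)]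

/-- The Feynman-Kac weight of a path for a realization of the noise. -/
def noiseWeight (b : ℝ) {Ω : Type*} (X : ℝ × Plane → Ω → ℝ) (w : PathSpace t) (ω : Ω) : ℝ :=
  Real.exp (b * ∫ s, X (t - (s : ℝ), x + w s) ω ∂(timeMeasure t))

theorem weight_eq_noiseWeight (b : ℝ) {Ω : Type*} (X : ℝ × Plane → Ω → ℝ) (ht : 0 ≤ t)
    (w : PathSpace t) (ω : Ω) :
    weight ht x b (fun s y => X (s, y) ω) w t = noiseWeight x b X w ω := by
  rw [weight_eq ht x b _ w ht, noiseWeight, ← integral_Icc_eq_integral_Ioc,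
    ← integral_subtype_comap measurableSet_Icc fun s => X (t - s, x + path ht w s) ω]
  simp only [path_coe]
  rfl

variable {h} {Ω : Type*} [MeasurableSpace Ω] {P : Measure Ω}
  {ξ : Lp ℝ 2 (volume : Measure (ℝ × Plane)) → Ω → ℝ}

/-- The starting point `x` cancels in the space difference, and the time reversal s ↦ t - s matches
the sign reversal in `IsMollifiedNoise.correlation_sub`. -/
theorem IsMollifiedNoise.interaction_eq (hξ : IsWhiteNoise P ξ) {V : ℝ → Plane → Ω → ℝ}
    (hV : IsMollifiedNoise P ξ h V) (w w' : PathSpace t) :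
    interaction (correlation P V) w w' = inner ℝ (pathKernel h x w) (pathKernel h x w') := by
  rw [inner_pathKernel, interaction]
  refine integral_congr_ae (Eventually.of_forall fun p => ?_)
  simp only
  rw [← hV.correlation_sub hξ]
  congr 1
  · ring
  · rw [add_sub_add_left_eq_sub]

variable {X : ℝ × Plane → Ω → ℝ} (b : ℝ)

theorem continuous_spaceTime_family {n : ℕ} (B : Fin n → PathSpace t) :
    Continuous fun p : Fin n × Icc (0 : ℝ) t => (t - (p.2 : ℝ), x + B p.1 p.2) :=
  continuous_prod_of_discrete_left.2 fun i =>
    (continuous_spaceTime x).comp (Continuous.prodMk_right (B i))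

/-- Adding the counting measure on the labels turns n paths into one average of the noise, so the
Gaussian formula for a single average covers all moments. -/
theorem IsContinuousNoise.prod_noiseWeight {n : ℕ} (hX : IsContinuousNoise P ξ h X)
    (B : Fin n → PathSpace t) (ω : Ω) : ∏ i, noiseWeight x b X (B i) ω = Real.exp (b *
      ∫ p : Fin n × Icc (0 : ℝ) t, X (t - (p.2 : ℝ), x + B p.1 p.2) ω
        ∂(Measure.count.prod (timeMeasure t))) := by
  have hc : Continuous fun p : Fin n × Icc (0 : ℝ) t => X (t - (p.2 : ℝ), x + B p.1 p.2) ω :=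
    (hX.continuous ω).comp (continuous_spaceTime_family x B)
  rw [integral_prod _ (hc.integrable_of_hasCompactSupport (HasCompactSupport.of_compactSpace _)),
    integral_count, Finset.mul_sum, Real.exp_sum]
  rfl

theorem averagedKernel_count {n : ℕ} (B : Fin n → PathSpace t) :
    averagedKernel h (Measure.count.prod (timeMeasure t))
      (fun p : Fin n × Icc (0 : ℝ) t => (t - (p.2 : ℝ), x + B p.1 p.2)) =
      ∑ i, pathKernel h x (B i) := by
  rw [averagedKernel, integral_prod _
    (integrable_kernelLp _ (continuous_spaceTime_family x B).measurable), integral_count]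
  rfl

theorem IsContinuousNoise.integrable_prod_noiseWeight_left {n : ℕ}
    (hX : IsContinuousNoise P ξ h X) (hξ : IsWhiteNoise P ξ) (B : Fin n → PathSpace t) :
    Integrable (fun ω => ∏ i, noiseWeight x b X (B i) ω) P := by
  simp only [hX.prod_noiseWeight x b B]
  exact hX.integrable_exp_integral _ hξ (continuous_spaceTime_family x B).measurable b

theorem IsContinuousNoise.integral_prod_noiseWeight {n : ℕ} (hX : IsContinuousNoise P ξ h X)
    (hξ : IsWhiteNoise P ξ) (B : Fin n → PathSpace t) :
    ∫ ω, ∏ i, noiseWeight x b X (B i) ω ∂P =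
      Real.exp (b ^ 2 * ‖∑ i, pathKernel h x (B i)‖ ^ 2 / 2) := by
  simp only [hX.prod_noiseWeight x b B]
  rw [hX.integral_exp_integral _ hξ (continuous_spaceTime_family x B).measurable,
    averagedKernel_count]

theorem norm_sum_pathKernel_le {n : ℕ} (B : Fin n → PathSpace t) :
    ‖∑ i, pathKernel h x (B i)‖ ≤ n * (‖kernelLp h 0‖ * (timeMeasure t).real univ) := by
  refine (norm_sum_le _ _).trans ?_
  refine (Finset.sum_le_card_nsmul _ _ _ fun i _ => norm_pathKernel_le h x (B i)).trans_eq ?_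
  simp

variable {W : Measure (PathSpace t)} [IsProbabilityMeasure W]

theorem IsContinuousNoise.integrable_prod_noiseWeight {n : ℕ} (ht : 0 ≤ t)
    (hX : IsContinuousNoise P ξ h X) (hξ : IsWhiteNoise P ξ) :
    Integrable (fun p : Ω × (Fin n → PathSpace t) => ∏ i, noiseWeight x b X (p.2 i) p.1)
      (P.prod (Measure.pi fun _ => W)) := by
  have := hξ.gaussian.isProbabilityMeasure
  have hm : Measurable fun p : Ω × (Fin n → PathSpace t) =>
      ∏ i, noiseWeight x b X (p.2 i) p.1 := by
    refine Finset.measurable_fun_prod _ fun i _ => ?_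
    simp_rw [← weight_eq_noiseWeight x b X ht]
    have hq : Measurable fun p : Ω × (Fin n → PathSpace t) => ((p.2 i, t), p.1) := by fun_prop
    exact (hX.measurable_weight ht x b).comp hq
  refine integrable_prod_of_integral_le hm.aestronglyMeasurable
    (fun p => Finset.prod_nonneg fun i _ => (Real.exp_pos _).le)
    (C := Real.exp (b ^ 2 * (n * (‖kernelLp h 0‖ * (timeMeasure t).real univ)) ^ 2 / 2))
    (Eventually.of_forall fun B => hX.integrable_prod_noiseWeight_left x b hξ B)
    (Eventually.of_forall fun B => ?_)
  simp only
  rw [hX.integral_prod_noiseWeight x b hξ]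
  have := norm_sum_pathKernel_le (h := h) x B
  gcongr

/-- The moments of `∫ noiseWeight dW`, where `W` averages over paths. -/
theorem IsContinuousNoise.integrable_pow_and_integral_pow (n : ℕ) (ht : 0 ≤ t)
    (hX : IsContinuousNoise P ξ h X) (hξ : IsWhiteNoise P ξ) :
    Integrable (fun ω => (∫ w, noiseWeight x b X w ω ∂W) ^ n) P ∧
      ∫ ω, (∫ w, noiseWeight x b X w ω ∂W) ^ n ∂P =
        ∫ B : Fin n → PathSpace t, Real.exp (b ^ 2 * ‖∑ i, pathKernel h x (B i)‖ ^ 2 / 2)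
          ∂(Measure.pi fun _ => W) := by
  have := hξ.gaussian.isProbabilityMeasure
  have hi := hX.integrable_prod_noiseWeight (n := n) (W := W) x b ht hξ
  have e : ∀ ω, (∫ w, noiseWeight x b X w ω ∂W) ^ n =
      ∫ B : Fin n → PathSpace t, ∏ i, noiseWeight x b X (B i) ω ∂(Measure.pi fun _ => W) := by
    intro ω
    rw [integral_fintype_prod_eq_pow (fun w => noiseWeight x b X w ω), Fintype.card_fin]
  simp_rw [e]
  refine ⟨hi.integral_prod_left, ?_⟩
  rw [integral_integral_swap (f := fun ω (B : Fin n → PathSpace t) =>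
    ∏ i, noiseWeight x b X (B i) ω) hi]
  simp_rw [hX.integral_prod_noiseWeight x b hξ]

theorem integrable_exp_mul_norm_sq {n : ℕ} {θ : ℝ} (hθ : 0 ≤ θ) :
    Integrable (fun B : Fin n → PathSpace t => Real.exp (θ * ‖∑ i, pathKernel h x (B i)‖ ^ 2))
      (Measure.pi fun _ => W) := by
  have hc : Continuous fun B : Fin n → PathSpace t =>
      Real.exp (θ * ‖∑ i, pathKernel h x (B i)‖ ^ 2) := by
    have := continuous_pathKernel h x (t := t)
    fun_prop
  refine (integrable_const
    (Real.exp (θ * (n * (‖kernelLp h 0‖ * (timeMeasure t).real univ)) ^ 2))).mono'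
    hc.aestronglyMeasurable (Eventually.of_forall fun B => ?_)
  rw [Real.norm_of_nonneg (Real.exp_pos _).le]
  have := norm_sum_pathKernel_le (h := h) x B
  gcongr

theorem integrable_exp_mul_inner_self {θ : ℝ} (hθ : 0 ≤ θ) :
    Integrable (fun w => Real.exp (θ * inner ℝ (pathKernel h x w) (pathKernel h x w))) W := by
  have hc : Continuous fun w : PathSpace t =>
      Real.exp (θ * inner ℝ (pathKernel h x w) (pathKernel h x w)) := by
    have := continuous_pathKernel h x (t := t)
    fun_prop
  refine (integrable_const
    (Real.exp (θ * (‖kernelLp h 0‖ * (timeMeasure t).real univ) ^ 2))).mono'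
    hc.aestronglyMeasurable (Eventually.of_forall fun w => ?_)
  rw [Real.norm_of_nonneg (Real.exp_pos _).le, real_inner_self_eq_norm_sq]
  have := norm_pathKernel_le h x w
  gcongr

end PathKernel

end MollifiedSHE

end

/-! ### The moment formula -/

open MollifiedSHE in
theorem proposition1p1
    {Ω : Type*} [MeasurableSpace Ω] (P : Measure Ω) [IsProbabilityMeasure P]
    (ξ : Lp ℝ 2 (volume : Measure (ℝ × Plane)) → Ω → ℝ) (hξ : IsWhiteNoise P ξ)
    (φ : ℝ → ℝ) (ψ : Plane → ℝ) (hφψ : IsMollifierPair φ ψ)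
    (V : ℝ → Plane → Ω → ℝ) (hV : IsMollifiedNoise P ξ hφψ V)
    (β ε : ℝ) (hε₀ : 0 < ε) (hε₁ : ε < 1)
    (u : ℝ → Plane → Ω → ℝ)
    (hu : ∀ᵐ ω ∂P, IsSolution (coupling β ε) (fun t x => V t x ω) (fun t x => u t x ω))
    (t : ℝ) (ht : 0 ≤ t) (x : Plane)
    (W : Measure (PathSpace t)) (hW : IsWienerMeasure W) (n : ℕ) :
    IsProbabilityMeasure (tiltedMeasure β ε (correlation P V) W) ∧
    Integrable (fun ω => u t x ω ^ n) P ∧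
    Integrable
      (fun B : Fin n → PathSpace t => Real.exp (β ^ 2 / Real.log (1 / ε) *
        ∑ i : Fin n, ∑ j ∈ Finset.Ioi i, interaction (correlation P V) (B i) (B j)))
      (Measure.pi fun _ : Fin n => tiltedMeasure β ε (correlation P V) W) ∧
    Real.exp (-(n * zeta β ε (correlation P V) W)) * ∫ ω, u t x ω ^ n ∂P =
      ∫ B : Fin n → PathSpace t, Real.exp (β ^ 2 / Real.log (1 / ε) *
          ∑ i : Fin n, ∑ j ∈ Finset.Ioi i, interaction (correlation P V) (B i) (B j))
        ∂(Measure.pi fun _ : Fin n => tiltedMeasure β ε (correlation P V) W) := by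
  have := (hW.isGaussianProcess_path ht).isProbabilityMeasure
  obtain ⟨X, hX, hVX⟩ := hV.exists_isContinuousNoise hξ
  have hL : 0 < Real.log (1 / ε) := Real.log_pos (by rw [lt_div_iff₀ hε₀]; linarith)
  set L := Real.log (1 / ε) with hLdef
  set b := coupling β ε with hb
  set κ := β ^ 2 / (2 * L) with hκ
  have hb2 : b ^ 2 = 2 * κ := by
    rw [hb, coupling, div_pow, Real.sq_sqrt hL.le, hκ]
    -- Squaring the coupling requires log(1/ε) > 0, which is where ε < 1 enters.
    field_simp
  have hβL : β ^ 2 / L = 2 * κ := by rw [hκ]; field_simp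
  have hκ0 : 0 ≤ κ := by positivity
  set A : PathSpace t → Lp ℝ 2 (volume : Measure (ℝ × Plane)) := pathKernel hφψ x with hA
  have hJ : ∀ w w' : PathSpace t, interaction (correlation P V) w w' = inner ℝ (A w) (A w') :=
    hV.interaction_eq x hξ
  set ζ := zeta β ε (correlation P V) W with hζ
  have hi : Integrable (fun w => Real.exp (κ * inner ℝ (A w) (A w))) W :=
    integrable_exp_mul_inner_self x hκ0
  set Z := ∫ w, Real.exp (κ * inner ℝ (A w) (A w)) ∂W with hZ
  have hZ0 : 0 < Z := integral_exp_pos hi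
  have hζZ : ζ = Real.log Z := by
    rw [hζ, zeta]
    simp only [hJ]
    rfl
  set ρ : PathSpace t → ℝ := fun w => Real.exp (κ * inner ℝ (A w) (A w) - ζ) with hρ
  have hρZ : ρ = fun w => Real.exp (κ * inner ℝ (A w) (A w)) / Z := by
    ext w
    rw [hρ]
    simp only
    rw [Real.exp_sub, hζZ, Real.exp_log hZ0]
  have hρi : Integrable ρ W := by
    rw [hρZ]
    exact hi.div_const Z
  have hρ1 : ∫ w, ρ w ∂W = 1 := by
    rw [hρZ, integral_div, div_self hZ0.ne']
  have htilt : tiltedMeasure β ε (correlation P V) W =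
      W.withDensity fun w => ENNReal.ofReal (ρ w) := by
    rw [tiltedMeasure]
    simp only [hJ]
    rfl
  have hFK : ∀ᵐ ω ∂P, u t x ω = ∫ w, noiseWeight x b X w ω ∂W := by
    have hu' : ∀ᵐ ω ∂P, IsSolution b (fun s y => X (s, y) ω) (fun s y => u s y ω) := by
      filter_upwards [hu, hVX] with ω h1 h2
      simpa only [h2] using h1
    filter_upwards [hX.feynmanKac_ae ht x hξ hW hu'] with ω hω
    simpa only [weight_eq_noiseWeight] using hω
  have hpow : (fun ω => u t x ω ^ n) =ᵐ[P] fun ω => (∫ w, noiseWeight x b X w ω ∂W) ^ n := by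
    filter_upwards [hFK] with ω hω
    rw [hω]
  obtain ⟨hm1, hm2⟩ := hX.integrable_pow_and_integral_pow (W := W) x b n ht hξ
  have hpi : (Measure.pi fun _ : Fin n => tiltedMeasure β ε (correlation P V) W) =
      (Measure.pi fun _ : Fin n => W).withDensity fun B => ENNReal.ofReal (∏ i, ρ (B i)) := by
    rw [htilt]
    exact pi_withDensity_ofReal W (fun w => (Real.exp_pos _).le) hρi
  -- The algebraic core: with b²/2 = κ, the diagonal of the expanded square is the exponent of the
  -- product density up to nζ, and each off-diagonal pair i < j appears twice, giving 2κ = β²/L.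
  have hkey : ∀ B : Fin n → PathSpace t,
      (∏ i, ρ (B i)) * Real.exp (β ^ 2 / L *
        ∑ i : Fin n, ∑ j ∈ Finset.Ioi i, interaction (correlation P V) (B i) (B j)) =
      Real.exp (-(n * ζ)) * Real.exp (b ^ 2 * ‖∑ i, A (B i)‖ ^ 2 / 2) := by
    intro B
    rw [hρ]
    simp only [hJ]
    rw [← Real.exp_sum, ← Real.exp_add, ← Real.exp_add, norm_sum_sq_eq, hb2, hβL,
      Finset.sum_sub_distrib, ← Finset.mul_sum]
    simp only [Finset.sum_const, Finset.card_univ, Fintype.card_fin, nsmul_eq_mul]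
    congr 1
    ring
  have hρc : Continuous ρ := by
    have := continuous_pathKernel hφψ x (t := t)
    fun_prop
  have hρm : Measurable fun B : Fin n → PathSpace t => ENNReal.ofReal (∏ i, ρ (B i)) :=
    (continuous_finsetProd _ fun i _ => hρc.comp (continuous_apply i)).measurable.ennreal_ofReal
  have hρ0 : ∀ B : Fin n → PathSpace t, 0 ≤ ∏ i, ρ (B i) := fun B =>
    Finset.prod_nonneg fun i _ => (Real.exp_pos _).le
  refine ⟨?_, hm1.congr hpow.symm, ?_, ?_⟩
  · rw [htilt]
    refine ⟨?_⟩
    rw [withDensity_apply _ MeasurableSet.univ, Measure.restrict_univ,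
      ← ofReal_integral_eq_lintegral_ofReal hρi
        (Filter.Eventually.of_forall fun w => (Real.exp_pos _).le), hρ1, ENNReal.ofReal_one]
  · rw [hpi, integrable_withDensity_iff hρm (Filter.Eventually.of_forall fun _ => ENNReal.ofReal_lt_top)]
    have := (integrable_exp_mul_norm_sq (h := hφψ) (W := W) (n := n) x
      (θ := b ^ 2 / 2) (by positivity)).const_mul (Real.exp (-(n * ζ)))
    refine this.congr (Filter.Eventually.of_forall fun B => ?_)
    simp only
    rw [ENNReal.toReal_ofReal (hρ0 B), mul_comm (Real.exp (β ^ 2 / L * _)), hkey]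
    congr 2
    ring
  · rw [hpi, integral_withDensity_eq_integral_toReal_smul hρm
      (Filter.Eventually.of_forall fun _ => ENNReal.ofReal_lt_top), integral_congr_ae hpow, hm2,
      ← integral_const_mul]
    refine integral_congr_ae (Filter.Eventually.of_forall fun B => ?_)
    simp only [smul_eq_mul]
    rw [ENNReal.toReal_ofReal (hρ0 B), hkey]
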